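/- Let $p\ge 1$ be an integer, $q=e^{2\pi i/p}$, $R=\mathbb{C}[z,z^{-1}]$, and let $\sigma$ be the automorphism of $R$ over $\mathbb{C}$ with $\sigma(z)=q^{-1}z$. Let $\omega=\{(z-q^k)\mid 0\le k\le p-1\}$, which is an orbit of $\sigma$ on the maximal ideals of $R$, and let $\mathsf{M}\subset R$ be the multiplicative monoid generated by the elements $z-q^k$, $0\le k\le p-1$. For $t\in\mathsf{M}$ let $A(t)$ be the generalized Weyl algebra obtained from $R$ by adjoining generators $X,Y$ with relations $Xr=\sigma(r)X$, $Yr=\sigma^{-1}(r)Y$ $(r\in R)$, $YX=t$, $XY=\sigma(t)$. Let $A(t)\text{-wmod}_\omega$ be the category of $A(t)$-modules $V$ such that $V=\bigoplus_{\mathfrak{m}}V_{\mathfrak m}$, the sum being over the maximal ideals of $R$ and $V_{\mathfrak m}=\{v\in V\mid \mathfrak{m}v=0\}$, such that $V_{\mathfrak m}=0$ for $\mathfrak m\notin\omega$, and such that every $V_{\mathfrak m}$ is finite dimensional over $R/\mathfrak m$. Let $K_0(A(t)\text{-wmod}_\omega)$ be its Grothendieck group, with relations $[V]=[U]+[W]$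 for all short exact sequences $0\to U\to V\to W\to 0$, and let $$\mathscr{A}(\omega,\mathsf{M})=\bigoplus_{t\in\mathsf{M}}\mathbb{C}\otimes_{\mathbb{Z}}K_0(A(t)\text{-wmod}_\omega),$$ a commutative $\mathsf{M}$-graded $\mathbb{C}$-algebra with product $[V][W]=[V\otimes_R W]$, where for an $A(t)$-module $V$ and an $A(t')$-module $W$ the generators $X$ and $Y$ of $A(tt')$ act on $V\otimes_R W$ by $X\otimes X$ and $Y\otimes Y$. For $\xi\in\mathbb{C}^\times$ let $u_\xi\in\mathscr{A}(\omega,\mathsf{M})$ be the class of the $A(1)$-module with $\mathbb{C}$-basis $e_k$ $(k\in\mathbb{Z}/p\mathbb{Z})$ and action $f e_k=f(q^k)e_k$ $(f\in R)$, $Xe_k=e_{k+1}$ and $Ye_{k+1}=e_k$ for $k\ne 0$, $Xe_0=\xi e_1$, $Ye_1=\xi^{-1}e_0$. Let $\mathscr{A}(p)$ be the quotient of $\mathscr{A}(\omega,\mathsf{M})$ by the ideal generated by $u_\xi-1$, $\xi\in\mathbb{C}^\times$. The map $\mathbb{N}^p\to\mathsf{M}$, $d=(d_1,\dots,d_p)\mapsto\prod_{k=0}^{p-1}(z-q^k)^{d_{k+1}}$,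 is bijective, and the algebra $\mathscr{A}(p)$ is $\mathbb{N}^p$-graded, the component $\mathscr{A}(p)_d$ being the image of the component of $\mathscr{A}(\omega,\mathsf{M})$ of the corresponding degree in $\mathsf{M}$. All the spaces $\mathscr{A}(p)_d$ are finite dimensional, and the following hold. (a) In $\mathbb{Q}[[T_1,\dots,T_p]]$, $$\sum_{d\in\mathbb{N}^p}(\dim\mathscr{A}(p)_d)\,T_1^{d_1}\cdots T_p^{d_p}=-1+\frac{2+T_1+T_2+\cdots+T_p}{(1-T_1)(1-T_2)\cdots(1-T_p)}.$$ (b) For $n\ge 0$ let $\mathscr{A}(p)_n=\sum_{d_1+\cdots+d_p=n}\mathscr{A}(p)_d$; it is finite dimensional. The Hilbert series of $\mathscr{A}(p)$ is $$H_{\mathscr{A}(p)}(T)=\sum_{n\ge0}(\dim\mathscr{A}(p)_n)\,T^n=-1+\frac{2+pT}{(1-T)^p}.$$ -/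

import Mathlib

open scoped TensorProduct LaurentPolynomial

/-! ### Generalized Weyl algebras -/

/-- Generators of a generalized Weyl algebra: the elements of `R`, and the two letters `X`, `Y`. -/
inductive GWAGen (R : Type) : Type
  | coe (r : R) : GWAGen R
  | X : GWAGen R
  | Y : GWAGen R

/-- The defining relations of the generalized Weyl algebra: `R` is a subring of coefficients
(first four relations), and `X r = σ(r) X`, `Y r = σ⁻¹(r) Y`, `Y X = t`, `X Y = σ(t)`. -/
inductive GWARel {R : Type} [CommRing R] (σ : R ≃+* R) (t : R) :
    FreeAlgebra ℤ (GWAGen R) → FreeAlgebra ℤ (GWAGen R) → Prop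
  | coe_one : GWARel σ t (FreeAlgebra.ι ℤ (.coe 1)) 1
  | coe_zero : GWARel σ t (FreeAlgebra.ι ℤ (.coe 0)) 0
  | coe_mul (r s : R) : GWARel σ t (FreeAlgebra.ι ℤ (.coe (r * s)))
      (FreeAlgebra.ι ℤ (.coe r) * FreeAlgebra.ι ℤ (.coe s))
  | coe_add (r s : R) : GWARel σ t (FreeAlgebra.ι ℤ (.coe (r + s)))
      (FreeAlgebra.ι ℤ (.coe r) + FreeAlgebra.ι ℤ (.coe s))
  | X_coe (r : R) : GWARel σ t (FreeAlgebra.ι ℤ .X * FreeAlgebra.ι ℤ (.coe r))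
      (FreeAlgebra.ι ℤ (.coe (σ r)) * FreeAlgebra.ι ℤ .X)
  | Y_coe (r : R) : GWARel σ t (FreeAlgebra.ι ℤ .Y * FreeAlgebra.ι ℤ (.coe r))
      (FreeAlgebra.ι ℤ (.coe (σ.symm r)) * FreeAlgebra.ι ℤ .Y)
  | Y_X : GWARel σ t (FreeAlgebra.ι ℤ .Y * FreeAlgebra.ι ℤ .X) (FreeAlgebra.ι ℤ (.coe t))
  | X_Y : GWARel σ t (FreeAlgebra.ι ℤ .X * FreeAlgebra.ι ℤ .Y) (FreeAlgebra.ι ℤ (.coe (σ t)))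

/-- The generalized Weyl algebra `A(R, σ, t)` of rank one. -/
def GWA {R : Type} [CommRing R] (σ : R ≃+* R) (t : R) : Type := RingQuot (GWARel σ t)

namespace GWA

variable {R : Type} [CommRing R] {σ : R ≃+* R} {t : R}

noncomputable instance : Ring (GWA σ t) := inferInstanceAs (Ring (RingQuot (GWARel σ t)))

/-- The quotient map from the free ring. -/
noncomputable def mk (σ : R ≃+* R) (t : R) : FreeAlgebra ℤ (GWAGen R) →+* GWA σ t :=
  RingQuot.mkRingHom (GWARel σ t)

theorem mk_surjective : Function.Surjective (mk σ t) := RingQuot.mkRingHom_surjective _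

theorem mk_rel {a b : FreeAlgebra ℤ (GWAGen R)} (h : GWARel σ t a b) : mk σ t a = mk σ t b :=
  RingQuot.mkRingHom_rel h

/-- The canonical ring homomorphism `R → A(R, σ, t)`. -/
noncomputable def coeff (σ : R ≃+* R) (t : R) : R →+* GWA σ t where
  toFun r := mk σ t (FreeAlgebra.ι ℤ (.coe r))
  map_one' := by rw [mk_rel .coe_one, map_one]
  map_zero' := by rw [mk_rel .coe_zero, map_zero]
  map_mul' r s := by rw [mk_rel (.coe_mul r s), map_mul]
  map_add' r s := by rw [mk_rel (.coe_add r s), map_add]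

/-- The generator `X` of `A(R, σ, t)`. -/
noncomputable def X (σ : R ≃+* R) (t : R) : GWA σ t := mk σ t (FreeAlgebra.ι ℤ .X)

/-- The generator `Y` of `A(R, σ, t)`. -/
noncomputable def Y (σ : R ≃+* R) (t : R) : GWA σ t := mk σ t (FreeAlgebra.ι ℤ .Y)

theorem X_mul_coeff (r : R) : X σ t * coeff σ t r = coeff σ t (σ r) * X σ t := by
  have := mk_rel (GWARel.X_coe (σ := σ) (t := t) r)
  rwa [map_mul, map_mul] at this

theorem Y_mul_coeff (r : R) : Y σ t * coeff σ t r = coeff σ t (σ.symm r) * Y σ t := by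
  have := mk_rel (GWARel.Y_coe (σ := σ) (t := t) r)
  rwa [map_mul, map_mul] at this

theorem Y_mul_X : Y σ t * X σ t = coeff σ t t := by
  have := mk_rel (GWARel.Y_X (σ := σ) (t := t))
  rwa [map_mul] at this

theorem X_mul_Y : X σ t * Y σ t = coeff σ t (σ t) := by
  have := mk_rel (GWARel.X_Y (σ := σ) (t := t))
  rwa [map_mul] at this

theorem induction {P : GWA σ t → Prop} (hc : ∀ r, P (coeff σ t r)) (hX : P (X σ t))
    (hY : P (Y σ t)) (hmul : ∀ a b, P a → P b → P (a * b)) (hadd : ∀ a b, P a → P b → P (a + b))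
    (a : GWA σ t) : P a := by
  obtain ⟨a, rfl⟩ := mk_surjective a
  induction a using FreeAlgebra.induction with
  | grade0 r =>
    have : mk σ t (algebraMap ℤ _ r) = coeff σ t (r : R) := by simp
    rw [this]
    exact hc _
  | grade1 x =>
    cases x with
    | coe r => exact hc r
    | X => exact hX
    | Y => exact hY
  | mul a b ha hb => rw [map_mul]; exact hmul _ _ ha hb
  | add a b ha hb => rw [map_add]; exact hadd _ _ ha hb

/-- The universal property of `A(R, σ, t)`. -/
noncomputable def lift {S : Type} [Ring S] (f : R →+* S) (x y : S)
    (hx : ∀ r, x * f r = f (σ r) * x) (hy : ∀ r, y * f r = f (σ.symm r) * y)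
    (hyx : y * x = f t) (hxy : x * y = f (σ t)) : GWA σ t →+* S :=
  RingQuot.lift ⟨((FreeAlgebra.lift ℤ (fun g : GWAGen R => match g with
    | .coe r => f r
    | .X => x
    | .Y => y) : FreeAlgebra ℤ (GWAGen R) →ₐ[ℤ] S) : FreeAlgebra ℤ (GWAGen R) →+* S), by
      intro a b h
      cases h <;> simp [hx, hy, hyx, hxy]⟩

section lift
variable {S : Type} [Ring S] (f : R →+* S) (x y : S)
    (hx : ∀ r, x * f r = f (σ r) * x) (hy : ∀ r, y * f r = f (σ.symm r) * y)
    (hyx : y * x = f t) (hxy : x * y = f (σ t))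

theorem lift_coeff (r : R) : lift f x y hx hy hyx hxy (coeff σ t r) = f r := by
  refine (RingQuot.lift_mkRingHom_apply _ _ _).trans ?_
  simp

theorem lift_X : lift f x y hx hy hyx hxy (X σ t) = x := by
  refine (RingQuot.lift_mkRingHom_apply _ _ _).trans ?_
  simp

theorem lift_Y : lift f x y hx hy hyx hxy (Y σ t) = y := by
  refine (RingQuot.lift_mkRingHom_apply _ _ _).trans ?_
  simp

end lift

end GWA

/-! ### Weight modules -/

/-- The weight space `V_𝔪 = {v | 𝔪 v = 0}` of an `R`-module. -/
abbrev weightSpace {R : Type} [CommRing R] (V : Type) [AddCommGroup V] [Module R V]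
    (m : MaximalSpectrum R) : Submodule R V :=
  Submodule.torsionBySet R V (m.asIdeal : Set R)

/-- `V` is the direct sum of its weight spaces, its support lies in `ω`, and each `V_𝔪` is finite
dimensional over `R/𝔪` (equivalently, as `R` acts on `V_𝔪` through `R/𝔪`, finitely generated
over `R`). -/
structure IsWeight {R : Type} [CommRing R] (ω : Set (MaximalSpectrum R)) (V : Type)
    [AddCommGroup V] [Module R V] : Prop where
  isInternal : letI := Classical.decEq (MaximalSpectrum R)
    DirectSum.IsInternal (fun m : MaximalSpectrum R => weightSpace V m)
  support : ∀ m : MaximalSpectrum R, weightSpace V m ≠ ⊥ → m ∈ ω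
  finite : ∀ m : MaximalSpectrum R, Module.Finite R (weightSpace V m)

section weight
variable {R : Type} [CommRing R] {ω : Set (MaximalSpectrum R)}
  {V : Type} [AddCommGroup V] [Module R V] {W : Type} [AddCommGroup W] [Module R W]

theorem iSupIndep_weightSpace (V : Type) [AddCommGroup V] [Module R V] :
    iSupIndep (fun m : MaximalSpectrum R => weightSpace V m) := by
  rw [iSupIndep_iff_supIndep]
  intro s
  apply Submodule.supIndep_torsionBySet_ideal
  intro m _ n _ hmn
  exact Ideal.isCoprime_iff_sup_eq.mp
    (Ideal.isCoprime_of_isMaximal (fun h => hmn (MaximalSpectrum.ext h)))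

theorem IsWeight.iSup_eq_top (h : IsWeight ω V) : ⨆ m ∈ ω, weightSpace V m = ⊤ := by
  classical
  have h1 := DirectSum.IsInternal.submodule_iSup_eq_top h.isInternal
  rw [eq_top_iff, ← h1]
  refine iSup_le fun m => ?_
  by_cases hm : weightSpace V m = ⊥
  · rw [hm]; exact bot_le
  · exact le_iSup₂_of_le m (h.support m hm) le_rfl

/-- A convenient criterion for being a weight module: it suffices to exhibit finitely generated
subspaces of the weight spaces in `ω` which together span. -/
theorem IsWeight.of_le (g : MaximalSpectrum R → Submodule R V)
    (hg : ∀ m, g m ≤ weightSpace V m) (hfin : ∀ m, (g m).FG) (hω : ∀ m, m ∉ ω → g m = ⊥)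
    (htop : ⨆ m, g m = ⊤) : IsWeight ω V := by
  classical
  have hind := iSupIndep_weightSpace (R := R) V
  have heq : ∀ m, weightSpace V m = g m := by
    intro m
    refine le_antisymm ?_ (hg m)
    have h1 : (⊤ : Submodule R V) ≤ g m ⊔ ⨆ (j) (_ : j ≠ m), weightSpace V j := by
      rw [← htop]
      refine iSup_le fun j => ?_
      by_cases hj : j = m
      · subst hj; exact le_sup_left
      · exact le_sup_of_le_right (le_iSup₂_of_le j hj (hg j))
    calc weightSpace V m = weightSpace V m ⊓ (g m ⊔ ⨆ (j) (_ : j ≠ m), weightSpace V j) := by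
          rw [top_le_iff.mp h1, inf_top_eq]
      _ = g m ⊔ ((⨆ (j) (_ : j ≠ m), weightSpace V j) ⊓ weightSpace V m) := by
          rw [inf_comm, sup_inf_assoc_of_le _ (hg m)]
      _ ≤ g m := by
          rw [inf_comm, (hind m).eq_bot, sup_bot_eq]
  refine ⟨?_, ?_, ?_⟩
  · refine (DirectSum.isInternal_submodule_iff_iSupIndep_and_iSup_eq_top _).mpr ⟨hind, ?_⟩
    simpa only [heq] using htop
  · intro m hm
    by_contra h
    exact hm (by rw [heq, hω m h])
  · intro m
    rw [heq]
    exact Module.Finite.iff_fg.mpr (hfin m)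

theorem IsWeight.tensor (hV : IsWeight ω V) (hW : IsWeight ω W) : IsWeight ω (V ⊗[R] W) := by
  classical
  refine IsWeight.of_le (fun m => Submodule.map₂ (TensorProduct.mk R V W)
    (weightSpace V m) (weightSpace W m)) ?_ ?_ ?_ ?_
  · intro m
    rw [Submodule.map₂_le]
    intro v hv w _
    rw [Submodule.mem_torsionBySet_iff] at hv ⊢
    intro a
    have := hv a
    rw [TensorProduct.mk_apply, TensorProduct.smul_tmul', this, TensorProduct.zero_tmul]
  · intro m
    exact Submodule.FG.map₂ _ (Module.Finite.iff_fg.mp (hV.finite m))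
      (Module.Finite.iff_fg.mp (hW.finite m))
  · intro m hm
    have : weightSpace V m = ⊥ := by
      by_contra h
      exact hm (hV.support m h)
    rw [this, Submodule.map₂_bot_left]
  · have hV1 := DirectSum.IsInternal.submodule_iSup_eq_top hV.isInternal
    have hW1 := DirectSum.IsInternal.submodule_iSup_eq_top hW.isInternal
    rw [eq_top_iff, ← TensorProduct.map₂_mk_top_top_eq_top, ← hV1, ← hW1,
      Submodule.map₂_iSup_left]
    refine iSup_le fun m => ?_
    rw [Submodule.map₂_iSup_right]
    refine iSup_le fun n => ?_
    by_cases hmn : m = n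
    · subst hmn
      exact le_iSup (fun m => Submodule.map₂ (TensorProduct.mk R V W)
        (weightSpace V m) (weightSpace W m)) m
    · rw [Submodule.map₂_le]
      intro v hv w hw
      rw [Submodule.mem_torsionBySet_iff] at hv hw
      have hco : IsCoprime m.asIdeal n.asIdeal :=
        Ideal.isCoprime_of_isMaximal (fun h => hmn (MaximalSpectrum.ext h))
      obtain ⟨a, ha, b, hb, hab⟩ := Ideal.isCoprime_iff_exists.mp hco
      have h1 : v ⊗ₜ[R] w = a • (v ⊗ₜ[R] w) + b • (v ⊗ₜ[R] w) := by
        rw [← add_smul, hab, one_smul]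
      have h2 : a • v = 0 := hv ⟨a, ha⟩
      have h3 : b • w = 0 := hw ⟨b, hb⟩
      rw [TensorProduct.mk_apply, h1, TensorProduct.smul_tmul', h2, TensorProduct.zero_tmul,
        ← TensorProduct.tmul_smul, h3, TensorProduct.tmul_zero, add_zero]
      exact Submodule.zero_mem _

theorem IsWeight.isSemisimple (hV : IsWeight ω V) : IsSemisimpleModule R V := by
  classical
  refine isSemisimpleModule_of_isSemisimpleModule_submodule'
    (p := fun m : MaximalSpectrum R => weightSpace V m) (fun m => ?_)
    (DirectSum.IsInternal.submodule_iSup_eq_top hV.isInternal)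
  have : m.asIdeal.IsMaximal := m.isMaximal
  let _ : Field (R ⧸ m.asIdeal) := Ideal.Quotient.field m.asIdeal
  exact (Module.IsTorsionBySet.isSemisimpleModule_iff
    (Submodule.torsionBySet_isTorsionBySet (R := R) (M := V) (m.asIdeal : Set R))).mp inferInstance

/-- Tensoring with an `R`-module preserves injectivity into a weight module. -/
theorem IsWeight.rTensor_injective (hW : IsWeight ω W) (f : V →ₗ[R] W)
    (hf : Function.Injective f) (U : Type) [AddCommGroup U] [Module R U] :
    Function.Injective (f.rTensor U) := by
  have := hW.isSemisimple
  obtain ⟨g, hg⟩ := IsSemisimpleModule.extension_property f hf LinearMap.id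
  apply Function.LeftInverse.injective (g := g.rTensor U)
  intro x
  rw [← LinearMap.comp_apply, ← LinearMap.rTensor_comp, hg, LinearMap.rTensor_id,
    LinearMap.id_apply]

end weight

/-- An object of `A(t)-wmod_ω`: a module over `A(t) = A(R, σ, t)` which, as an `R`-module via
`R → A(t)`, is a weight module with support in `ω` and finite dimensional weight spaces. The
`R`-module structure is the restriction of scalars (`coeff_smul`), hence no extra datum. -/
structure WeightModule {R : Type} [CommRing R] (σ : R ≃+* R) (ω : Set (MaximalSpectrum R))
    (t : R) : Type 1 where
  carrier : Type
  [addCommGroup : AddCommGroup carrier]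
  [moduleCoeff : Module R carrier]
  [moduleGWA : Module (GWA σ t) carrier]
  coeff_smul : ∀ (r : R) (v : carrier), GWA.coeff σ t r • v = r • v
  isWeight : IsWeight ω carrier

attribute [instance] WeightModule.addCommGroup WeightModule.moduleCoeff WeightModule.moduleGWA

namespace WeightModule

variable {R : Type} [CommRing R] {σ : R ≃+* R} {ω : Set (MaximalSpectrum R)} {t t' t'' : R}

/-- There is a short exact sequence `0 → U → V → W → 0` of `A(t)`-modules. -/
def IsExtension (U V W : WeightModule σ ω t) : Prop :=
  ∃ (f : U.carrier →ₗ[GWA σ t] V.carrier) (g : V.carrier →ₗ[GWA σ t] W.carrier),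
    Function.Injective f ∧ Function.Exact f g ∧ Function.Surjective g

/-- An `R`-linear map that commutes with `X` and `Y` is a homomorphism of `A(t)`-modules. -/
noncomputable def homOfCommutes (V W : WeightModule σ ω t) (f : V.carrier →ₗ[R] W.carrier)
    (hX : ∀ v, f (GWA.X σ t • v) = GWA.X σ t • f v)
    (hY : ∀ v, f (GWA.Y σ t • v) = GWA.Y σ t • f v) :
    V.carrier →ₗ[GWA σ t] W.carrier where
  toFun := f
  map_add' := f.map_add
  map_smul' a := by
    refine GWA.induction (P := fun a => ∀ v, f (a • v) = a • f v) ?_ hX hY ?_ ?_ a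
    · intro r v
      rw [V.coeff_smul, W.coeff_smul, f.map_smul]
    · intro a b ha hb v
      rw [mul_smul, ha, hb, mul_smul]
    · intro a b ha hb v
      rw [add_smul, f.map_add, ha, hb, add_smul]

/-- A homomorphism of `A(t)`-modules is `R`-linear. -/
noncomputable def homCoeff {V W : WeightModule σ ω t} (f : V.carrier →ₗ[GWA σ t] W.carrier) :
    V.carrier →ₗ[R] W.carrier where
  toFun := f
  map_add' := f.map_add
  map_smul' r v := by rw [RingHom.id_apply, ← V.coeff_smul, ← W.coeff_smul, f.map_smul]

/-- The ring homomorphism `R → End(V)` given by the `R`-action. -/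
def coeffEnd (V : Type) [AddCommGroup V] [Module R V] : R →+* AddMonoid.End V :=
  Module.toAddMonoidEnd R V

/-- The `A(t)`-module determined by an `R`-module `V` and additive endomorphisms `x`, `y` of `V`
that satisfy the defining relations of `A(t)`. -/
noncomputable def ofOperators (V : Type) [AddCommGroup V] [Module R V] (x y : V →+ V)
    (hx : ∀ r v, x (r • v) = σ r • x v) (hy : ∀ r v, y (r • v) = σ.symm r • y v)
    (hyx : ∀ v, y (x v) = t • v) (hxy : ∀ v, x (y v) = σ t • v) (hV : IsWeight ω V) :
    WeightModule σ ω t :=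
  letI : Module (GWA σ t) V := Module.compHom V
    (GWA.lift (S := AddMonoid.End V) (coeffEnd V) x y
      (fun r => AddMonoidHom.ext (hx r)) (fun r => AddMonoidHom.ext (hy r))
      (AddMonoidHom.ext hyx) (AddMonoidHom.ext hxy) : GWA σ t →+* AddMonoid.End V)
  { carrier := V
    coeff_smul := fun r v =>
      DFunLike.congr_fun (GWA.lift_coeff (S := AddMonoid.End V) (coeffEnd V) x y
        (fun r => AddMonoidHom.ext (hx r)) (fun r => AddMonoidHom.ext (hy r))
        (AddMonoidHom.ext hyx) (AddMonoidHom.ext hxy) r) v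
    isWeight := hV }

section ofOperators
variable (V : Type) [AddCommGroup V] [Module R V] (x y : V →+ V)
    (hx : ∀ r v, x (r • v) = σ r • x v) (hy : ∀ r v, y (r • v) = σ.symm r • y v)
    (hyx : ∀ v, y (x v) = t • v) (hxy : ∀ v, x (y v) = σ t • v) (hV : IsWeight ω V)

theorem X_smul_ofOperators (v : (ofOperators V x y hx hy hyx hxy hV).carrier) :
    GWA.X σ t • v = (show V from x v) :=
  DFunLike.congr_fun (GWA.lift_X (S := AddMonoid.End V) (coeffEnd V) x y
        (fun r => AddMonoidHom.ext (hx r)) (fun r => AddMonoidHom.ext (hy r))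
        (AddMonoidHom.ext hyx) (AddMonoidHom.ext hxy)) v

theorem Y_smul_ofOperators (v : (ofOperators V x y hx hy hyx hxy hV).carrier) :
    GWA.Y σ t • v = (show V from y v) :=
  DFunLike.congr_fun (GWA.lift_Y (S := AddMonoid.End V) (coeffEnd V) x y
        (fun r => AddMonoidHom.ext (hx r)) (fun r => AddMonoidHom.ext (hy r))
        (AddMonoidHom.ext hyx) (AddMonoidHom.ext hxy)) v

end ofOperators

/-- The action of `X` on an `A(t)`-module, as a `σ`-semilinear map. -/
noncomputable def opX (V : WeightModule σ ω t) : V.carrier →ₛₗ[(σ : R →+* R)] V.carrier where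
  toFun v := GWA.X σ t • v
  map_add' := smul_add _
  map_smul' r v := by
    rw [← V.coeff_smul, ← mul_smul, GWA.X_mul_coeff, mul_smul, V.coeff_smul]; rfl

/-- The action of `Y` on an `A(t)`-module, as a `σ⁻¹`-semilinear map. -/
noncomputable def opY (V : WeightModule σ ω t) :
    V.carrier →ₛₗ[(σ.symm : R →+* R)] V.carrier where
  toFun v := GWA.Y σ t • v
  map_add' := smul_add _
  map_smul' r v := by
    rw [← V.coeff_smul, ← mul_smul, GWA.Y_mul_coeff, mul_smul, V.coeff_smul]; rfl

theorem opY_opX (V : WeightModule σ ω t) (v : V.carrier) : V.opY (V.opX v) = t • v := by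
  change GWA.Y σ t • GWA.X σ t • v = t • v
  rw [← mul_smul, GWA.Y_mul_X, V.coeff_smul]

theorem opX_opY (V : WeightModule σ ω t) (v : V.carrier) : V.opX (V.opY v) = σ t • v := by
  change GWA.X σ t • GWA.Y σ t • v = σ t • v
  rw [← mul_smul, GWA.X_mul_Y, V.coeff_smul]

/-- The tensor product `V ⊗_R W` of an `A(t)`-module and an `A(t')`-module, regarded as an
`A(tt')`-module through `A(tt') → A(t) ⊗_R A(t')`, `r ↦ r ⊗ 1`, `X ↦ X ⊗ X`, `Y ↦ Y ⊗ Y`. -/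
noncomputable def tensor (V : WeightModule σ ω t) (W : WeightModule σ ω t') :
    WeightModule σ ω (t * t') :=
  ofOperators (V.carrier ⊗[R] W.carrier)
    (TensorProduct.map V.opX W.opX).toAddMonoidHom
    (TensorProduct.map V.opY W.opY).toAddMonoidHom
    (fun r v => (TensorProduct.map V.opX W.opX).map_smulₛₗ r v)
    (fun r v => (TensorProduct.map V.opY W.opY).map_smulₛₗ r v)
    (fun v => by
      change TensorProduct.map V.opY W.opY (TensorProduct.map V.opX W.opX v) = _
      induction v with
      | zero => simp
      | tmul v w =>
        rw [TensorProduct.map_tmul, TensorProduct.map_tmul, opY_opX, opY_opX,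
          TensorProduct.smul_tmul_smul]
      | add a b ha hb => rw [map_add, map_add, ha, hb, smul_add])
    (fun v => by
      change TensorProduct.map V.opX W.opX (TensorProduct.map V.opY W.opY v) = _
      induction v with
      | zero => simp
      | tmul v w =>
        rw [TensorProduct.map_tmul, TensorProduct.map_tmul, opX_opY, opX_opY,
          TensorProduct.smul_tmul_smul, map_mul]
      | add a b ha hb => rw [map_add, map_add, ha, hb, smul_add])
    (V.isWeight.tensor W.isWeight)

/-- The underlying `R`-module of the tensor product is `V ⊗_R W`. -/
noncomputable def tensorEquiv (V : WeightModule σ ω t) (W : WeightModule σ ω t') :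
    (V.carrier ⊗[R] W.carrier) ≃ₗ[R] (V.tensor W).carrier :=
  LinearEquiv.refl R (V.carrier ⊗[R] W.carrier)

/-- The pure tensor `v ⊗ w`. -/
noncomputable def tmul (V : WeightModule σ ω t) (W : WeightModule σ ω t')
    (v : V.carrier) (w : W.carrier) : (V.tensor W).carrier :=
  tensorEquiv V W (v ⊗ₜ[R] w)

theorem opX_tmul (V : WeightModule σ ω t) (W : WeightModule σ ω t')
    (v : V.carrier) (w : W.carrier) :
    (V.tensor W).opX (V.tmul W v w) = V.tmul W (V.opX v) (W.opX w) :=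
  (X_smul_ofOperators (V.carrier ⊗[R] W.carrier) _ _ _ _ _ _ _ (v ⊗ₜ[R] w)).trans
    (TensorProduct.map_tmul V.opX W.opX v w)

theorem opY_tmul (V : WeightModule σ ω t) (W : WeightModule σ ω t')
    (v : V.carrier) (w : W.carrier) :
    (V.tensor W).opY (V.tmul W v w) = V.tmul W (V.opY v) (W.opY w) :=
  (Y_smul_ofOperators (V.carrier ⊗[R] W.carrier) _ _ _ _ _ _ _ (v ⊗ₜ[R] w)).trans
    (TensorProduct.map_tmul V.opY W.opY v w)

theorem tensor_induction {V : WeightModule σ ω t} {W : WeightModule σ ω t'}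
    {P : (V.tensor W).carrier → Prop} (h0 : P 0) (ht : ∀ v w, P (V.tmul W v w))
    (ha : ∀ a b, P a → P b → P (a + b)) (u : (V.tensor W).carrier) : P u :=
  TensorProduct.induction_on (motive := P) u h0 ht ha

/-- Isomorphism of an `A(t)`-module with an `A(t')`-module, to be used when `t = t'`. -/
def IsIso (V : WeightModule σ ω t) (W : WeightModule σ ω t') : Prop :=
  ∃ e : V.carrier ≃ₗ[R] W.carrier, (∀ v, e (V.opX v) = W.opX (e v)) ∧
    ∀ v, e (V.opY v) = W.opY (e v)

theorem tensor_comm (V : WeightModule σ ω t) (W : WeightModule σ ω t') :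
    IsIso (V.tensor W) (W.tensor V) := by
  let e : (V.tensor W).carrier ≃ₗ[R] (W.tensor V).carrier :=
    (tensorEquiv V W).symm.trans ((TensorProduct.comm R _ _).trans (tensorEquiv W V))
  have he : ∀ v w, e (V.tmul W v w) = W.tmul V w v := fun v w => rfl
  refine ⟨e, fun u => ?_, fun u => ?_⟩
  · induction u using tensor_induction with
    | h0 => simp only [map_zero]
    | ht v w => rw [opX_tmul, he, he, opX_tmul]
    | ha a b ha hb => simp only [map_add, ha, hb]
  · induction u using tensor_induction with
    | h0 => simp only [map_zero]
    | ht v w => rw [opY_tmul, he, he, opY_tmul]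
    | ha a b ha hb => simp only [map_add, ha, hb]

theorem tmul_zero (V : WeightModule σ ω t) (W : WeightModule σ ω t') (v : V.carrier) :
    V.tmul W v 0 = 0 := TensorProduct.tmul_zero _ v

theorem zero_tmul (V : WeightModule σ ω t) (W : WeightModule σ ω t') (w : W.carrier) :
    V.tmul W 0 w = 0 := TensorProduct.zero_tmul _ w

theorem tmul_add (V : WeightModule σ ω t) (W : WeightModule σ ω t') (v : V.carrier)
    (w w' : W.carrier) : V.tmul W v (w + w') = V.tmul W v w + V.tmul W v w' :=
  TensorProduct.tmul_add v w w'

theorem add_tmul (V : WeightModule σ ω t) (W : WeightModule σ ω t') (v v' : V.carrier)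
    (w : W.carrier) : V.tmul W (v + v') w = V.tmul W v w + V.tmul W v' w :=
  TensorProduct.add_tmul v v' w

theorem tensor_assoc (U : WeightModule σ ω t) (V : WeightModule σ ω t')
    (W : WeightModule σ ω t'') : IsIso ((U.tensor V).tensor W) (U.tensor (V.tensor W)) := by
  let e : ((U.tensor V).tensor W).carrier ≃ₗ[R] (U.tensor (V.tensor W)).carrier :=
    (tensorEquiv (U.tensor V) W).symm.trans
      ((TensorProduct.congr (tensorEquiv U V).symm (LinearEquiv.refl R _)).trans
      ((TensorProduct.assoc R _ _ _).trans
      ((TensorProduct.congr (LinearEquiv.refl R _) (tensorEquiv V W)).trans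
        (tensorEquiv U (V.tensor W)))))
  have he : ∀ u v w, e ((U.tensor V).tmul W (U.tmul V u v) w) =
      U.tmul (V.tensor W) u (V.tmul W v w) := fun u v w => rfl
  refine ⟨e, fun u => ?_, fun u => ?_⟩
  · induction u using tensor_induction with
    | h0 => simp only [map_zero]
    | ht u w =>
      induction u using tensor_induction with
      | h0 => simp only [zero_tmul, map_zero]
      | ht u v => rw [opX_tmul, opX_tmul, he, he, opX_tmul, opX_tmul]
      | ha a b ha hb => simp only [add_tmul, map_add, ha, hb]
    | ha a b ha hb => simp only [map_add, ha, hb]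
  · induction u using tensor_induction with
    | h0 => simp only [map_zero]
    | ht u w =>
      induction u using tensor_induction with
      | h0 => simp only [zero_tmul, map_zero]
      | ht u v => rw [opY_tmul, opY_tmul, he, he, opY_tmul, opY_tmul]
      | ha a b ha hb => simp only [add_tmul, map_add, ha, hb]
    | ha a b ha hb => simp only [map_add, ha, hb]

theorem IsIso.isExtension_zero {V W Z : WeightModule σ ω t} (h : IsIso V W)
    (hZ : Subsingleton Z.carrier) : IsExtension V W Z := by
  obtain ⟨e, hX, hY⟩ := h
  refine ⟨homOfCommutes V W e hX hY, 0, e.injective, ?_, ?_⟩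
  · intro w
    simp only [LinearMap.zero_apply, true_iff]
    exact e.surjective w
  · intro z
    exact ⟨0, Subsingleton.elim _ _⟩

/-- The zero module. -/
noncomputable def zero (σ : R ≃+* R) (ω : Set (MaximalSpectrum R)) (t : R) :
    WeightModule σ ω t :=
  ofOperators PUnit 0 0 (fun _ _ => rfl) (fun _ _ => rfl) (fun _ => rfl) (fun _ => rfl)
    (IsWeight.of_le (fun _ => ⊥) (fun _ => bot_le) (fun _ => Submodule.fg_bot)
      (fun _ _ => rfl) (Subsingleton.elim _ _))

/-- Tensoring is exact on weight modules. -/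
theorem IsExtension.tensor_right {U V W : WeightModule σ ω t} (h : IsExtension U V W)
    (N : WeightModule σ ω t') : IsExtension (U.tensor N) (V.tensor N) (W.tensor N) := by
  obtain ⟨f, g, hf, hfg, hg⟩ := h
  let F : (U.tensor N).carrier →ₗ[R] (V.tensor N).carrier := (homCoeff f).rTensor N.carrier
  let G : (V.tensor N).carrier →ₗ[R] (W.tensor N).carrier := (homCoeff g).rTensor N.carrier
  have hF : ∀ u n, F (U.tmul N u n) = V.tmul N (f u) n := fun u n => rfl
  have hG : ∀ u n, G (V.tmul N u n) = W.tmul N (g u) n := fun u n => rfl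
  refine ⟨homOfCommutes _ _ F (fun u => ?_) (fun u => ?_),
    homOfCommutes _ _ G (fun u => ?_) (fun u => ?_), ?_, ?_, ?_⟩
  · change F ((U.tensor N).opX u) = (V.tensor N).opX (F u)
    induction u using tensor_induction with
    | h0 => simp only [map_zero]
    | ht u w =>
      rw [opX_tmul, hF, hF, opX_tmul]
      exact congrArg (fun z => V.tmul N z (N.opX w)) (f.map_smul _ u)
    | ha a b ha hb => simp only [map_add, ha, hb]
  · change F ((U.tensor N).opY u) = (V.tensor N).opY (F u)
    induction u using tensor_induction with
    | h0 => simp only [map_zero]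
    | ht u w =>
      rw [opY_tmul, hF, hF, opY_tmul]
      exact congrArg (fun z => V.tmul N z (N.opY w)) (f.map_smul _ u)
    | ha a b ha hb => simp only [map_add, ha, hb]
  · change G ((V.tensor N).opX u) = (W.tensor N).opX (G u)
    induction u using tensor_induction with
    | h0 => simp only [map_zero]
    | ht u w =>
      rw [opX_tmul, hG, hG, opX_tmul]
      exact congrArg (fun z => W.tmul N z (N.opX w)) (g.map_smul _ u)
    | ha a b ha hb => simp only [map_add, ha, hb]
  · change G ((V.tensor N).opY u) = (W.tensor N).opY (G u)
    induction u using tensor_induction with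
    | h0 => simp only [map_zero]
    | ht u w =>
      rw [opY_tmul, hG, hG, opY_tmul]
      exact congrArg (fun z => W.tmul N z (N.opY w)) (g.map_smul _ u)
    | ha a b ha hb => simp only [map_add, ha, hb]
  · exact V.isWeight.rTensor_injective (homCoeff f) hf N.carrier
  · exact rTensor_exact (f := homCoeff f) (g := homCoeff g) N.carrier hfg hg
  · exact LinearMap.rTensor_surjective N.carrier (g := homCoeff g) hg

end WeightModule

/-! ### Grothendieck groups -/

section K0
variable {R : Type} [CommRing R]

/-- The Grothendieck group `K₀(A(t)-wmod_ω)`: the abelian group generated by the objects, subject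
to `[V] = [U] + [W]` for every short exact sequence `0 → U → V → W → 0`. -/
def K0 (σ : R ≃+* R) (ω : Set (MaximalSpectrum R)) (t : R) : Type 1 :=
  FreeAbelianGroup (WeightModule σ ω t) ⧸ AddSubgroup.closure
    {a : FreeAbelianGroup (WeightModule σ ω t) | ∃ U V W : WeightModule σ ω t,
      WeightModule.IsExtension U V W ∧
      a = FreeAbelianGroup.of V - FreeAbelianGroup.of U - FreeAbelianGroup.of W}

noncomputable instance (σ : R ≃+* R) (ω : Set (MaximalSpectrum R)) (t : R) :
    AddCommGroup (K0 σ ω t) :=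
  inferInstanceAs (AddCommGroup (FreeAbelianGroup (WeightModule σ ω t) ⧸ AddSubgroup.closure _))

namespace K0

variable {σ : R ≃+* R} {ω : Set (MaximalSpectrum R)} {t : R}

/-- The class `[V]` in the Grothendieck group. -/
noncomputable def of (V : WeightModule σ ω t) : K0 σ ω t :=
  QuotientAddGroup.mk (FreeAbelianGroup.of V)

/-- An additive function on objects induces a homomorphism on the Grothendieck group. -/
noncomputable def lift {G : Type*} [AddCommGroup G] (φ : WeightModule σ ω t → G)
    (h : ∀ U V W, WeightModule.IsExtension U V W → φ V = φ U + φ W) : K0 σ ω t →+ G :=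
  QuotientAddGroup.lift _ (FreeAbelianGroup.lift φ) (by
    rw [AddSubgroup.closure_le]
    rintro a ⟨U, V, W, hE, rfl⟩
    simp [AddMonoidHom.mem_ker, h U V W hE])

theorem lift_of {G : Type*} [AddCommGroup G] (φ : WeightModule σ ω t → G)
    (h : ∀ U V W, WeightModule.IsExtension U V W → φ V = φ U + φ W) (V : WeightModule σ ω t) :
    lift φ h (of V) = φ V := by
  refine (QuotientAddGroup.lift_mk _ _ _).trans ?_
  simp

theorem hom_ext {G : Type*} [AddCommGroup G] {f g : K0 σ ω t →+ G}
    (h : ∀ V, f (of V) = g (of V)) : f = g := by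
  refine QuotientAddGroup.addMonoidHom_ext _ ?_
  ext V
  exact h V

theorem of_eq_add {U V W : WeightModule σ ω t} (h : WeightModule.IsExtension U V W) :
    of V = of U + of W := by
  have : of V - of U - of W = 0 :=
    (QuotientAddGroup.eq_zero_iff _).mpr (AddSubgroup.subset_closure ⟨U, V, W, h, rfl⟩)
  rw [sub_sub, sub_eq_zero] at this
  exact this

theorem of_eq_zero (Z : WeightModule σ ω t) (hZ : Subsingleton Z.carrier) : of Z = 0 := by
  have h : WeightModule.IsIso Z Z := ⟨LinearEquiv.refl R _, fun _ => rfl, fun _ => rfl⟩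
  have := of_eq_add (h.isExtension_zero hZ)
  simpa using this

theorem of_eq_of_isIso {V W : WeightModule σ ω t} (h : WeightModule.IsIso V W) :
    of V = of W := by
  have hZ : Subsingleton (WeightModule.zero σ ω t).carrier :=
    inferInstanceAs (Subsingleton PUnit)
  have := of_eq_add (h.isExtension_zero hZ)
  rw [of_eq_zero _ hZ, add_zero] at this
  exact this.symm

end K0

end K0

/-! ### The Grothendieck ring `𝒜(ω, M)` -/

section GrothendieckRing
variable {R : Type} [CommRing R]

/-- The `ℂ`-vector space `𝒜(ω, M) = ⨁_{t ∈ M} ℂ ⊗_ℤ K₀(A(t)-wmod_ω)`. -/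
def GrothendieckRing (σ : R ≃+* R) (ω : Set (MaximalSpectrum R)) (M : Submonoid R) : Type 1 :=
  DirectSum M (fun t => ℂ ⊗[ℤ] K0 σ ω (t : R))

namespace GrothendieckRing

variable {σ : R ≃+* R} {ω : Set (MaximalSpectrum R)} {M : Submonoid R}

noncomputable instance : AddCommGroup (GrothendieckRing σ ω M) :=
  inferInstanceAs (AddCommGroup (DirectSum M (fun t => ℂ ⊗[ℤ] K0 σ ω (t : R))))

noncomputable instance : Module ℂ (GrothendieckRing σ ω M) :=
  inferInstanceAs (Module ℂ (DirectSum M (fun t => ℂ ⊗[ℤ] K0 σ ω (t : R))))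

open scoped Classical in
/-- The inclusion of the component of degree `t`. -/
noncomputable def incl (σ : R ≃+* R) (ω : Set (MaximalSpectrum R)) {M : Submonoid R} (t : M) :
    (ℂ ⊗[ℤ] K0 σ ω (t : R)) →ₗ[ℂ] GrothendieckRing σ ω M :=
  DirectSum.lof ℂ M (fun t => ℂ ⊗[ℤ] K0 σ ω (t : R)) t

/-- The class `[V]` of an `A(t)`-module, placed in degree `t`. -/
noncomputable def cls (t : M) (V : WeightModule σ ω (t : R)) : GrothendieckRing σ ω M :=
  incl σ ω t (1 ⊗ₜ[ℤ] K0.of V)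

open scoped Classical in
/-- A linear map out of `𝒜(ω, M)` given by a family of additive functions on objects. -/
noncomputable def lift {E : Type*} [AddCommGroup E] [Module ℂ E]
    (φ : ∀ t : M, WeightModule σ ω (t : R) → E)
    (h : ∀ t U V W, WeightModule.IsExtension U V W → φ t V = φ t U + φ t W) :
    GrothendieckRing σ ω M →ₗ[ℂ] E :=
  DirectSum.toModule ℂ M E
    (fun t => LinearMap.liftBaseChange ℂ (K0.lift (φ t) (h t)).toIntLinearMap)

theorem lift_cls {E : Type*} [AddCommGroup E] [Module ℂ E]
    (φ : ∀ t : M, WeightModule σ ω (t : R) → E)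
    (h : ∀ t U V W, WeightModule.IsExtension U V W → φ t V = φ t U + φ t W)
    (t : M) (V : WeightModule σ ω (t : R)) : lift φ h (cls t V) = φ t V := by
  classical
  refine (DirectSum.toModule_lof ℂ t _).trans ?_
  rw [LinearMap.liftBaseChange_tmul, one_smul]
  exact K0.lift_of (φ t) (h t) V

theorem hom_ext {E : Type*} [AddCommGroup E] [Module ℂ E]
    {f g : GrothendieckRing σ ω M →ₗ[ℂ] E} (h : ∀ t V, f (cls t V) = g (cls t V)) : f = g := by
  classical
  refine DirectSum.linearMap_ext ℂ fun t => ?_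
  refine TensorProduct.AlgebraTensorModule.curry_injective ?_
  ext x
  have h2 : ((f.comp (incl σ ω t)).toAddMonoidHom.comp
      (TensorProduct.mk ℤ ℂ (K0 σ ω (t : R)) 1).toAddMonoidHom) =
      ((g.comp (incl σ ω t)).toAddMonoidHom.comp
      (TensorProduct.mk ℤ ℂ (K0 σ ω (t : R)) 1).toAddMonoidHom) :=
    K0.hom_ext (fun V => h t V)
  exact DFunLike.congr_fun h2 x

theorem cls_eq_add (t : M) {U V W : WeightModule σ ω (t : R)}
    (h : WeightModule.IsExtension U V W) : cls t V = cls t U + cls t W := by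
  rw [cls, K0.of_eq_add h, TensorProduct.tmul_add, map_add]
  rfl

theorem cls_eq_of_isIso {t t' : M} (ht : t = t') {V : WeightModule σ ω (t : R)}
    {W : WeightModule σ ω (t' : R)} (h : WeightModule.IsIso V W) : cls t V = cls t' W := by
  subst ht
  rw [cls, K0.of_eq_of_isIso h]
  rfl

/-- Multiplication by the class `[V]`: the linear map `[W] ↦ [V ⊗_R W]`. -/
noncomputable def mulCls (t : M) (V : WeightModule σ ω (t : R)) :
    GrothendieckRing σ ω M →ₗ[ℂ] GrothendieckRing σ ω M :=
  lift (fun t' W => cls (t * t') (V.tensor W)) (fun t' A B C h => by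
    have hc : ∀ W : WeightModule σ ω (t' : R),
        cls (t * t') (V.tensor W) = cls (t' * t) (W.tensor V) := fun W =>
      cls_eq_of_isIso (mul_comm t t') (WeightModule.tensor_comm V W)
    rw [hc, hc, hc]
    exact cls_eq_add (t' * t) (h.tensor_right V))

/-- The multiplication of `𝒜(ω, M)`: the bilinear map with `[V] [W] = [V ⊗_R W]`. -/
noncomputable def mulMap : GrothendieckRing σ ω M →ₗ[ℂ]
    GrothendieckRing σ ω M →ₗ[ℂ] GrothendieckRing σ ω M :=
  lift mulCls (fun t A B C h => by
    refine hom_ext fun t' W => ?_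
    rw [LinearMap.add_apply, mulCls, mulCls, mulCls, lift_cls, lift_cls, lift_cls]
    exact cls_eq_add (t * t') (h.tensor_right W))

noncomputable instance : Mul (GrothendieckRing σ ω M) := ⟨fun a b => mulMap a b⟩

theorem cls_mul_cls (t t' : M) (V : WeightModule σ ω (t : R)) (W : WeightModule σ ω (t' : R)) :
    cls t V * cls t' W = cls (t * t') (V.tensor W) := by
  change mulMap (cls t V) (cls t' W) = _
  rw [mulMap, lift_cls, mulCls, lift_cls]

protected theorem mul_comm' (a b : GrothendieckRing σ ω M) : a * b = b * a := by
  have : (mulMap : GrothendieckRing σ ω M →ₗ[ℂ] _) = mulMap.flip := by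
    refine hom_ext fun t V => hom_ext fun t' W => ?_
    change cls t V * cls t' W = cls t' W * cls t V
    rw [cls_mul_cls, cls_mul_cls]
    exact cls_eq_of_isIso (mul_comm t t') (WeightModule.tensor_comm V W)
  exact DFunLike.congr_fun (DFunLike.congr_fun this a) b

protected theorem mul_assoc' (a b c : GrothendieckRing σ ω M) : a * b * c = a * (b * c) := by
  let L : GrothendieckRing σ ω M →ₗ[ℂ] GrothendieckRing σ ω M →ₗ[ℂ]
      GrothendieckRing σ ω M →ₗ[ℂ] GrothendieckRing σ ω M :=
    LinearMap.mk₂ ℂ (fun a b => mulMap (mulMap a b))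
      (fun _ _ _ => by simp) (fun _ _ _ => by simp) (fun _ _ _ => by simp) (fun _ _ _ => by simp)
  let N : GrothendieckRing σ ω M →ₗ[ℂ] GrothendieckRing σ ω M →ₗ[ℂ]
      GrothendieckRing σ ω M →ₗ[ℂ] GrothendieckRing σ ω M :=
    LinearMap.mk₂ ℂ (fun a b => (mulMap a).comp (mulMap b))
      (fun _ _ _ => by rw [map_add, LinearMap.add_comp])
      (fun _ _ _ => by rw [map_smul, LinearMap.smul_comp])
      (fun _ _ _ => by rw [map_add, LinearMap.comp_add])
      (fun _ _ _ => by rw [map_smul, LinearMap.comp_smul])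
  have hLN : L = N := by
    refine hom_ext fun t U => hom_ext fun t' V => hom_ext fun t'' W => ?_
    change cls t U * cls t' V * cls t'' W = cls t U * (cls t' V * cls t'' W)
    rw [cls_mul_cls, cls_mul_cls, cls_mul_cls, cls_mul_cls]
    exact cls_eq_of_isIso (mul_assoc t t' t'') (WeightModule.tensor_assoc U V W)
  exact DFunLike.congr_fun (DFunLike.congr_fun (DFunLike.congr_fun hLN a) b) c

/-- `𝒜(ω, M)` is a commutative ring as soon as there is a unit object, that is an `A(1)`-module `I`
with `I ⊗_R V ≅ V` for all `V`. -/
@[reducible]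
noncomputable def commRingOfUnit (I : WeightModule σ ω ((1 : M) : R))
    (hI : ∀ (t : M) (V : WeightModule σ ω (t : R)), WeightModule.IsIso (I.tensor V) V) :
    CommRing (GrothendieckRing σ ω M) :=
  have one_mul' : ∀ a : GrothendieckRing σ ω M, cls 1 I * a = a := fun a => by
    have h : mulMap (cls 1 I) = (LinearMap.id : GrothendieckRing σ ω M →ₗ[ℂ] _) := by
      refine hom_ext fun t V => ?_
      change cls 1 I * cls t V = cls t V
      rw [cls_mul_cls]
      exact cls_eq_of_isIso (one_mul t) (hI t V)
    exact DFunLike.congr_fun h a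
  { (inferInstance : AddCommGroup (GrothendieckRing σ ω M)),
    (inferInstance : Mul (GrothendieckRing σ ω M)) with
    one := cls 1 I
    one_mul := one_mul'
    mul_one := fun a => (GrothendieckRing.mul_comm' a _).trans (one_mul' a)
    mul_comm := GrothendieckRing.mul_comm'
    mul_assoc := GrothendieckRing.mul_assoc'
    left_distrib := fun a b c => (mulMap a).map_add b c
    right_distrib := fun a b c => LinearMap.map_add₂ mulMap a b c
    zero_mul := fun a => LinearMap.map_zero₂ mulMap a
    mul_zero := fun a => (mulMap a).map_zero }

end GrothendieckRing

end GrothendieckRing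

/-! ### The case `R = ℂ[z, z⁻¹]`, `σ(z) = q⁻¹ z`, `q = exp(2πi/p)` -/

namespace RootOfUnityGWA

open LaurentPolynomial

/-- The root of unity `q = exp(2πi/p)`. -/
noncomputable def q (p : ℕ) : ℂˣ :=
  Units.mk0 (Complex.exp (2 * Real.pi * Complex.I / p)) (Complex.exp_ne_zero _)

/-- The variable `z` as a unit of `ℂ[z, z⁻¹]`. -/
noncomputable def z : (ℂ[T;T⁻¹])ˣ where
  val := T 1
  inv := T (-1)
  val_inv := by rw [← T_add]; simp
  inv_val := by rw [← T_add]; simp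

theorem ringHom_ext {S : Type} [CommRing S] {f g : ℂ[T;T⁻¹] →+* S}
    (hC : ∀ c : ℂ, f (C c) = g (C c)) (hT : f (T 1) = g (T 1)) : f = g := by
  refine IsLocalization.ringHom_ext (Submonoid.powers (Polynomial.X : Polynomial ℂ)) ?_
  refine Polynomial.ringHom_ext (fun c => ?_) ?_
  · simpa using hC c
  · simpa using hT

/-- The endomorphism `f(z) ↦ f(a z)` of `ℂ[z, z⁻¹]`. -/
noncomputable def scale (a : ℂˣ) : ℂ[T;T⁻¹] →+* ℂ[T;T⁻¹] :=
  LaurentPolynomial.eval₂ C (Units.map (C : ℂ →+* ℂ[T;T⁻¹]).toMonoidHom a * z)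

theorem scale_C (a : ℂˣ) (c : ℂ) : scale a (C c) = C c := eval₂_C _ _ c

theorem scale_T (a : ℂˣ) : scale a (T 1) = C (a : ℂ) * T 1 := by
  rw [scale, eval₂_T, zpow_one]; rfl

theorem scale_comp (a b : ℂˣ) (h : a * b = 1) : (scale a).comp (scale b) = RingHom.id _ := by
  refine ringHom_ext (fun c => ?_) ?_
  · simp [scale_C]
  · rw [RingHom.comp_apply, scale_T, map_mul, scale_C, scale_T, ← mul_assoc, ← map_mul,
      ← Units.val_mul, mul_comm b a, h]
    simp

/-- The automorphism `σ` of `ℂ[z, z⁻¹]` with `σ(z) = q⁻¹ z`. -/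
noncomputable def σ (p : ℕ) : ℂ[T;T⁻¹] ≃+* ℂ[T;T⁻¹] :=
  RingEquiv.ofRingHom (scale (q p)⁻¹) (scale (q p))
    (scale_comp _ _ (inv_mul_cancel _)) (scale_comp _ _ (mul_inv_cancel _))

/-- The elements `z - q^k`, `0 ≤ k ≤ p - 1`. -/
noncomputable def lin (p : ℕ) (k : Fin p) : ℂ[T;T⁻¹] := T 1 - C ((q p : ℂ) ^ (k : ℕ))

/-- The orbit `ω = {(z - q^k) | 0 ≤ k ≤ p - 1}` of the maximal ideal `(z - 1)` under `σ`. -/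
def ω (p : ℕ) : Set (MaximalSpectrum ℂ[T;T⁻¹]) :=
  {m | ∃ k : Fin p, m.asIdeal = Ideal.span {lin p k}}

/-- The multiplicative monoid `M` generated by the elements `z - q^k`. -/
noncomputable def M (p : ℕ) : Submonoid ℂ[T;T⁻¹] := Submonoid.closure (Set.range (lin p))

/-- The map `ℕ^p → M`, `d ↦ ∏ (z - q^k)^{d_k}`. -/
noncomputable def toM (p : ℕ) : Multiplicative (Fin p →₀ ℕ) →* M p where
  toFun d := ⟨∏ k, lin p k ^ (d.toAdd k), Submonoid.prod_mem _ fun k _ =>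
    Submonoid.pow_mem _ (Submonoid.subset_closure (Set.mem_range_self k)) _⟩
  map_one' := Subtype.ext (by simp)
  map_mul' d e := Subtype.ext (by simp [pow_add, Finset.prod_mul_distrib])

section modules
variable (p : ℕ)

/-- Evaluation at the points `q^k` of the orbit, `f ↦ (f(q^k))_k`. -/
noncomputable def evalOrbit : ℂ[T;T⁻¹] →+* (Fin p → ℂ) :=
  RingHom.pi fun k => LaurentPolynomial.eval₂ (RingHom.id ℂ) (q p ^ (k : ℕ))

theorem evalOrbit_C (c : ℂ) (k : Fin p) : evalOrbit p (C c) k = c := eval₂_C _ _ c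

theorem evalOrbit_T (k : Fin p) : evalOrbit p (T 1) k = (q p : ℂ) ^ (k : ℕ) := by
  refine (eval₂_T _ _ 1).trans ?_
  simp

/-- The space `⨁_k ℂ e_k`, `0 ≤ k ≤ p - 1`, on which `f ∈ ℂ[z, z⁻¹]` acts by `f e_k = f(q^k) e_k`;
that is, `⨁_k R/(z - q^k)`. -/
def OrbitSpace (p : ℕ) : Type := Fin p → ℂ

noncomputable instance : AddCommGroup (OrbitSpace p) := inferInstanceAs (AddCommGroup (Fin p → ℂ))

noncomputable instance : Module ℂ[T;T⁻¹] (OrbitSpace p) :=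
  Module.compHom (Fin p → ℂ) (evalOrbit p)

theorem orbit_smul (f : ℂ[T;T⁻¹]) (v : OrbitSpace p) (k : Fin p) :
    (f • v) k = evalOrbit p f k * v k := rfl

theorem sub_C_mem (k : Fin p) (f : ℂ[T;T⁻¹]) :
    f - C (evalOrbit p f k) ∈ Ideal.span {lin p k} := by
  have : Ideal.Quotient.mk (Ideal.span {lin p k}) =
      ((Ideal.Quotient.mk (Ideal.span {lin p k})).comp C).comp
        ((Pi.evalRingHom (fun _ : Fin p => ℂ) k).comp (evalOrbit p)) := by
    refine ringHom_ext (fun c => ?_) ?_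
    · change _ = Ideal.Quotient.mk (Ideal.span {lin p k}) (C (evalOrbit p (C c) k))
      rw [evalOrbit_C]
    · change _ = Ideal.Quotient.mk (Ideal.span {lin p k}) (C (evalOrbit p (T 1) k))
      rw [evalOrbit_T, Ideal.Quotient.eq]
      exact Ideal.subset_span rfl
  rw [← Ideal.Quotient.eq]
  exact DFunLike.congr_fun this f

theorem mem_span_lin (k : Fin p) (f : ℂ[T;T⁻¹]) :
    f ∈ Ideal.span {lin p k} ↔ evalOrbit p f k = 0 := by
  constructor
  · intro h
    obtain ⟨g, rfl⟩ := Ideal.mem_span_singleton'.mp h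
    rw [map_mul, Pi.mul_apply, lin, map_sub, Pi.sub_apply, evalOrbit_T, evalOrbit_C, sub_self,
      mul_zero]
  · intro h
    have := sub_C_mem p k f
    rwa [h, map_zero, sub_zero] at this

theorem smul_eq_zero_of_evalOrbit {V : Type} [AddCommGroup V] [Module ℂ[T;T⁻¹] V]
    (hV : IsWeight (ω p) V) {f : ℂ[T;T⁻¹]} (hf : evalOrbit p f = 0) (v : V) : f • v = 0 := by
  have hle : (⊤ : Submodule ℂ[T;T⁻¹] V) ≤ LinearMap.ker (LinearMap.lsmul ℂ[T;T⁻¹] V f) := by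
    rw [← hV.iSup_eq_top]
    refine iSup₂_le fun m hm v hv => ?_
    obtain ⟨k, hk⟩ := hm
    rw [Submodule.mem_torsionBySet_iff] at hv
    exact hv ⟨f, by
      change f ∈ m.asIdeal
      rw [hk, mem_span_lin, hf]
      rfl⟩
  exact hle (Submodule.mem_top (x := v))

variable [NeZero p]

theorem isPrimitiveRoot_q : IsPrimitiveRoot (q p : ℂ) p :=
  Complex.isPrimitiveRoot_exp p (NeZero.ne p)

theorem q_pow_add_one (j : Fin p) :
    (q p : ℂ) ^ ((j + 1 : Fin p) : ℕ) = (q p : ℂ) * (q p : ℂ) ^ (j : ℕ) := by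
  have h1 : (q p : ℂ) ^ p = 1 := (isPrimitiveRoot_q p).pow_eq_one
  rw [← pow_succ', Fin.val_add, ← pow_eq_pow_mod _ h1]
  rw [pow_add, pow_add]
  congr 1
  rw [Fin.val_one', ← pow_eq_pow_mod _ h1]

theorem evalOrbit_σ (f : ℂ[T;T⁻¹]) (j : Fin p) :
    evalOrbit p (σ p f) (j + 1) = evalOrbit p f j := by
  have : ((Pi.evalRingHom (fun _ : Fin p => ℂ) (j + 1)).comp (evalOrbit p)).comp
      (σ p : ℂ[T;T⁻¹] →+* ℂ[T;T⁻¹]) = (Pi.evalRingHom (fun _ : Fin p => ℂ) j).comp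
      (evalOrbit p) := by
    refine ringHom_ext (fun c => ?_) ?_
    · change evalOrbit p (scale _ (C c)) (j + 1) = evalOrbit p (C c) j
      rw [scale_C, evalOrbit_C, evalOrbit_C]
    · change evalOrbit p (scale _ (T 1)) (j + 1) = evalOrbit p (T 1) j
      rw [scale_T, map_mul, Pi.mul_apply, evalOrbit_C, evalOrbit_T, evalOrbit_T, q_pow_add_one,
        ← mul_assoc, ← Units.val_mul, inv_mul_cancel, Units.val_one, one_mul]
  exact DFunLike.congr_fun this f

theorem evalOrbit_surjective : Function.Surjective (evalOrbit p) := by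
  intro v
  let P : Polynomial ℂ := Lagrange.interpolate Finset.univ (fun k : Fin p => (q p : ℂ) ^ (k : ℕ)) v
  refine ⟨Polynomial.toLaurent P, ?_⟩
  funext k
  refine (eval₂_toLaurent _ _ P).trans ?_
  have hinj : Set.InjOn (fun k : Fin p => (q p : ℂ) ^ (k : ℕ)) (Finset.univ : Finset (Fin p)) := by
    intro a _ b _ hab
    exact Fin.ext ((isPrimitiveRoot_q p).pow_inj a.2 b.2 hab)
  have := Lagrange.eval_interpolate_at_node v hinj (Finset.mem_univ k)
  simp only [Polynomial.eval₂_id, Units.val_pow_eq_pow_val]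
  exact this

theorem isMaximal_span_lin (k : Fin p) : (Ideal.span {lin p k}).IsMaximal := by
  have h : Ideal.span {lin p k} =
      RingHom.ker ((Pi.evalRingHom (fun _ : Fin p => ℂ) k).comp (evalOrbit p)) := by
    ext f
    rw [mem_span_lin, RingHom.mem_ker]
    rfl
  rw [h]
  refine RingHom.ker_isMaximal_of_surjective _ ?_
  exact (Function.surjective_eval k).comp (evalOrbit_surjective p)

theorem isWeight_orbitSpace : IsWeight (ω p) (OrbitSpace p) := by
  classical
  let e : Fin p → OrbitSpace p := fun k => (Pi.single k 1 : Fin p → ℂ)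
  have hsmul : ∀ (f : ℂ[T;T⁻¹]) (k : Fin p), f • e k =
      (Pi.single k (evalOrbit p f k) : Fin p → ℂ) := by
    intro f k
    funext j
    rw [orbit_smul]
    by_cases h : j = k
    · subst h; simp [e]
    · simp [e, h]
  refine IsWeight.of_le (fun m => ⨆ (k : Fin p) (_ : m.asIdeal = Ideal.span {lin p k}),
    Submodule.span _ {e k}) ?_ ?_ ?_ ?_
  · intro m
    refine iSup₂_le fun k hk => ?_
    rw [Submodule.span_singleton_le_iff_mem, Submodule.mem_torsionBySet_iff]
    rintro ⟨a, ha⟩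
    have ha' : a ∈ m.asIdeal := ha
    rw [hk, mem_span_lin] at ha'
    rw [hsmul, ha', Pi.single_zero]
    rfl
  · intro m
    refine Submodule.fg_iSup _ fun k => ?_
    by_cases hk : m.asIdeal = Ideal.span {lin p k}
    · simp only [hk, iSup_pos]
      exact Submodule.fg_span_singleton _
    · simp only [hk, iSup_false]
      exact Submodule.fg_bot
  · intro m hm
    refine iSup₂_eq_bot.mpr fun k hk => ?_
    exact absurd ⟨k, hk⟩ hm
  · rw [eq_top_iff]
    intro v _
    have hv : v = ∑ k, (C (v k) : ℂ[T;T⁻¹]) • e k := by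
      funext j
      have : (∑ k, (C (v k) : ℂ[T;T⁻¹]) • e k) j = ∑ k, ((C (v k) : ℂ[T;T⁻¹]) • e k) j :=
        Finset.sum_apply j _ _
      rw [this, Finset.sum_eq_single j]
      · rw [hsmul, evalOrbit_C, Pi.single_eq_same]
      · intro k _ hk
        rw [hsmul, evalOrbit_C, Pi.single_eq_of_ne hk.symm]
      · intro h
        exact absurd (Finset.mem_univ j) h
    rw [hv]
    refine Submodule.sum_mem _ fun k _ => Submodule.smul_mem _ _ ?_
    refine Submodule.mem_iSup_of_mem ⟨Ideal.span {lin p k}, isMaximal_span_lin p k⟩ ?_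
    refine Submodule.mem_iSup_of_mem k (Submodule.mem_iSup_of_mem rfl ?_)
    exact Submodule.mem_span_singleton_self _

/-- The `A(1)`-module `V^1(ω, 1^p, x - ξ)`: it has basis `e_k`, `k ∈ ℤ/p`, with `e_k` of weight
`(z - q^k)`, `X e_k = e_{k+1}` and `Y e_{k+1} = e_k` for `k ≠ 0`, and `X e_0 = ξ e_1`,
`Y e_1 = ξ⁻¹ e_0`. -/
noncomputable def uModule (ξ : ℂˣ) : WeightModule (σ p) (ω p) (1 : ℂ[T;T⁻¹]) :=
  WeightModule.ofOperators (OrbitSpace p)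
    { toFun := fun v k => (if k = 1 then (ξ : ℂ) else 1) * v (k - 1)
      map_zero' := funext fun k => mul_zero _
      map_add' := fun v w => funext fun k => mul_add _ _ _ }
    { toFun := fun v k => (if k = 0 then ((ξ⁻¹ : ℂˣ) : ℂ) else 1) * v (k + 1)
      map_zero' := funext fun k => mul_zero _
      map_add' := fun v w => funext fun k => mul_add _ _ _ }
    (fun f v => funext fun k => by
      obtain ⟨j, rfl⟩ : ∃ j, k = j + 1 := ⟨k - 1, by simp⟩
      change _ * (evalOrbit p f (j + 1 - 1) * v (j + 1 - 1)) =
        evalOrbit p (σ p f) (j + 1) * (_ * v (j + 1 - 1))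
      rw [evalOrbit_σ, add_sub_cancel_right]
      ring)
    (fun f v => funext fun k => by
      change _ * (evalOrbit p f (k + 1) * v (k + 1)) =
        evalOrbit p ((σ p).symm f) k * (_ * v (k + 1))
      rw [← evalOrbit_σ p ((σ p).symm f) k, RingEquiv.apply_symm_apply]
      ring)
    (fun v => funext fun k => by
      change (if k = 0 then ((ξ⁻¹ : ℂˣ) : ℂ) else 1) *
        ((if k + 1 = 1 then (ξ : ℂ) else 1) * v (k + 1 - 1)) = ((1 : ℂ[T;T⁻¹]) • v) k
      rw [one_smul, add_sub_cancel_right]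
      by_cases h : k = 0
      · simp [h]
      · simp [h])
    (fun v => funext fun k => by
      change (if k = 1 then (ξ : ℂ) else 1) *
        ((if k - 1 = 0 then ((ξ⁻¹ : ℂˣ) : ℂ) else 1) * v (k - 1 + 1)) =
          (σ p 1 • v) k
      rw [map_one, one_smul, sub_add_cancel]
      by_cases h : k = 1
      · simp [h]
      · simp [h, sub_eq_zero])
    (isWeight_orbitSpace p)

theorem unit_isIso {t : ℂ[T;T⁻¹]} (V : WeightModule (σ p) (ω p) t) :
    WeightModule.IsIso ((uModule p 1).tensor V) V := by
  let ev : ℂ[T;T⁻¹] →ₗ[ℂ[T;T⁻¹]] OrbitSpace p :=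
    { toFun := evalOrbit p
      map_add' := map_add _
      map_smul' := fun f g => map_mul (evalOrbit p) f g }
  have hev : Function.Surjective ev := evalOrbit_surjective p
  let L : OrbitSpace p →ₗ[ℂ[T;T⁻¹]] V.carrier →ₗ[ℂ[T;T⁻¹]] V.carrier :=
    ((LinearMap.ker ev).liftQ (LinearMap.lsmul ℂ[T;T⁻¹] V.carrier) (by
      intro f hf
      ext v
      exact smul_eq_zero_of_evalOrbit p V.isWeight hf v)).comp
      (ev.quotKerEquivOfSurjective hev).symm.toLinearMap
  have hL : ∀ f v, L (ev f) v = f • v := by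
    intro f v
    have h1 : (ev.quotKerEquivOfSurjective hev).symm (ev f) = Submodule.Quotient.mk f := by
      rw [LinearEquiv.symm_apply_eq]
      rfl
    simp only [L, LinearMap.comp_apply, LinearEquiv.coe_coe, h1]
    rfl
  let one : (uModule p 1).carrier := (fun _ => 1 : Fin p → ℂ)
  have hone : ∀ f : ℂ[T;T⁻¹], f • one = ev f := by
    intro f
    funext k
    exact mul_one (evalOrbit p f k)
  have hXone : (uModule p 1).opX one = one := by
    refine (WeightModule.X_smul_ofOperators (OrbitSpace p) _ _ _ _ _ _ _ one).trans ?_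
    funext k
    change (if k = 1 then ((1 : ℂˣ) : ℂ) else 1) * 1 = 1
    simp
  have hYone : (uModule p 1).opY one = one := by
    refine (WeightModule.Y_smul_ofOperators (OrbitSpace p) _ _ _ _ _ _ _ one).trans ?_
    funext k
    change (if k = 0 then (((1 : ℂˣ)⁻¹ : ℂˣ) : ℂ) else 1) * 1 = 1
    simp
  let F : ((uModule p 1).tensor V).carrier →ₗ[ℂ[T;T⁻¹]] V.carrier :=
    (TensorProduct.lift L).comp (WeightModule.tensorEquiv (uModule p 1) V).symm.toLinearMap
  let G : V.carrier →ₗ[ℂ[T;T⁻¹]] ((uModule p 1).tensor V).carrier :=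
    (WeightModule.tensorEquiv (uModule p 1) V).toLinearMap.comp
      (TensorProduct.mk ℂ[T;T⁻¹] (uModule p 1).carrier V.carrier one)
  have hF : ∀ f v, F ((uModule p 1).tmul V (ev f) v) = f • v := fun f v =>
    (TensorProduct.lift.tmul (f' := L) (ev f) v).trans (hL f v)
  have hG : ∀ v, G v = (uModule p 1).tmul V one v := fun v => rfl
  have hone' : one = ev 1 := by rw [← hone, one_smul]
  have hFG : ∀ v, F (G v) = v := by
    intro v
    rw [hG, hone', hF, one_smul]
  have hpure : ∀ (f : ℂ[T;T⁻¹]) v, (uModule p 1).tmul V (ev f) v =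
      (uModule p 1).tmul V one (f • v) := by
    intro f v
    rw [← hone]
    exact congrArg (WeightModule.tensorEquiv (uModule p 1) V) (TensorProduct.smul_tmul f one v)
  have hGF : ∀ u, G (F u) = u := by
    intro u
    induction u using WeightModule.tensor_induction with
    | h0 => simp only [map_zero]
    | ht u v =>
      obtain ⟨f, rfl⟩ := hev u
      rw [hF, hG, hpure]
    | ha a b ha hb => simp only [map_add, ha, hb]
  let E : ((uModule p 1).tensor V).carrier ≃ₗ[ℂ[T;T⁻¹]] V.carrier :=
    { F with
      invFun := G
      left_inv := hGF
      right_inv := hFG }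
  refine ⟨E, fun u => ?_, fun u => ?_⟩
  · obtain ⟨v, rfl⟩ := E.symm.surjective u
    have h1 : ((uModule p 1).tensor V).opX (G v) = G (V.opX v) := by
      rw [hG, WeightModule.opX_tmul, hXone, hG]
    rw [LinearEquiv.apply_symm_apply]
    exact (congrArg F h1).trans (hFG _)
  · obtain ⟨v, rfl⟩ := E.symm.surjective u
    have h1 : ((uModule p 1).tensor V).opY (G v) = G (V.opY v) := by
      rw [hG, WeightModule.opY_tmul, hYone, hG]
    rw [LinearEquiv.apply_symm_apply]
    exact (congrArg F h1).trans (hFG _)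

end modules

/-! ### The rings `𝒜(ω, M)` and `𝒜(p)` -/

section rings
variable (p : ℕ) [NeZero p]

noncomputable instance : CommRing (GrothendieckRing (σ p) (ω p) (M p)) :=
  GrothendieckRing.commRingOfUnit (uModule p 1) (fun _ V => unit_isIso p V)

noncomputable instance : Algebra ℂ (GrothendieckRing (σ p) (ω p) (M p)) :=
  Algebra.ofModule (fun c a b => LinearMap.map_smul₂ GrothendieckRing.mulMap c a b)
    (fun c a b => (GrothendieckRing.mulMap a).map_smul c b)

/-- The element `u_ξ = [V^1(ω, 1^p, x - ξ)]` of `𝒜(ω, M)`. -/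
noncomputable def u (ξ : ℂˣ) : GrothendieckRing (σ p) (ω p) (M p) :=
  GrothendieckRing.cls 1 (uModule p ξ)

/-- The ideal of `𝒜(ω, M)` generated by all `u_ξ - 1`. -/
noncomputable def uIdeal : Ideal (GrothendieckRing (σ p) (ω p) (M p)) :=
  Ideal.span (Set.range fun ξ : ℂˣ => u p ξ - 1)

/-- The algebra `𝒜(p) = 𝒜(ω, M) / (u_ξ - 1 | ξ ∈ ℂˣ)`. -/
abbrev Ap : Type 1 := GrothendieckRing (σ p) (ω p) (M p) ⧸ uIdeal p

/-- The component `𝒜(p)_d`, `d ∈ ℕ^p`: the image of the component of `𝒜(ω, M)` of degree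
`∏ (z - q^k)^{d_k} ∈ M`. -/
noncomputable def piece (d : Fin p →₀ ℕ) : Submodule ℂ (Ap p) :=
  (LinearMap.range (GrothendieckRing.incl (σ p) (ω p) (toM p (Multiplicative.ofAdd d)))).map
    (Ideal.Quotient.mkₐ ℂ (uIdeal p)).toLinearMap

/-- The component of total degree `n`, i.e. the sum of the `𝒜(p)_d` with `d_1 + ⋯ + d_p = n`. -/
noncomputable def totalPiece (n : ℕ) : Submodule ℂ (Ap p) :=
  ⨆ (d : Fin p →₀ ℕ) (_ : ∑ i, d i = n), piece p d

/-- The series `∑_{d ∈ ℕ^p} (dim 𝒜(p)_d) T^d`. -/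
noncomputable def dimSeries : MvPowerSeries (Fin p) ℚ :=
  fun d => (Module.finrank ℂ (piece p d) : ℚ)

/-- The Hilbert series `∑_{n ≥ 0} (dim 𝒜(p)_n) T^n` with respect to the total degree. -/
noncomputable def hilbertSeries : PowerSeries ℚ :=
  PowerSeries.mk fun n => (Module.finrank ℂ (totalPiece p n) : ℚ)

end rings

end RootOfUnityGWA

/-! ### Stable rank of an endomorphism -/

section StableRank

variable {V : Type*} [AddCommGroup V] [Module ℂ V]

/-- The dimension of the eventual image of an endomorphism. -/
noncomputable def stableRank (f : Module.End ℂ V) : ℕ :=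
  Module.finrank ℂ (LinearMap.range (f ^ Module.finrank ℂ V))

theorem stableRank_of_surjective {f : Module.End ℂ V} (hf : Function.Surjective f) :
    stableRank f = Module.finrank ℂ V := by
  have h : LinearMap.range (f ^ Module.finrank ℂ V) = ⊤ := by
    rw [LinearMap.range_eq_top]
    rw [Module.End.coe_pow]
    exact hf.iterate _
  rw [stableRank, h, finrank_top]

/-- The stable rank does not change when an endomorphism is multiplied by an element of a monoid
of surjective endomorphisms which it normalizes. -/
theorem stableRank_eq_of_eq_mul {f f' g : Module.End ℂ V} (S : Submonoid (Module.End ℂ V))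
    (hS : ∀ h ∈ S, Function.Surjective h) (hg : g ∈ S) (hf' : f' = f * g)
    (hcomm : ∀ h ∈ S, ∃ h' ∈ S, h * f = f * h') : stableRank f' = stableRank f := by
  have key : ∀ n : ℕ, ∃ h ∈ S, f' ^ n = f ^ n * h := by
    intro n
    induction n with
    | zero => exact ⟨1, S.one_mem, by simp⟩
    | succ n ih =>
      obtain ⟨h, hh, e⟩ := ih
      obtain ⟨h', hh', e'⟩ := hcomm h hh
      refine ⟨h' * g, S.mul_mem hh' hg, ?_⟩
      rw [pow_succ, e, hf', mul_assoc, ← mul_assoc h, e', pow_succ]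
      simp only [mul_assoc]
  obtain ⟨h, hh, e⟩ := key (Module.finrank ℂ V)
  have hr : LinearMap.range (f ^ Module.finrank ℂ V * h) =
      LinearMap.range (f ^ Module.finrank ℂ V) := by
    rw [Module.End.mul_eq_comp, LinearMap.range_comp, LinearMap.range_eq_top.mpr (hS h hh),
      LinearMap.range_eq_map]
  rw [stableRank, stableRank, e, hr]

variable [FiniteDimensional ℂ V]

theorem finrank_range_pow_eq_stableRank (f : Module.End ℂ V) {n : ℕ}
    (hn : Module.finrank ℂ V ≤ n) :
    Module.finrank ℂ (LinearMap.range (f ^ n)) = stableRank f := by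
  have h1 := LinearMap.finrank_range_add_finrank_ker (f ^ n)
  have h2 := LinearMap.finrank_range_add_finrank_ker (f ^ Module.finrank ℂ V)
  rw [Module.End.ker_pow_eq_ker_pow_finrank_of_le hn] at h1
  unfold stableRank
  omega

theorem eq_zero_of_pow_pow_eq_zero (f : Module.End ℂ V) {n : ℕ}
    (hn : Module.finrank ℂ V ≤ n) {v : V} (h : (f ^ n) ((f ^ n) v) = 0) : (f ^ n) v = 0 := by
  have h1 : v ∈ LinearMap.ker (f ^ (n + n)) := by
    rw [LinearMap.mem_ker, pow_add]; exact h
  rw [Module.End.ker_pow_eq_ker_pow_finrank_of_le (by omega),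
    ← Module.End.ker_pow_eq_ker_pow_finrank_of_le hn] at h1
  exact h1

theorem stableRank_add_of_exact {U W : Type*} [AddCommGroup U] [Module ℂ U]
    [FiniteDimensional ℂ U] [AddCommGroup W] [Module ℂ W] [FiniteDimensional ℂ W]
    {i : U →ₗ[ℂ] V} {g : V →ₗ[ℂ] W} (hi : Function.Injective i) (hig : Function.Exact i g)
    (hg : Function.Surjective g) {a : Module.End ℂ U} {b : Module.End ℂ V} {c : Module.End ℂ W}
    (hab : ∀ u, i (a u) = b (i u)) (hbc : ∀ v, g (b v) = c (g v)) :
    stableRank b = stableRank a + stableRank c := by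
  have hab' : ∀ n u, i ((a ^ n) u) = (b ^ n) (i u) := by
    intro n
    induction n with
    | zero => intro u; rfl
    | succ n ih => intro u; rw [pow_succ, pow_succ, Module.End.mul_apply, ih, hab]; rfl
  have hbc' : ∀ n u, g ((b ^ n) u) = (c ^ n) (g u) := by
    intro n
    induction n with
    | zero => intro u; rfl
    | succ n ih => intro u; rw [pow_succ, pow_succ, Module.End.mul_apply, ih, hbc]; rfl
  let n := Module.finrank ℂ U + Module.finrank ℂ V + Module.finrank ℂ W
  rw [← finrank_range_pow_eq_stableRank a (n := n) (by omega),
    ← finrank_range_pow_eq_stableRank b (n := n) (by omega),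
    ← finrank_range_pow_eq_stableRank c (n := n) (by omega)]
  have hg1 : LinearMap.range (g.domRestrict (LinearMap.range (b ^ n))) =
      LinearMap.range (c ^ n) := by
    ext w
    constructor
    · rintro ⟨⟨_, v, rfl⟩, rfl⟩
      exact ⟨g v, (hbc' n v).symm⟩
    · rintro ⟨w, rfl⟩
      obtain ⟨v, rfl⟩ := hg w
      exact ⟨⟨_, v, rfl⟩, hbc' n v⟩
  have hk : (LinearMap.ker (g.domRestrict (LinearMap.range (b ^ n)))).map
      (LinearMap.range (b ^ n)).subtype = (LinearMap.range (a ^ n)).map i := by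
    ext v
    constructor
    · rintro ⟨⟨_, v, rfl⟩, hv, rfl⟩
      have hv' : g ((b ^ n) v) = 0 := hv
      have hsurj : ∃ v', (b ^ n) v = (b ^ n) ((b ^ n) v') := by
        have : LinearMap.range (b ^ (n + n)) = LinearMap.range (b ^ n) := by
          refine Submodule.eq_of_le_of_finrank_eq ?_ ?_
          · rw [pow_add]; exact LinearMap.range_comp_le_range _ _
          · rw [finrank_range_pow_eq_stableRank b (by omega),
              finrank_range_pow_eq_stableRank b (by omega)]
        have hm : (b ^ n) v ∈ LinearMap.range (b ^ (n + n)) := by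
          rw [this]; exact ⟨v, rfl⟩
        obtain ⟨v', hv'⟩ := hm
        exact ⟨v', by rw [← hv', pow_add]; rfl⟩
      obtain ⟨v', hv''⟩ := hsurj
      have h1 : g ((b ^ n) v') = 0 := by
        rw [hbc']
        refine eq_zero_of_pow_pow_eq_zero c (by omega) ?_
        rw [← hbc', ← hbc', ← hv'', hv']
      obtain ⟨u', hu'⟩ := (hig _).mp h1
      refine ⟨(a ^ n) u', ⟨u', rfl⟩, ?_⟩
      change _ = (b ^ n) v
      rw [hab', hu', hv'']
    · rintro ⟨_, ⟨u, rfl⟩, rfl⟩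
      refine ⟨⟨i ((a ^ n) u), ⟨i u, (hab' n u).symm⟩⟩, ?_, rfl⟩
      exact (hig _).mpr ⟨_, rfl⟩
  have h3 := LinearMap.finrank_range_add_finrank_ker (g.domRestrict (LinearMap.range (b ^ n)))
  rw [hg1] at h3
  have h4 := (Submodule.equivMapOfInjective _ (LinearMap.range (b ^ n)).injective_subtype
    (LinearMap.ker (g.domRestrict (LinearMap.range (b ^ n))))).finrank_eq
  rw [hk] at h4
  have h5 := (Submodule.equivMapOfInjective i hi (LinearMap.range (a ^ n))).finrank_eq
  omega

theorem stableRank_eq_zero_of_isNilpotent {f : Module.End ℂ V} (hf : IsNilpotent f) :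
    stableRank f = 0 := by
  obtain ⟨n, hn⟩ := hf
  rw [← finrank_range_pow_eq_stableRank f (n := n + Module.finrank ℂ V) (by omega), pow_add, hn,
    zero_mul, LinearMap.range_zero, finrank_bot]

theorem stableRank_of_isIdempotentElem {f : Module.End ℂ V} (hf : IsIdempotentElem f) :
    stableRank f = Module.finrank ℂ (LinearMap.range f) := by
  rw [← finrank_range_pow_eq_stableRank f (n := Module.finrank ℂ V + 1) (by omega),
    hf.pow_succ_eq]

/-- An endomorphism of a finite dimensional complex space is nilpotent or has a nonzero
eigenvalue. -/
theorem exists_eigenvector_of_not_isNilpotent {f : Module.End ℂ V} (hf : ¬ IsNilpotent f) :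
    ∃ (c : ℂ) (v : V), c ≠ 0 ∧ v ≠ 0 ∧ f v = c • v := by
  by_contra! hcon
  refine hf ?_
  have h0 : ∀ c : ℂ, c ≠ 0 → f.maxGenEigenspace c = ⊥ := by
    intro c hc
    have hinj : Function.Injective (f - c • (1 : Module.End ℂ V)) := by
      rw [← LinearMap.ker_eq_bot, LinearMap.ker_eq_bot']
      intro v hv
      by_contra hv0
      exact hcon c v hc hv0 (sub_eq_zero.mp hv)
    rw [eq_bot_iff]
    intro v hv
    obtain ⟨k, hk⟩ := (Module.End.mem_maxGenEigenspace f c v).mp hv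
    rw [Module.End.coe_pow] at hk
    exact (hinj.iterate k) (hk.trans (by rw [← Module.End.coe_pow, map_zero]))
  have h1 : f.maxGenEigenspace 0 = ⊤ := by
    rw [eq_top_iff, ← Module.End.iSup_maxGenEigenspace_eq_top f]
    refine iSup_le fun c => ?_
    by_cases hc : c = 0
    · rw [hc]
    · rw [h0 c hc]; exact bot_le
  rw [Module.End.maxGenEigenspace_eq_genEigenspace_finrank, Module.End.genEigenspace_nat,
    zero_smul, sub_zero, LinearMap.ker_eq_top] at h1
  exact ⟨_, h1⟩

end StableRank

namespace RootOfUnityGWA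

open LaurentPolynomial

variable {p : ℕ}

/-! ### Complex structure -/

theorem σ_C (c : ℂ) : σ p (C c) = C c := scale_C _ c

theorem σ_symm_C (c : ℂ) : (σ p).symm (C c) = C c := scale_C _ c

theorem coeff_C_commutes {t : ℂ[T;T⁻¹]} (c : ℂ) (a : GWA (σ p) t) :
    GWA.coeff (σ p) t (C c) * a = a * GWA.coeff (σ p) t (C c) := by
  refine GWA.induction (P := fun a => GWA.coeff (σ p) t (C c) * a = a * GWA.coeff (σ p) t (C c))
    (fun r => ?_) ?_ ?_ (fun a b ha hb => ?_) (fun a b ha hb => ?_) a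
  · rw [← map_mul, ← map_mul, mul_comm]
  · rw [GWA.X_mul_coeff, σ_C]
  · rw [GWA.Y_mul_coeff, σ_symm_C]
  · rw [← mul_assoc, ha, mul_assoc, hb, mul_assoc]
  · rw [mul_add, add_mul, ha, hb]

noncomputable instance (t : ℂ[T;T⁻¹]) : Algebra ℂ (GWA (σ p) t) :=
  RingHom.toAlgebra' ((GWA.coeff (σ p) t).comp C) fun c a => coeff_C_commutes c a

section carrier
variable {t : ℂ[T;T⁻¹]} (V : WeightModule (σ p) (ω p) t)

noncomputable instance : Module ℂ V.carrier := Module.compHom V.carrier (C : ℂ →+* ℂ[T;T⁻¹])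

theorem C_smul (c : ℂ) (v : V.carrier) : (C c : ℂ[T;T⁻¹]) • v = c • v := rfl

instance : IsScalarTower ℂ ℂ[T;T⁻¹] V.carrier where
  smul_assoc c f v := by
    rw [← C_smul, ← mul_smul, LaurentPolynomial.smul_eq_C_mul]

instance : IsScalarTower ℂ (GWA (σ p) t) V.carrier where
  smul_assoc c a v := by
    rw [Algebra.smul_def, mul_smul, ← C_smul, ← V.coeff_smul]; rfl

/-- The action of an element of `A(t)` as a complex linear endomorphism. -/
noncomputable def act :
    GWA (σ p) t →ₐ[ℂ] Module.End ℂ V.carrier := Algebra.lsmul ℂ ℂ V.carrier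

theorem act_apply (a : GWA (σ p) t) (v : V.carrier) :
    act V a v = a • v := rfl

end carrier

theorem smul_congr {V : Type} [AddCommGroup V] [Module ℂ[T;T⁻¹] V]
    (hV : ∀ f : ℂ[T;T⁻¹], evalOrbit p f = 0 → ∀ v : V, f • v = 0)
    {f g : ℂ[T;T⁻¹]} (h : evalOrbit p f = evalOrbit p g) (v : V) : f • v = g • v := by
  rw [← sub_eq_zero, ← sub_smul]
  exact hV _ (by rw [map_sub, h, sub_self]) v

theorem carrier_smul_congr {t : ℂ[T;T⁻¹]} {V : WeightModule (σ p) (ω p) t} {f g : ℂ[T;T⁻¹]}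
    (h : evalOrbit p f = evalOrbit p g) (v : V.carrier) : f • v = g • v :=
  smul_congr (fun _ hf => smul_eq_zero_of_evalOrbit p V.isWeight hf) h v

variable [NeZero p]

/-- A Laurent polynomial with prescribed values on the orbit. -/
noncomputable def interp (v : Fin p → ℂ) : ℂ[T;T⁻¹] := (evalOrbit_surjective p v).choose

theorem evalOrbit_interp (v : Fin p → ℂ) : evalOrbit p (interp v) = v :=
  (evalOrbit_surjective p v).choose_spec

/-- An element of `ℂ[z, z⁻¹]` acting on weight modules as the projection to the `k`-th weight
space. -/
noncomputable def idem (k : Fin p) : ℂ[T;T⁻¹] := interp (Pi.single k 1)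

theorem evalOrbit_idem (k : Fin p) : evalOrbit p (idem k) = Pi.single k 1 := evalOrbit_interp _

theorem evalOrbit_mul_idem (f : ℂ[T;T⁻¹]) (k : Fin p) :
    evalOrbit p (f * idem k) = evalOrbit p (C (evalOrbit p f k) * idem k) := by
  funext j
  rw [map_mul, map_mul, evalOrbit_idem, Pi.mul_apply, Pi.mul_apply, evalOrbit_C]
  by_cases h : j = k
  · rw [h]
  · simp [h]

theorem evalOrbit_sum_idem : evalOrbit p (∑ k : Fin p, idem k) = evalOrbit p 1 := by
  rw [map_sum, map_one]
  simp only [evalOrbit_idem]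
  exact Finset.univ_sum_single (1 : Fin p → ℂ)

section weight

variable {V : Type} [AddCommGroup V] [Module ℂ[T;T⁻¹] V]

theorem finite_of_isWeight (hV : IsWeight (ω p) V) : Module.Finite ℂ[T;T⁻¹] V := by
  have hfin : Finite (ω p) := by
    refine Set.Finite.to_subtype ((Set.finite_range fun k : Fin p =>
      (⟨Ideal.span {lin p k}, isMaximal_span_lin p k⟩ : MaximalSpectrum ℂ[T;T⁻¹])).subset ?_)
    rintro m ⟨k, hk⟩
    exact ⟨k, MaximalSpectrum.ext hk.symm⟩
  refine ⟨?_⟩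
  rw [← hV.iSup_eq_top, iSup_subtype']
  exact Submodule.fg_iSup _ fun m => Module.Finite.iff_fg.mp (hV.finite m)

variable [Module ℂ V] [IsScalarTower ℂ ℂ[T;T⁻¹] V]

theorem C_smul' (c : ℂ) (v : V) : (C c : ℂ[T;T⁻¹]) • v = c • v := by
  rw [show c • v = c • (1 : ℂ[T;T⁻¹]) • v by rw [one_smul], ← smul_assoc,
    LaurentPolynomial.smul_eq_C_mul, mul_one]

theorem finiteDimensional_of_isWeight (hV : IsWeight (ω p) V) : FiniteDimensional ℂ V := by
  obtain ⟨S, hS⟩ := (finite_of_isWeight hV).fg_top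
  have hc := fun f hf => smul_eq_zero_of_evalOrbit p hV (f := f) hf
  let A : Set V := Set.image2 (fun (k : Fin p) v => idem k • v) Set.univ S
  have hA : A.Finite := Set.Finite.image2 _ Set.finite_univ S.finite_toSet
  have hsmul : ∀ f : ℂ[T;T⁻¹], ∀ v ∈ Submodule.span ℂ A, f • v ∈ Submodule.span ℂ A := by
    intro f v hv
    induction hv using Submodule.span_induction with
    | mem v hv =>
      obtain ⟨k, -, s, hs, rfl⟩ := hv
      rw [← mul_smul, smul_congr hc (evalOrbit_mul_idem f k), mul_smul, C_smul']
      exact Submodule.smul_mem _ _ (Submodule.subset_span ⟨k, trivial, s, hs, rfl⟩)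
    | zero => rw [smul_zero]; exact Submodule.zero_mem _
    | add v w _ _ hv hw => rw [smul_add]; exact Submodule.add_mem _ hv hw
    | smul c v _ hv =>
      rw [← C_smul', ← mul_smul, mul_comm, mul_smul, C_smul']
      exact Submodule.smul_mem _ _ hv
  refine ⟨Submodule.fg_def.mpr ⟨A, hA, eq_top_iff.mpr fun v _ => ?_⟩⟩
  have hv : v ∈ Submodule.span ℂ[T;T⁻¹] (S : Set V) := by rw [hS]; trivial
  induction hv using Submodule.span_induction with
  | mem v hv =>
    rw [← one_smul ℂ[T;T⁻¹] v, ← smul_congr hc evalOrbit_sum_idem, Finset.sum_smul]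
    exact Submodule.sum_mem _ fun k _ => Submodule.subset_span ⟨k, trivial, v, hv, rfl⟩
  | zero => exact Submodule.zero_mem _
  | add v w _ _ hv hw => exact Submodule.add_mem _ (hv trivial) (hw trivial)
  | smul c v _ hv => exact hsmul _ _ (hv trivial)

theorem isWeight_of_finiteDimensional [FiniteDimensional ℂ V]
    (hV : ∀ f : ℂ[T;T⁻¹], evalOrbit p f = 0 → ∀ v : V, f • v = 0) : IsWeight (ω p) V := by
  have hfin : Module.Finite ℂ[T;T⁻¹] V := Module.Finite.of_restrictScalars_finite ℂ _ _
  let L : Fin p → V →ₗ[ℂ[T;T⁻¹]] V := fun k => LinearMap.lsmul ℂ[T;T⁻¹] V (idem k)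
  refine IsWeight.of_le (fun m => ⨆ (k : Fin p) (_ : m.asIdeal = Ideal.span {lin p k}),
    LinearMap.range (L k)) ?_ ?_ ?_ ?_
  · intro m
    refine iSup₂_le fun k hk => ?_
    rintro _ ⟨v, rfl⟩
    rw [Submodule.mem_torsionBySet_iff]
    rintro ⟨a, ha⟩
    have ha' : a ∈ m.asIdeal := ha
    rw [hk, mem_span_lin] at ha'
    change a • idem k • v = 0
    rw [← mul_smul, smul_congr hV (evalOrbit_mul_idem a k), ha', map_zero, zero_mul, zero_smul]
  · intro m
    refine Submodule.fg_iSup _ fun k => ?_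
    by_cases hk : m.asIdeal = Ideal.span {lin p k}
    · simp only [hk, iSup_pos]
      exact Module.Finite.iff_fg.mp inferInstance
    · simp only [hk, iSup_false]
      exact Submodule.fg_bot
  · intro m hm
    refine iSup₂_eq_bot.mpr fun k hk => ?_
    exact absurd ⟨k, hk⟩ hm
  · rw [eq_top_iff]
    intro v _
    rw [← one_smul ℂ[T;T⁻¹] v, ← smul_congr hV evalOrbit_sum_idem, Finset.sum_smul]
    refine Submodule.sum_mem _ fun k _ => ?_
    refine Submodule.mem_iSup_of_mem ⟨Ideal.span {lin p k}, isMaximal_span_lin p k⟩ ?_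
    exact Submodule.mem_iSup_of_mem k (Submodule.mem_iSup_of_mem rfl ⟨v, rfl⟩)

end weight

/-! ### Submodules and quotients of weight modules -/

section subquotient

variable {t : ℂ[T;T⁻¹]} (V : WeightModule (σ p) (ω p) t)

instance : FiniteDimensional ℂ V.carrier := finiteDimensional_of_isWeight V.isWeight

/-- A finite dimensional `A(t)`-module on which `ℂ[z, z⁻¹]` acts through its values on the orbit,
as a weight module. -/
noncomputable def ofGWAModule (N : Type) [AddCommGroup N] [Module (GWA (σ p) t) N] [Module ℂ N]
    [IsScalarTower ℂ (GWA (σ p) t) N] [FiniteDimensional ℂ N]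
    (hN : ∀ f : ℂ[T;T⁻¹], evalOrbit p f = 0 → ∀ v : N, GWA.coeff (σ p) t f • v = 0) :
    WeightModule (σ p) (ω p) t :=
  letI : Module ℂ[T;T⁻¹] N := Module.compHom N (GWA.coeff (σ p) t)
  haveI : IsScalarTower ℂ ℂ[T;T⁻¹] N :=
    { smul_assoc := fun c f v => by
        change GWA.coeff (σ p) t (c • f) • v = c • GWA.coeff (σ p) t f • v
        rw [LaurentPolynomial.smul_eq_C_mul, map_mul, ← smul_assoc, Algebra.smul_def]
        rfl }
  { carrier := N
    coeff_smul := fun _ _ => rfl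
    isWeight := isWeight_of_finiteDimensional hN }

/-- The quotient of a weight module by an `A(t)`-submodule. -/
noncomputable def quotModule (N : Submodule (GWA (σ p) t) V.carrier) :
    WeightModule (σ p) (ω p) t :=
  haveI : FiniteDimensional ℂ (V.carrier ⧸ N) :=
    Module.Finite.of_surjective (N.mkQ.restrictScalars ℂ) N.mkQ_surjective
  ofGWAModule (V.carrier ⧸ N) fun f hf v => by
    obtain ⟨v, rfl⟩ := N.mkQ_surjective v
    rw [← map_smul, V.coeff_smul, smul_eq_zero_of_evalOrbit p V.isWeight hf, map_zero]

/-- The projection to the quotient. -/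
noncomputable def quotMk (N : Submodule (GWA (σ p) t) V.carrier) :
    V.carrier →ₗ[GWA (σ p) t] (quotModule V N).carrier := N.mkQ

theorem quotMk_surjective (N : Submodule (GWA (σ p) t) V.carrier) :
    Function.Surjective (quotMk V N) := N.mkQ_surjective

theorem quotMk_eq_zero (N : Submodule (GWA (σ p) t) V.carrier) {v : V.carrier} :
    quotMk V N v = 0 ↔ v ∈ N := Submodule.Quotient.mk_eq_zero N

theorem isExtension_quotModule {U : WeightModule (σ p) (ω p) t}
    (f : U.carrier →ₗ[GWA (σ p) t] V.carrier) (hf : Function.Injective f) :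
    WeightModule.IsExtension U V (quotModule V (LinearMap.range f)) :=
  ⟨f, quotMk V _, hf, fun _ => quotMk_eq_zero V _, quotMk_surjective V _⟩

theorem exists_injective_of_quotModule (N : Submodule (GWA (σ p) t) V.carrier)
    {W : WeightModule (σ p) (ω p) t} (f : V.carrier →ₗ[GWA (σ p) t] W.carrier)
    (hf : LinearMap.ker f = N) :
    ∃ g : (quotModule V N).carrier →ₗ[GWA (σ p) t] W.carrier, Function.Injective g :=
  ⟨N.liftQ f hf.ge, LinearMap.ker_eq_bot.mp (Submodule.ker_liftQ_eq_bot _ _ _ hf.le)⟩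

theorem finrank_eq_add_of_isExtension {U V W : WeightModule (σ p) (ω p) t}
    (h : WeightModule.IsExtension U V W) : Module.finrank ℂ V.carrier =
      Module.finrank ℂ U.carrier + Module.finrank ℂ W.carrier := by
  obtain ⟨f, g, hf, hfg, hg⟩ := h
  have h1 := LinearMap.finrank_range_add_finrank_ker (g.restrictScalars ℂ)
  have h2 : LinearMap.ker (g.restrictScalars ℂ) = LinearMap.range (f.restrictScalars ℂ) := by
    ext v; exact hfg v
  have h3 : LinearMap.range (g.restrictScalars ℂ) = ⊤ := LinearMap.range_eq_top.mpr hg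
  rw [h3, finrank_top, h2, LinearMap.finrank_range_of_inj (f := f.restrictScalars ℂ) hf] at h1
  omega

end subquotient

/-! ### Stable ranks as additive functions -/

section act

variable {t : ℂ[T;T⁻¹]}

theorem stableRank_act_of_isExtension (a : GWA (σ p) t) {U V W : WeightModule (σ p) (ω p) t}
    (h : WeightModule.IsExtension U V W) :
    stableRank (act V a) = stableRank (act U a) + stableRank (act W a) := by
  obtain ⟨f, g, hf, hfg, hg⟩ := h
  exact stableRank_add_of_exact (i := f.restrictScalars ℂ) (g := g.restrictScalars ℂ) hf hfg hg
    (fun u => f.map_smul a u) (fun u => g.map_smul a u)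

end act

end RootOfUnityGWA

namespace RootOfUnityGWA

open LaurentPolynomial

variable {p : ℕ}

/-- Laurent polynomials without zeros on the orbit, as endomorphisms of a weight module. -/
noncomputable def orbitUnits {t : ℂ[T;T⁻¹]} (V : WeightModule (σ p) (ω p) t) :
    Submonoid (Module.End ℂ V.carrier) :=
  Submonoid.map (act V) (Submonoid.map (GWA.coeff (σ p) t)
    (Submonoid.comap (evalOrbit p) (IsUnit.submonoid (Fin p → ℂ))))

theorem act_coeff_mem_orbitUnits {t : ℂ[T;T⁻¹]} (V : WeightModule (σ p) (ω p) t) {f : ℂ[T;T⁻¹]}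
    (hf : IsUnit (evalOrbit p f)) : act V (GWA.coeff (σ p) t f) ∈ orbitUnits V :=
  ⟨_, ⟨f, hf, rfl⟩, rfl⟩

theorem isUnit_evalOrbit_iff (f : ℂ[T;T⁻¹]) :
    IsUnit (evalOrbit p f) ↔ ∀ k, evalOrbit p f k ≠ 0 := by
  simp [Pi.isUnit_iff]

variable [NeZero p]

/-! ### Twists -/

theorem evalOrbit_σ_symm (f : ℂ[T;T⁻¹]) (k : Fin p) :
    evalOrbit p ((σ p).symm f) k = evalOrbit p f (k + 1) := by
  rw [← evalOrbit_σ p ((σ p).symm f) k, RingEquiv.apply_symm_apply]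

section twist

variable {t : ℂ[T;T⁻¹]}

/-- The values of the twisting factor `f_ξ`, namely `ξ` at `1` and `1` at `q, …, q^{p-1}`. -/
def twistFactor (ξ : ℂˣ) (k : Fin p) : ℂˣ := if k = 0 then ξ else 1

/-- The Laurent polynomial `f_ξ` with the values `twistFactor ξ` on the orbit. -/
noncomputable def twistPoly (p : ℕ) [NeZero p] (ξ : ℂˣ) : ℂ[T;T⁻¹] :=
  interp (fun k : Fin p => (twistFactor ξ k : ℂ))

/-- A Laurent polynomial which is inverse to `f_ξ` on the orbit. -/
noncomputable def twistPolyInv (p : ℕ) [NeZero p] (ξ : ℂˣ) : ℂ[T;T⁻¹] :=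
  interp (fun k : Fin p => ((twistFactor ξ k)⁻¹ : ℂˣ))

theorem evalOrbit_twistPoly_mul_inv (ξ : ℂˣ) :
    evalOrbit p (twistPoly p ξ * twistPolyInv p ξ) = evalOrbit p 1 := by
  rw [map_mul, twistPoly, twistPolyInv, evalOrbit_interp, evalOrbit_interp, map_one]
  funext k
  exact Units.mul_inv _

/-- The module `V` with `X` replaced by `X f_ξ` and `Y` by `f_ξ⁻¹ Y`. -/
noncomputable def twist (V : WeightModule (σ p) (ω p) t) (ξ : ℂˣ) :
    WeightModule (σ p) (ω p) t :=
  WeightModule.ofOperators V.carrier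
    (V.opX.toAddMonoidHom.comp (DistribSMul.toAddMonoidHom V.carrier
      (twistPoly p ξ)))
    ((DistribSMul.toAddMonoidHom V.carrier
      (twistPolyInv p ξ)).comp V.opY.toAddMonoidHom)
    (fun r v => by
      change V.opX (twistPoly p ξ • r • v) = σ p r • V.opX (twistPoly p ξ • v)
      rw [smul_comm, map_smulₛₗ]
      rfl)
    (fun r v => by
      change twistPolyInv p ξ • V.opY (r • v) = (σ p).symm r • twistPolyInv p ξ • V.opY v
      rw [map_smulₛₗ, smul_comm]
      rfl)
    (fun v => by
      change twistPolyInv p ξ • V.opY (V.opX (twistPoly p ξ • v)) = t • v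
      rw [WeightModule.opY_opX, smul_smul, smul_smul]
      refine carrier_smul_congr ?_ v
      rw [mul_comm _ t, mul_assoc, map_mul, mul_comm _ (twistPoly p ξ), evalOrbit_twistPoly_mul_inv,
        ← map_mul, mul_one])
    (fun v => by
      change V.opX (twistPoly p ξ • twistPolyInv p ξ • V.opY v) = _
      rw [smul_smul, carrier_smul_congr (evalOrbit_twistPoly_mul_inv ξ), one_smul,
        WeightModule.opX_opY])
    V.isWeight

theorem twist_X_smul (V : WeightModule (σ p) (ω p) t) (ξ : ℂˣ) (v : V.carrier) :
    (GWA.X (σ p) t • (show (twist V ξ).carrier from v) : (twist V ξ).carrier) =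
      (show V.carrier from GWA.X (σ p) t • (twistPoly p ξ • v)) :=
  WeightModule.X_smul_ofOperators V.carrier _ _ _ _ _ _ _ v

theorem twist_Y_smul (V : WeightModule (σ p) (ω p) t) (ξ : ℂˣ) (v : V.carrier) :
    (GWA.Y (σ p) t • (show (twist V ξ).carrier from v) : (twist V ξ).carrier) =
      (show V.carrier from
        (twistPolyInv p ξ) • GWA.Y (σ p) t • v) :=
  WeightModule.Y_smul_ofOperators V.carrier _ _ _ _ _ _ _ v

theorem surjective_of_mem_orbitUnits (V : WeightModule (σ p) (ω p) t)
    {h : Module.End ℂ V.carrier} (hh : h ∈ orbitUnits V) : Function.Surjective h := by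
  obtain ⟨_, ⟨f, hf, rfl⟩, rfl⟩ := hh
  obtain ⟨g, hg⟩ := hf.exists_right_inv
  obtain ⟨g, rfl⟩ := evalOrbit_surjective p g
  intro v
  refine ⟨g • v, ?_⟩
  change GWA.coeff (σ p) t f • g • v = v
  rw [V.coeff_smul, smul_smul, carrier_smul_congr (g := 1) (by rw [map_mul, hg, map_one]),
    one_smul]

theorem stableRank_act_X_twist (V : WeightModule (σ p) (ω p) t) (ξ : ℂˣ) :
    stableRank (act (twist V ξ) (GWA.X (σ p) t)) = stableRank (act V (GWA.X (σ p) t)) := by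
  let f' : Module.End ℂ V.carrier := act (twist V ξ) (GWA.X (σ p) t)
  refine stableRank_eq_of_eq_mul (f' := f') (orbitUnits V)
    (fun h hh => surjective_of_mem_orbitUnits V hh)
    (act_coeff_mem_orbitUnits V (f := twistPoly p ξ) ?_) ?_ ?_
  · rw [isUnit_evalOrbit_iff, twistPoly, evalOrbit_interp]
    exact fun k => Units.ne_zero _
  · ext v
    refine (twist_X_smul V ξ v).trans ?_
    change _ = GWA.X (σ p) t • GWA.coeff (σ p) t _ • v
    rw [V.coeff_smul]
  · rintro _ ⟨_, ⟨f, hf, rfl⟩, rfl⟩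
    refine ⟨_, act_coeff_mem_orbitUnits V (f := (σ p).symm f) ?_, ?_⟩
    · have hf' := (isUnit_evalOrbit_iff f).mp hf
      rw [isUnit_evalOrbit_iff]
      intro k
      rw [evalOrbit_σ_symm]
      exact hf' _
    · exact (map_mul (act V) _ _).symm.trans ((congrArg (act V) (by
        rw [GWA.X_mul_coeff, RingEquiv.apply_symm_apply])).trans (map_mul (act V) _ _))

theorem stableRank_act_Y_twist (V : WeightModule (σ p) (ω p) t) (ξ : ℂˣ) :
    stableRank (act (twist V ξ) (GWA.Y (σ p) t)) = stableRank (act V (GWA.Y (σ p) t)) := by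
  let f' : Module.End ℂ V.carrier := act (twist V ξ) (GWA.Y (σ p) t)
  refine stableRank_eq_of_eq_mul (f' := f') (orbitUnits V)
    (fun h hh => surjective_of_mem_orbitUnits V hh)
    (act_coeff_mem_orbitUnits V
      (f := σ p (twistPolyInv p ξ)) ?_) ?_ ?_
  · rw [isUnit_evalOrbit_iff]
    intro k
    obtain ⟨k, rfl⟩ : ∃ j, k = j + 1 := ⟨k - 1, by simp⟩
    rw [evalOrbit_σ, twistPolyInv, evalOrbit_interp]
    exact Units.ne_zero _
  · ext v
    refine (twist_Y_smul V ξ v).trans ?_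
    change _ = GWA.Y (σ p) t • GWA.coeff (σ p) t _ • v
    rw [smul_smul, GWA.Y_mul_coeff, RingEquiv.symm_apply_apply, mul_smul, V.coeff_smul]
  · rintro _ ⟨_, ⟨f, hf, rfl⟩, rfl⟩
    refine ⟨_, act_coeff_mem_orbitUnits V (f := σ p f) ?_, ?_⟩
    · have hf' := (isUnit_evalOrbit_iff f).mp hf
      rw [isUnit_evalOrbit_iff]
      intro k
      obtain ⟨k, rfl⟩ : ∃ j, k = j + 1 := ⟨k - 1, by simp⟩
      rw [evalOrbit_σ]
      exact hf' _
    · exact (map_mul (act V) _ _).symm.trans ((congrArg (act V) (by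
        rw [GWA.Y_mul_coeff, RingEquiv.symm_apply_apply])).trans (map_mul (act V) _ _))

theorem stableRank_act_coeff_twist (V : WeightModule (σ p) (ω p) t) (ξ : ℂˣ) (f : ℂ[T;T⁻¹]) :
    stableRank (act (twist V ξ) (GWA.coeff (σ p) t f)) =
      stableRank (act V (GWA.coeff (σ p) t f)) := by
  let f' : Module.End ℂ V.carrier := act (twist V ξ) (GWA.coeff (σ p) t f)
  have h : f' = act V (GWA.coeff (σ p) t f) := by
    ext v
    exact ((twist V ξ).coeff_smul f v).trans (V.coeff_smul f v).symm
  exact congrArg (stableRank (V := V.carrier)) h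

/-- The module of functions on the orbit is a unit for the tensor product. -/
theorem exists_orbitSpace_tensor_equiv (V : WeightModule (σ p) (ω p) t) :
    ∃ e : (OrbitSpace p ⊗[ℂ[T;T⁻¹]] V.carrier) ≃ₗ[ℂ[T;T⁻¹]] V.carrier,
      ∀ v, e ((fun _ => 1 : Fin p → ℂ) ⊗ₜ v) = v := by
  let ev : ℂ[T;T⁻¹] →ₗ[ℂ[T;T⁻¹]] OrbitSpace p :=
    { toFun := evalOrbit p
      map_add' := map_add _
      map_smul' := fun f g => map_mul (evalOrbit p) f g }
  have hev : Function.Surjective ev := evalOrbit_surjective p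
  let L : OrbitSpace p →ₗ[ℂ[T;T⁻¹]] V.carrier →ₗ[ℂ[T;T⁻¹]] V.carrier :=
    ((LinearMap.ker ev).liftQ (LinearMap.lsmul ℂ[T;T⁻¹] V.carrier) (by
      intro f hf
      ext v
      exact smul_eq_zero_of_evalOrbit p V.isWeight hf v)).comp
      (ev.quotKerEquivOfSurjective hev).symm.toLinearMap
  have hL : ∀ f v, L (ev f) v = f • v := by
    intro f v
    have h1 : (ev.quotKerEquivOfSurjective hev).symm (ev f) = Submodule.Quotient.mk f := by
      rw [LinearEquiv.symm_apply_eq]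
      rfl
    simp only [L, LinearMap.comp_apply, LinearEquiv.coe_coe, h1]
    rfl
  have hone : ∀ f : ℂ[T;T⁻¹], f • (ev 1) = ev f := fun f => by
    rw [← map_smul, smul_eq_mul, mul_one]
  have hF : ∀ f v, TensorProduct.lift L (ev f ⊗ₜ v) = f • v := fun f v =>
    (TensorProduct.lift.tmul (f' := L) (ev f) v).trans (hL f v)
  have h1 : (fun _ => 1 : Fin p → ℂ) = ev 1 := (map_one (evalOrbit p)).symm
  refine ⟨{ TensorProduct.lift L with
    invFun := fun v => ev 1 ⊗ₜ v
    left_inv := fun u => ?_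
    right_inv := fun v => (hF 1 v).trans (one_smul _ _) }, fun v => ?_⟩
  · change ev 1 ⊗ₜ (TensorProduct.lift L u) = u
    induction u using TensorProduct.induction_on with
    | zero => rw [map_zero, TensorProduct.tmul_zero]
    | tmul u v =>
      obtain ⟨f, rfl⟩ := hev u
      rw [hF, ← TensorProduct.smul_tmul, hone]
    | add a b ha hb => rw [map_add, TensorProduct.tmul_add, ha, hb]
  · rw [h1]
    exact (hF 1 v).trans (one_smul _ _)

theorem uModule_tensor_isIso_twist (V : WeightModule (σ p) (ω p) t) (ξ : ℂˣ) :
    WeightModule.IsIso ((uModule p ξ).tensor V) (twist V ξ) := by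
  obtain ⟨e, he⟩ := exists_orbitSpace_tensor_equiv V
  let one : (uModule p ξ).carrier := (fun _ => 1 : Fin p → ℂ)
  let E : ((uModule p ξ).tensor V).carrier ≃ₗ[ℂ[T;T⁻¹]] (twist V ξ).carrier :=
    (WeightModule.tensorEquiv (uModule p ξ) V).symm.trans e
  have hE : ∀ (f : ℂ[T;T⁻¹]) (v : V.carrier),
      E ((uModule p ξ).tmul V (f • one) v) = (show (twist V ξ).carrier from f • v) := by
    intro f v
    refine (E.map_smul f ((uModule p ξ).tmul V one v)).trans ?_
    exact congrArg (fun w : V.carrier => f • w) (he v)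
  have hE1 : ∀ v : V.carrier, E ((uModule p ξ).tmul V one v) = v := he
  have hX : (uModule p ξ).opX one =
      σ p (twistPoly p ξ) • one := by
    refine (WeightModule.X_smul_ofOperators (OrbitSpace p) _ _ _ _ _ _ _ one).trans ?_
    funext k
    obtain ⟨k, rfl⟩ : ∃ j, k = j + 1 := ⟨k - 1, by simp⟩
    change (if k + 1 = 1 then (ξ : ℂ) else 1) * 1 = evalOrbit p (σ p _) (k + 1) * 1
    rw [evalOrbit_σ, twistPoly, evalOrbit_interp, twistFactor]
    by_cases h : k = 0 <;> simp [h]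
  have hY : (uModule p ξ).opY one =
      (twistPolyInv p ξ) • one := by
    refine (WeightModule.Y_smul_ofOperators (OrbitSpace p) _ _ _ _ _ _ _ one).trans ?_
    funext k
    change (if k = 0 then ((ξ⁻¹ : ℂˣ) : ℂ) else 1) * 1 = evalOrbit p _ k * 1
    rw [twistPolyInv, evalOrbit_interp, twistFactor]
    split_ifs <;> simp
  have hsurj : ∀ u, ∃ v : V.carrier, u = (uModule p ξ).tmul V one v := fun u =>
    ⟨E u, E.injective (hE1 _).symm⟩
  refine ⟨E, fun u => ?_, fun u => ?_⟩
  · obtain ⟨v, rfl⟩ := hsurj u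
    rw [WeightModule.opX_tmul, hX, hE1]
    refine (hE _ _).trans ((twist_X_smul V ξ v).trans ?_).symm
    exact V.opX.map_smulₛₗ _ v
  · obtain ⟨v, rfl⟩ := hsurj u
    rw [WeightModule.opY_tmul, hY, hE1]
    exact (hE _ _).trans (twist_Y_smul V ξ v).symm

end twist

/-! ### Linear maps on `𝒜(p)` -/

/-- The quotient map `𝒜(ω, M) → 𝒜(p)`. -/
noncomputable def toAp (p : ℕ) [NeZero p] :
    GrothendieckRing (σ p) (ω p) (M p) →ₗ[ℂ] Ap p :=
  (Ideal.Quotient.mkₐ ℂ (uIdeal p)).toLinearMap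

theorem toAp_surjective : Function.Surjective (toAp p) := Ideal.Quotient.mk_surjective

theorem toAp_mul (a b : GrothendieckRing (σ p) (ω p) (M p)) :
    toAp p (a * b) = toAp p a * toAp p b := map_mul (Ideal.Quotient.mkₐ ℂ (uIdeal p)) a b

theorem toAp_one : toAp p 1 = 1 := map_one (Ideal.Quotient.mkₐ ℂ (uIdeal p))

theorem u_mul_cls (ξ : ℂˣ) (t : M p) (V : WeightModule (σ p) (ω p) (t : ℂ[T;T⁻¹])) :
    u p ξ * GrothendieckRing.cls t V = GrothendieckRing.cls t (twist V ξ) :=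
  (GrothendieckRing.cls_mul_cls 1 t (uModule p ξ) V).trans
    (GrothendieckRing.cls_eq_of_isIso (one_mul t) (uModule_tensor_isIso_twist V ξ))

theorem toAp_u_mul (ξ : ℂˣ) (a : GrothendieckRing (σ p) (ω p) (M p)) :
    toAp p (u p ξ * a) = toAp p a := by
  have h : toAp p (u p ξ - 1) = 0 :=
    Ideal.Quotient.eq_zero_iff_mem.mpr (Ideal.subset_span ⟨ξ, rfl⟩)
  rw [map_sub, sub_eq_zero, toAp_one] at h
  rw [toAp_mul, h, one_mul]

theorem toAp_cls_twist (ξ : ℂˣ) (t : M p) (V : WeightModule (σ p) (ω p) (t : ℂ[T;T⁻¹])) :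
    toAp p (GrothendieckRing.cls t (twist V ξ)) = toAp p (GrothendieckRing.cls t V) := by
  rw [← u_mul_cls, toAp_u_mul]

theorem ker_toAp_le {E : Type*} [AddCommGroup E] [Module ℂ E]
    (L : GrothendieckRing (σ p) (ω p) (M p) →ₗ[ℂ] E)
    (hL : ∀ t V ξ, L (GrothendieckRing.cls t (twist V ξ)) = L (GrothendieckRing.cls t V)) :
    LinearMap.ker (toAp p) ≤ LinearMap.ker L := by
  intro x hx
  have hx' : x ∈ uIdeal p := Ideal.Quotient.eq_zero_iff_mem.mp hx
  suffices h : ∀ a, L (a * x) = 0 by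
    have := h 1
    rwa [one_mul] at this
  refine Submodule.span_induction (p := fun x _ => ∀ a, L (a * x) = 0) ?_ ?_ ?_ ?_ hx'
  · rintro _ ⟨ξ, rfl⟩ a
    have h : L.comp (GrothendieckRing.mulMap (u p ξ)) = L := by
      refine GrothendieckRing.hom_ext fun t V => ?_
      exact (congrArg L (u_mul_cls ξ t V)).trans (hL t V ξ)
    have h1 : L (u p ξ * a) = L a := DFunLike.congr_fun h a
    rw [mul_sub, mul_one, map_sub, mul_comm, h1, sub_self]
  · intro a
    rw [mul_zero, map_zero]
  · intro x y _ _ hx hy a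
    rw [mul_add, map_add, hx, hy, add_zero]
  · intro r x _ hx a
    rw [smul_eq_mul, ← mul_assoc, hx]

/-- A linear map on `𝒜(p)` given by additive functions on objects which are invariant under
twists. -/
noncomputable def liftAp {E : Type*} [AddCommGroup E] [Module ℂ E]
    (φ : ∀ t : M p, WeightModule (σ p) (ω p) (t : ℂ[T;T⁻¹]) → E)
    (h : ∀ t U V W, WeightModule.IsExtension U V W → φ t V = φ t U + φ t W)
    (hφ : ∀ t V ξ, φ t (twist V ξ) = φ t V) : Ap p →ₗ[ℂ] E :=
  ((LinearMap.ker (toAp p)).liftQ (GrothendieckRing.lift φ h) (ker_toAp_le _ (fun t V ξ => by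
    rw [GrothendieckRing.lift_cls, GrothendieckRing.lift_cls, hφ]))).comp
    ((toAp p).quotKerEquivOfSurjective toAp_surjective).symm.toLinearMap

theorem liftAp_toAp_cls {E : Type*} [AddCommGroup E] [Module ℂ E]
    (φ : ∀ t : M p, WeightModule (σ p) (ω p) (t : ℂ[T;T⁻¹]) → E)
    (h : ∀ t U V W, WeightModule.IsExtension U V W → φ t V = φ t U + φ t W)
    (hφ : ∀ t V ξ, φ t (twist V ξ) = φ t V) (t : M p)
    (V : WeightModule (σ p) (ω p) (t : ℂ[T;T⁻¹])) :
    liftAp φ h hφ (toAp p (GrothendieckRing.cls t V)) = φ t V := by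
  have h1 : ((toAp p).quotKerEquivOfSurjective toAp_surjective).symm
      (toAp p (GrothendieckRing.cls t V)) =
      Submodule.Quotient.mk (GrothendieckRing.cls t V) := by
    rw [LinearEquiv.symm_apply_eq]
    rfl
  simp only [liftAp, LinearMap.comp_apply, LinearEquiv.coe_coe, h1]
  exact (Submodule.liftQ_apply _ _ _).trans (GrothendieckRing.lift_cls φ h t V)

/-- The functional on `𝒜(p)` given by the stable rank of an element of the algebras `A(t)`. -/
noncomputable def stableRankAp (a : ∀ t : M p, GWA (σ p) (t : ℂ[T;T⁻¹]))
    (ha : ∀ (t : M p) (V : WeightModule (σ p) (ω p) (t : ℂ[T;T⁻¹])) (ξ : ℂˣ),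
      stableRank (act (twist V ξ) (a t)) = stableRank (act V (a t))) : Ap p →ₗ[ℂ] ℂ :=
  liftAp (fun t V => (stableRank (act V (a t)) : ℂ))
    (fun t U V W h => by rw [stableRank_act_of_isExtension (a t) h, Nat.cast_add])
    (fun t V ξ => by rw [ha])

theorem stableRankAp_toAp_cls (a : ∀ t : M p, GWA (σ p) (t : ℂ[T;T⁻¹]))
    (ha : ∀ (t : M p) (V : WeightModule (σ p) (ω p) (t : ℂ[T;T⁻¹])) (ξ : ℂˣ),
      stableRank (act (twist V ξ) (a t)) = stableRank (act V (a t)))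
    (t : M p) (V : WeightModule (σ p) (ω p) (t : ℂ[T;T⁻¹])) :
    stableRankAp a ha (toAp p (GrothendieckRing.cls t V)) = (stableRank (act V (a t)) : ℂ) :=
  liftAp_toAp_cls _ _ _ t V

end RootOfUnityGWA

namespace RootOfUnityGWA

open LaurentPolynomial

variable {p : ℕ}

/-! ### Cyclic arithmetic in `Fin p` -/

section fin
variable [NeZero p]

theorem fin_cyclic_induction {P : Fin p → Prop} (k : Fin p) (h0 : P k)
    (hs : ∀ l, P l → P (l + 1)) (l : Fin p) : P l := by
  have key : ∀ n : ℕ, ∀ l : Fin p, (l - k).val = n → P l := by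
    intro n
    induction n with
    | zero =>
      intro l hl
      have : l = k := sub_eq_zero.mp (Fin.ext (by rw [hl, Fin.val_zero]))
      rwa [this]
    | succ n ih =>
      intro l hl
      have hne : l - k ≠ 0 := fun h => by rw [h, Fin.val_zero] at hl; omega
      have h1 := ih (l - 1) (by
        rw [sub_right_comm, Fin.val_sub_one_of_ne_zero hne, hl, Nat.add_sub_cancel])
      have h2 := hs _ h1
      rwa [sub_add_cancel] at h2
  exact key _ l rfl

theorem fin_cyclic_induction_down {P : Fin p → Prop} (k : Fin p) (h0 : P k)
    (hs : ∀ l, P (l + 1) → P l) (l : Fin p) : P l := by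
  have h := fin_cyclic_induction (P := fun j => P (-j)) (-k) (by rwa [neg_neg]) (fun j hj => by
    refine hs _ ?_
    rwa [neg_add, neg_add_cancel_right]) (-l)
  rwa [neg_neg] at h

theorem val_sub_add_one {k l : Fin p} (h : l ≠ k) : (k - (l + 1)).val + 1 = (k - l).val := by
  have hne : k - l ≠ 0 := fun h' => h (sub_eq_zero.mp h').symm
  have h0 : (k - l).val ≠ 0 := fun h' => hne (Fin.ext (by rw [h', Fin.val_zero]))
  rw [← sub_sub, Fin.val_sub_one_of_ne_zero hne]
  omega

theorem pow_val_sub_one (c : ℂˣ) (l : Fin p) :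
    (c : ℂ) ^ ((l - 1).val + 1) = (twistFactor (c ^ p) l : ℂ) * (c : ℂ) ^ l.val := by
  unfold twistFactor
  by_cases h : l = 0
  · rw [h, if_pos rfl, zero_sub, Fin.val_zero, pow_zero, mul_one, Units.val_pow_eq_pow_val]
    congr 1
    have hp := NeZero.pos p
    rw [Fin.val_neg', Fin.val_one']
    rcases Nat.lt_or_ge 1 p with h1 | h1
    · rw [Nat.mod_eq_of_lt h1, Nat.mod_eq_of_lt (by omega)]
      omega
    · have : p = 1 := by omega
      subst this
      rfl
  · rw [if_neg h, Units.val_one, one_mul, Fin.val_sub_one_of_ne_zero h]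
    have : l.val ≠ 0 := fun h' => h (Fin.ext (by rw [h', Fin.val_zero]))
    congr 1
    omega

end fin

/-! ### Homogeneous vectors -/

section homogeneous

variable {t : ℂ[T;T⁻¹]} (V : WeightModule (σ p) (ω p) t)

theorem carrier_smul_comm (a : GWA (σ p) t) (c : ℂ) (v : V.carrier) :
    a • c • v = c • a • v := (act V a).map_smul c v

variable [NeZero p] {V}

theorem smul_idem_smul (f : ℂ[T;T⁻¹]) (k : Fin p) (v : V.carrier) :
    f • idem k • v = evalOrbit p f k • idem k • v := by
  rw [smul_smul, carrier_smul_congr (evalOrbit_mul_idem f k), mul_smul, C_smul]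

theorem idem_smul_idem_smul_self (k : Fin p) (v : V.carrier) :
    (idem k : ℂ[T;T⁻¹]) • idem k • v = idem k • v := by
  rw [smul_idem_smul, evalOrbit_idem, Pi.single_eq_same, one_smul]

theorem sum_idem_smul (v : V.carrier) : ∑ k : Fin p, idem k • v = v := by
  rw [← Finset.sum_smul, carrier_smul_congr evalOrbit_sum_idem, one_smul]

theorem X_smul_idem_smul (k : Fin p) (v : V.carrier) :
    GWA.X (σ p) t • idem k • v = idem (k + 1) • GWA.X (σ p) t • v := by
  rw [← V.coeff_smul, smul_smul, GWA.X_mul_coeff, mul_smul, V.coeff_smul]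
  refine carrier_smul_congr ?_ _
  funext j
  obtain ⟨j, rfl⟩ : ∃ i, j = i + 1 := ⟨j - 1, by simp⟩
  rw [evalOrbit_σ, evalOrbit_idem, evalOrbit_idem]
  simp [Pi.single_apply]

theorem Y_smul_idem_smul (k : Fin p) (v : V.carrier) :
    GWA.Y (σ p) t • idem (k + 1) • v = idem k • GWA.Y (σ p) t • v := by
  rw [← V.coeff_smul, smul_smul, GWA.Y_mul_coeff, mul_smul, V.coeff_smul]
  refine carrier_smul_congr ?_ _
  funext j
  rw [evalOrbit_σ_symm, evalOrbit_idem, evalOrbit_idem]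
  simp [Pi.single_apply]

theorem smul_of_idem_smul {k : Fin p} {w : V.carrier} (hw : (idem k : ℂ[T;T⁻¹]) • w = w)
    (f : ℂ[T;T⁻¹]) : f • w = evalOrbit p f k • w := by
  rw [← hw, smul_idem_smul]

theorem Y_smul_X_smul {k : Fin p} {w : V.carrier} (hw : (idem k : ℂ[T;T⁻¹]) • w = w) :
    GWA.Y (σ p) t • GWA.X (σ p) t • w = evalOrbit p t k • w := by
  rw [smul_smul, GWA.Y_mul_X, V.coeff_smul, smul_of_idem_smul hw]

theorem X_smul_Y_smul {k : Fin p} {w : V.carrier}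
    (hw : (idem (k + 1) : ℂ[T;T⁻¹]) • w = w) :
    GWA.X (σ p) t • GWA.Y (σ p) t • w = evalOrbit p t k • w := by
  rw [smul_smul, GWA.X_mul_Y, V.coeff_smul, smul_of_idem_smul hw, evalOrbit_σ]

end homogeneous

variable [NeZero p]

/-! ### Modules with one-dimensional weight spaces -/

section orbitModule

variable (t : ℂ[T;T⁻¹]) (a b : Fin p → ℂ) (hab : ∀ k, a k * b k = evalOrbit p t k)

/-- The module with basis `e_k` and `X e_k = a_k e_{k+1}`, `Y e_{k+1} = b_k e_k`. -/
noncomputable def orbitModule : WeightModule (σ p) (ω p) t :=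
  WeightModule.ofOperators (OrbitSpace p)
    { toFun := fun v k => a (k - 1) * v (k - 1)
      map_zero' := funext fun k => mul_zero _
      map_add' := fun v w => funext fun k => mul_add _ _ _ }
    { toFun := fun v k => b k * v (k + 1)
      map_zero' := funext fun k => mul_zero _
      map_add' := fun v w => funext fun k => mul_add _ _ _ }
    (fun f v => funext fun k => by
      obtain ⟨j, rfl⟩ : ∃ j, k = j + 1 := ⟨k - 1, by simp⟩
      change _ * (evalOrbit p f (j + 1 - 1) * v (j + 1 - 1)) =
        evalOrbit p (σ p f) (j + 1) * (_ * v (j + 1 - 1))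
      rw [evalOrbit_σ, add_sub_cancel_right]
      ring)
    (fun f v => funext fun k => by
      change _ * (evalOrbit p f (k + 1) * v (k + 1)) =
        evalOrbit p ((σ p).symm f) k * (_ * v (k + 1))
      rw [evalOrbit_σ_symm]
      ring)
    (fun v => funext fun k => by
      change b k * (a (k + 1 - 1) * v (k + 1 - 1)) = evalOrbit p t k * v k
      rw [add_sub_cancel_right, ← hab]
      ring)
    (fun v => funext fun k => by
      obtain ⟨j, rfl⟩ : ∃ j, k = j + 1 := ⟨k - 1, by simp⟩
      change a (j + 1 - 1) * (b (j + 1 - 1) * v (j + 1 - 1 + 1)) =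
        evalOrbit p (σ p t) (j + 1) * v (j + 1)
      rw [add_sub_cancel_right, evalOrbit_σ, ← hab]
      ring)
    (isWeight_orbitSpace p)

/-- The coordinates with respect to the basis `e_k`. -/
noncomputable def coord : (orbitModule t a b hab).carrier ≃ₗ[ℂ] (Fin p → ℂ) where
  toFun v := v
  invFun v := v
  map_add' _ _ := rfl
  map_smul' c v := funext fun k => by
    change evalOrbit p (C c) k * _ = c * _
    rw [evalOrbit_C]
  left_inv _ := rfl
  right_inv _ := rfl

variable {t a b} {hab}

theorem coord_smul (f : ℂ[T;T⁻¹]) (v : (orbitModule t a b hab).carrier) (k : Fin p) :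
    coord t a b hab (f • v) k = evalOrbit p f k * coord t a b hab v k := rfl

theorem coord_X_smul (v : (orbitModule t a b hab).carrier) (k : Fin p) :
    coord t a b hab (GWA.X (σ p) t • v) (k + 1) = a k * coord t a b hab v k := by
  refine (congrFun (WeightModule.X_smul_ofOperators (OrbitSpace p) _ _ _ _ _ _ _ v)
    (k + 1)).trans ?_
  change a (k + 1 - 1) * coord t a b hab v (k + 1 - 1) = _
  rw [add_sub_cancel_right]

theorem coord_Y_smul (v : (orbitModule t a b hab).carrier) (k : Fin p) :
    coord t a b hab (GWA.Y (σ p) t • v) k = b k * coord t a b hab v (k + 1) :=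
  congrFun (WeightModule.Y_smul_ofOperators (OrbitSpace p) _ _ _ _ _ _ _ v) k

theorem finrank_orbitModule : Module.finrank ℂ (orbitModule t a b hab).carrier = p := by
  rw [(coord t a b hab).finrank_eq, Module.finrank_fin_fun]

theorem twist_orbitModule_isIso (ξ : ℂˣ) {a' b' : Fin p → ℂ}
    {hab' : ∀ k, a' k * b' k = evalOrbit p t k} (ha : ∀ k, a' k = a k * twistFactor ξ k)
    (hb : ∀ k, b' k = b k * ((twistFactor ξ k)⁻¹ : ℂˣ)) :
    WeightModule.IsIso (twist (orbitModule t a b hab) ξ) (orbitModule t a' b' hab') := by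
  let e : (twist (orbitModule t a b hab) ξ).carrier ≃ₗ[ℂ[T;T⁻¹]]
      (orbitModule t a' b' hab').carrier := LinearEquiv.refl ℂ[T;T⁻¹] (OrbitSpace p)
  refine ⟨e, fun (v : (orbitModule t a b hab).carrier) => ?_,
    fun (v : (orbitModule t a b hab).carrier) => ?_⟩
  · refine (coord t a' b' hab').injective (funext fun k => ?_)
    obtain ⟨k, rfl⟩ : ∃ j, k = j + 1 := ⟨k - 1, by simp⟩
    refine Eq.trans ?_ (coord_X_smul (e v) k).symm
    refine (congrFun (congrArg (coord t a b hab)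
      (twist_X_smul (orbitModule t a b hab) ξ v)) (k + 1)).trans ?_
    rw [coord_X_smul, coord_smul, twistPoly, evalOrbit_interp, ha, mul_assoc]
    rfl
  · refine (coord t a' b' hab').injective (funext fun k => ?_)
    refine Eq.trans ?_ (coord_Y_smul (e v) k).symm
    refine (congrFun (congrArg (coord t a b hab)
      (twist_Y_smul (orbitModule t a b hab) ξ v)) k).trans ?_
    rw [coord_smul, coord_Y_smul, twistPolyInv, evalOrbit_interp, hb]
    change _ * (_ * coord t a b hab v (k + 1)) = _ * coord t a b hab v (k + 1)
    ring

/-- Homogeneous vectors `w_k` with `X w_k = a_k w_{k+1}`, `Y w_{k+1} = b_k w_k` define a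
homomorphism `e_k ↦ w_k`. -/
theorem exists_hom_of_orbitModule (V : WeightModule (σ p) (ω p) t) (w : Fin p → V.carrier)
    (hw : ∀ k, (idem k : ℂ[T;T⁻¹]) • w k = w k)
    (hX : ∀ k, GWA.X (σ p) t • w k = a k • w (k + 1))
    (hY : ∀ k, GWA.Y (σ p) t • w (k + 1) = b k • w k) :
    ∃ f : (orbitModule t a b hab).carrier →ₗ[GWA (σ p) t] V.carrier,
      ∀ v, f v = 0 ↔ ∀ k, w k ≠ 0 → coord t a b hab v k = 0 := by
  let F : (orbitModule t a b hab).carrier →ₗ[ℂ[T;T⁻¹]] V.carrier :=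
    { toFun := fun v => ∑ k, coord t a b hab v k • w k
      map_add' := fun v v' => by
        rw [← Finset.sum_add_distrib]
        exact Finset.sum_congr rfl fun k _ => by rw [map_add, Pi.add_apply, add_smul]
      map_smul' := fun f v => by
        rw [RingHom.id_apply, Finset.smul_sum]
        refine Finset.sum_congr rfl fun k _ => ?_
        rw [coord_smul, smul_comm, smul_of_idem_smul (hw k), smul_smul, mul_comm] }
  have hF : ∀ v, F v = ∑ k, coord t a b hab v k • w k := fun v => rfl
  refine ⟨WeightModule.homOfCommutes _ _ F (fun v => ?_) (fun v => ?_), fun v => ?_⟩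
  · rw [hF, hF, Finset.smul_sum, ← Equiv.sum_comp (Equiv.addRight (1 : Fin p))]
    refine Finset.sum_congr rfl fun k _ => ?_
    rw [Equiv.coe_addRight, coord_X_smul, carrier_smul_comm, hX, smul_smul, mul_comm]
  · rw [hF, hF, Finset.smul_sum,
      ← Equiv.sum_comp (Equiv.addRight (1 : Fin p)) (fun k => GWA.Y (σ p) t • _)]
    refine Finset.sum_congr rfl fun k _ => ?_
    rw [Equiv.coe_addRight, coord_Y_smul, carrier_smul_comm, hY, smul_smul, mul_comm]
  · change F v = 0 ↔ _
    constructor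
    · intro h k hk
      have h1 : (idem k : ℂ[T;T⁻¹]) • F v = 0 := by rw [h, smul_zero]
      rw [hF, Finset.smul_sum, Finset.sum_eq_single k] at h1
      · rw [smul_comm, hw, smul_eq_zero] at h1
        exact h1.resolve_right hk
      · intro j _ hj
        rw [smul_comm, smul_of_idem_smul (hw j), evalOrbit_idem, Pi.single_eq_of_ne hj,
          zero_smul, smul_zero]
      · exact fun h' => absurd (Finset.mem_univ k) h'
    · intro h
      rw [hF]
      refine Finset.sum_eq_zero fun k _ => ?_
      by_cases hk : w k = 0
      · rw [hk, smul_zero]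
      · rw [h k hk, zero_smul]

theorem exists_injective_of_orbitModule (V : WeightModule (σ p) (ω p) t) (w : Fin p → V.carrier)
    (hw : ∀ k, (idem k : ℂ[T;T⁻¹]) • w k = w k) (hw0 : ∀ k, w k ≠ 0)
    (hX : ∀ k, GWA.X (σ p) t • w k = a k • w (k + 1))
    (hY : ∀ k, GWA.Y (σ p) t • w (k + 1) = b k • w k) :
    ∃ f : (orbitModule t a b hab).carrier →ₗ[GWA (σ p) t] V.carrier, Function.Injective f := by
  obtain ⟨f, hf⟩ := exists_hom_of_orbitModule (hab := hab) V w hw hX hY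
  refine ⟨f, (injective_iff_map_eq_zero f).mpr fun v hv => ?_⟩
  refine (coord t a b hab).injective (funext fun k => ?_)
  rw [(hf v).mp hv k (hw0 k), map_zero, Pi.zero_apply]

theorem isNilpotent_act_X {k : Fin p} (hk : a k = 0) :
    IsNilpotent (act (orbitModule t a b hab) (GWA.X (σ p) t)) := by
  by_contra h
  obtain ⟨c, v, hc, hv, h⟩ := exists_eigenvector_of_not_isNilpotent h
  have h1 : ∀ l, c * coord t a b hab v (l + 1) = a l * coord t a b hab v l := fun l => by
    rw [← coord_X_smul, ← act_apply, h, map_smul]; rfl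
  refine hv ((coord t a b hab).injective (funext fun l => ?_))
  rw [map_zero]
  refine fin_cyclic_induction (P := fun l => coord t a b hab v l = 0) (k + 1) ?_ ?_ l
  · have := h1 k
    rw [hk, zero_mul, mul_eq_zero] at this
    exact this.resolve_left hc
  · intro l hl
    have := h1 l
    rw [hl, mul_zero, mul_eq_zero] at this
    exact this.resolve_left hc

theorem isNilpotent_act_Y {k : Fin p} (hk : b k = 0) :
    IsNilpotent (act (orbitModule t a b hab) (GWA.Y (σ p) t)) := by
  by_contra h
  obtain ⟨c, v, hc, hv, h⟩ := exists_eigenvector_of_not_isNilpotent h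
  have h1 : ∀ l, c * coord t a b hab v l = b l * coord t a b hab v (l + 1) := fun l => by
    rw [← coord_Y_smul, ← act_apply, h, map_smul]; rfl
  refine hv ((coord t a b hab).injective (funext fun l => ?_))
  rw [map_zero]
  refine fin_cyclic_induction_down (P := fun l => coord t a b hab v l = 0) k ?_ ?_ l
  · have := h1 k
    rw [hk, zero_mul, mul_eq_zero] at this
    exact this.resolve_left hc
  · intro l hl
    have := h1 l
    rw [hl, mul_zero, mul_eq_zero] at this
    exact this.resolve_left hc

theorem stableRank_act_X_orbitModule (ha : ∀ k, a k ≠ 0) :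
    stableRank (act (orbitModule t a b hab) (GWA.X (σ p) t)) = p := by
  rw [stableRank_of_surjective, finrank_orbitModule]
  intro v
  refine ⟨(coord t a b hab).symm fun k => (a k)⁻¹ * coord t a b hab v (k + 1), ?_⟩
  refine (coord t a b hab).injective (funext fun k => ?_)
  obtain ⟨k, rfl⟩ : ∃ j, k = j + 1 := ⟨k - 1, by simp⟩
  rw [act_apply, coord_X_smul, LinearEquiv.apply_symm_apply, mul_inv_cancel_left₀ (ha k)]

theorem stableRank_act_Y_orbitModule (hb : ∀ k, b k ≠ 0) :
    stableRank (act (orbitModule t a b hab) (GWA.Y (σ p) t)) = p := by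
  rw [stableRank_of_surjective, finrank_orbitModule]
  intro v
  refine ⟨(coord t a b hab).symm fun k => (b (k - 1))⁻¹ * coord t a b hab v (k - 1), ?_⟩
  refine (coord t a b hab).injective (funext fun k => ?_)
  rw [act_apply, coord_Y_smul, LinearEquiv.apply_symm_apply, add_sub_cancel_right,
    mul_inv_cancel_left₀ (hb k)]

end orbitModule

/-! ### The three types of simple modules -/

section simple

variable (p) (t : ℂ[T;T⁻¹])

/-- The module on which `X` acts invertibly, with monodromy `ξ`. -/
noncomputable abbrev xModule (ξ : ℂˣ) : WeightModule (σ p) (ω p) t :=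
  orbitModule t (fun k => twistFactor ξ k)
    (fun k => evalOrbit p t k * ((twistFactor ξ k)⁻¹ : ℂˣ)) (fun k => by
      rw [mul_left_comm, Units.mul_inv, mul_one])

/-- The module on which `Y` acts invertibly, with monodromy `ξ⁻¹`. -/
noncomputable abbrev yModule (ξ : ℂˣ) : WeightModule (σ p) (ω p) t :=
  orbitModule t (fun k => evalOrbit p t k * twistFactor ξ k)
    (fun k => ((twistFactor ξ k)⁻¹ : ℂˣ)) (fun k => by
      rw [mul_assoc, Units.mul_inv, mul_one])

theorem twistFactor_one (k : Fin p) : twistFactor 1 k = 1 := by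
  unfold twistFactor
  split_ifs <;> rfl

theorem twist_xModule_isIso (ξ : ℂˣ) :
    WeightModule.IsIso (twist (xModule p t 1) ξ) (xModule p t ξ) :=
  twist_orbitModule_isIso ξ (fun k => by simp [twistFactor_one])
    (fun k => by simp [twistFactor_one])

theorem twist_yModule_isIso (ξ : ℂˣ) :
    WeightModule.IsIso (twist (yModule p t 1) ξ) (yModule p t ξ) :=
  twist_orbitModule_isIso ξ (fun k => by simp [twistFactor_one])
    (fun k => by simp [twistFactor_one])

variable {p}

/-- The vertices of the segment that ends at `k`. -/
def segment (k : Fin p) : Set (Fin p) :=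
  {l | ∀ i, i ≠ k → (k - i).val ≤ (k - l).val → evalOrbit p t i ≠ 0}

variable {t}

theorem self_mem_segment (k : Fin p) : k ∈ segment t k := by
  intro i hi h
  rw [sub_self, Fin.val_zero, Nat.le_zero] at h
  exact absurd (sub_eq_zero.mp (Fin.ext (by rw [h, Fin.val_zero]))).symm hi

theorem mem_segment_iff {k l : Fin p} (h : l ≠ k) :
    l ∈ segment t k ↔ evalOrbit p t l ≠ 0 ∧ l + 1 ∈ segment t k := by
  have hv := val_sub_add_one h
  constructor
  · intro hl
    exact ⟨hl l h le_rfl, fun i hi hi' => hl i hi (by omega)⟩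
  · rintro ⟨h1, h2⟩ i hi hi'
    rcases Nat.lt_or_ge (k - (l + 1)).val (k - i).val with h3 | h3
    · have h4 : k - i = k - l := Fin.ext (by omega)
      have h5 : i = l := sub_right_inj.mp h4
      rwa [h5]
    · exact h2 i hi h3

/-- The module with `X e_l = t(q^l) e_{l+1}` for all `l`, `Y e_{l+1} = e_l` for `l ≠ k` and
`Y e_{k+1} = 0`. -/
noncomputable abbrev brokenModule (k : Fin p) (hk : evalOrbit p t k = 0) :
    WeightModule (σ p) (ω p) t :=
  orbitModule t (evalOrbit p t) (fun l => if l = k then 0 else 1) (fun l => by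
    split_ifs with h
    · rw [h, hk, zero_mul]
    · rw [mul_one])

/-- The vectors of `brokenModule` that vanish on the segment ending at `k`. -/
noncomputable def segmentKernel (k : Fin p) (hk : evalOrbit p t k = 0) :
    Submodule (GWA (σ p) t) (brokenModule k hk).carrier where
  carrier := {v | ∀ l ∈ segment t k, coord _ _ _ _ v l = 0}
  zero_mem' := fun l _ => by rw [map_zero]; rfl
  add_mem' := fun hv hw l hl => by rw [map_add, Pi.add_apply, hv l hl, hw l hl, add_zero]
  smul_mem' := fun a v₀ => by
    refine GWA.induction (P := fun a => ∀ v ∈ {v | ∀ l ∈ segment t k, coord _ _ _ _ v l = 0},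
      a • v ∈ {v | ∀ l ∈ segment t k, coord _ _ _ _ v l = 0}) ?_ ?_ ?_ ?_ ?_ a v₀
    · intro f v hv l hl
      rw [WeightModule.coeff_smul, coord_smul, hv l hl, mul_zero]
    · intro v hv l hl
      obtain ⟨l, rfl⟩ : ∃ j, l = j + 1 := ⟨l - 1, by simp⟩
      rw [coord_X_smul]
      by_cases h : l = k
      · rw [h, hk, zero_mul]
      · by_cases h' : evalOrbit p t l = 0
        · rw [h', zero_mul]
        · rw [hv l ((mem_segment_iff h).mpr ⟨h', hl⟩), mul_zero]
    · intro v hv l hl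
      rw [coord_Y_smul]
      by_cases h : l = k
      · rw [if_pos h, zero_mul]
      · rw [hv _ ((mem_segment_iff h).mp hl).2, mul_zero]
    · intro a b ha hb v hv
      rw [mul_smul]
      exact ha _ (hb _ hv)
    · intro a b ha hb v hv l hl
      rw [add_smul, map_add, Pi.add_apply, ha v hv l hl, hb v hv l hl, add_zero]

/-- The simple module supported on the segment that ends at `k`. -/
noncomputable abbrev segmentModule (k : Fin p) (hk : evalOrbit p t k = 0) :
    WeightModule (σ p) (ω p) t := quotModule (brokenModule k hk) (segmentKernel k hk)

theorem isNilpotent_act_quotModule {V : WeightModule (σ p) (ω p) t}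
    (N : Submodule (GWA (σ p) t) V.carrier) {a : GWA (σ p) t} (h : IsNilpotent (act V a)) :
    IsNilpotent (act (quotModule V N) a) := by
  obtain ⟨n, hn⟩ := h
  refine ⟨n, LinearMap.ext fun w => ?_⟩
  obtain ⟨v, rfl⟩ := quotMk_surjective V N w
  rw [← map_pow] at hn ⊢
  have h1 : a ^ n • v = 0 := DFunLike.congr_fun hn v
  rw [act_apply, ← map_smul, h1, map_zero]
  rfl

theorem stableRank_act_X_segmentModule (k : Fin p) (hk : evalOrbit p t k = 0) :
    stableRank (act (segmentModule k hk) (GWA.X (σ p) t)) = 0 :=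
  stableRank_eq_zero_of_isNilpotent (isNilpotent_act_quotModule _ (isNilpotent_act_X hk))

theorem stableRank_act_Y_segmentModule (k : Fin p) (hk : evalOrbit p t k = 0) :
    stableRank (act (segmentModule k hk) (GWA.Y (σ p) t)) = 0 :=
  stableRank_eq_zero_of_isNilpotent (isNilpotent_act_quotModule _
    (isNilpotent_act_Y (k := k) (if_pos rfl)))

theorem exists_idem_smul_ne_zero (k : Fin p) (hk : evalOrbit p t k = 0) :
    ∃ w : (segmentModule k hk).carrier, w ≠ 0 ∧ (idem k : ℂ[T;T⁻¹]) • w = w := by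
  let e : (brokenModule k hk).carrier := (coord _ _ _ _).symm (Pi.single k 1)
  refine ⟨quotMk _ _ e, fun h => ?_, ?_⟩
  · have h1 := (quotMk_eq_zero _ _).mp h k (self_mem_segment k)
    rw [LinearEquiv.apply_symm_apply, Pi.single_eq_same] at h1
    exact one_ne_zero h1
  · rw [← WeightModule.coeff_smul]
    refine ((quotMk _ _).map_smul _ e).symm.trans (congrArg _ ?_)
    rw [WeightModule.coeff_smul]
    refine (coord _ _ _ _).injective (funext fun j => ?_)
    rw [coord_smul, evalOrbit_idem, LinearEquiv.apply_symm_apply]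
    by_cases h : j = k
    · rw [h, Pi.single_eq_same, mul_one]
    · rw [Pi.single_eq_of_ne h, mul_zero]

theorem nontrivial_segmentModule (k : Fin p) (hk : evalOrbit p t k = 0) :
    Nontrivial (segmentModule k hk).carrier := by
  obtain ⟨w, hw, -⟩ := exists_idem_smul_ne_zero k hk
  exact ⟨w, 0, hw⟩

theorem stableRank_act_idem_segmentModule_self (k : Fin p) (hk : evalOrbit p t k = 0) :
    stableRank (act (segmentModule k hk) (GWA.coeff (σ p) t (idem k))) ≠ 0 := by
  rw [stableRank_of_isIdempotentElem]
  · obtain ⟨w, hw, hw'⟩ := exists_idem_smul_ne_zero k hk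
    intro h
    rw [Submodule.finrank_eq_zero] at h
    have hm : w ∈ LinearMap.range (act (segmentModule k hk) (GWA.coeff (σ p) t (idem k))) :=
      ⟨w, by rw [act_apply, WeightModule.coeff_smul, hw']⟩
    rw [h] at hm
    exact hw hm
  · refine LinearMap.ext fun v => ?_
    change GWA.coeff (σ p) t (idem k) • GWA.coeff (σ p) t (idem k) • v =
      GWA.coeff (σ p) t (idem k) • v
    simp only [WeightModule.coeff_smul]
    exact idem_smul_idem_smul_self k v

theorem stableRank_act_idem_segmentModule (k : Fin p) (hk : evalOrbit p t k = 0) {j : Fin p}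
    (hjk : j ≠ k) (hj : evalOrbit p t j = 0) :
    stableRank (act (segmentModule k hk) (GWA.coeff (σ p) t (idem j))) = 0 := by
  refine stableRank_eq_zero_of_isNilpotent ⟨1, ?_⟩
  rw [pow_one]
  refine LinearMap.ext fun w => ?_
  obtain ⟨v, rfl⟩ := quotMk_surjective _ _ w
  rw [act_apply, ← map_smul]
  refine (quotMk_eq_zero _ _).mpr fun l hl => ?_
  rw [WeightModule.coeff_smul, coord_smul, evalOrbit_idem, Pi.single_eq_of_ne, zero_mul]
  rintro rfl
  exact ((mem_segment_iff hjk).mp hl).1 hj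

end simple

end RootOfUnityGWA

namespace RootOfUnityGWA

open LaurentPolynomial

variable {p : ℕ} [NeZero p]

/-! ### Existence of simple submodules of known type -/

section existence

variable {t : ℂ[T;T⁻¹]} (V : WeightModule (σ p) (ω p) t)

theorem exists_injective_xModule (h : ¬ IsNilpotent (act V (GWA.X (σ p) t))) :
    ∃ (ξ : ℂˣ) (f : (xModule p t ξ).carrier →ₗ[GWA (σ p) t] V.carrier),
      Function.Injective f := by
  obtain ⟨c, v, hc, hv, h⟩ := exists_eigenvector_of_not_isNilpotent h
  rw [act_apply] at h
  let c' : ℂˣ := Units.mk0 c hc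
  have hX : ∀ k : Fin p, GWA.X (σ p) t • idem k • v = c • idem (k + 1) • v := fun k => by
    rw [X_smul_idem_smul, h, smul_comm]
  have hne : ∀ k : Fin p, (idem k : ℂ[T;T⁻¹]) • v ≠ 0 := by
    intro k hk
    refine hv ?_
    have : ∀ l : Fin p, (idem l : ℂ[T;T⁻¹]) • v = 0 :=
      fin_cyclic_induction k hk fun l hl => by
        have := hX l
        rw [hl, smul_zero] at this
        exact (smul_eq_zero.mp this.symm).resolve_left hc
    rw [← sum_idem_smul v]
    exact Finset.sum_eq_zero fun l _ => this l
  obtain ⟨w, hwd⟩ : ∃ w : Fin p → V.carrier,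
      ∀ k, w k = c ^ (k - 1).val • (idem k : ℂ[T;T⁻¹]) • v := ⟨_, fun _ => rfl⟩
  have hw : ∀ k, (idem k : ℂ[T;T⁻¹]) • w k = w k := fun k => by
    rw [hwd, smul_comm, idem_smul_idem_smul_self]
  have hXw : ∀ k, GWA.X (σ p) t • w k = (twistFactor (c' ^ p) k : ℂ) • w (k + 1) := fun k => by
    rw [hwd, hwd, carrier_smul_comm, hX, smul_smul, smul_smul, ← pow_succ, add_sub_cancel_right]
    exact congrArg (· • _) (pow_val_sub_one c' k)
  refine ⟨c' ^ p, exists_injective_of_orbitModule V w hw (fun k => ?_) hXw (fun k => ?_)⟩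
  · rw [hwd]
    exact smul_ne_zero (pow_ne_zero _ hc) (hne k)
  · have h1 : GWA.Y (σ p) t • w (k + 1) =
        (((twistFactor (c' ^ p) k)⁻¹ : ℂˣ) : ℂ) • GWA.Y (σ p) t • GWA.X (σ p) t • w k := by
      rw [hXw, carrier_smul_comm, smul_smul, Units.inv_mul, one_smul]
    rw [h1, Y_smul_X_smul (hw k), smul_smul, mul_comm]

theorem exists_injective_yModule (h : ¬ IsNilpotent (act V (GWA.Y (σ p) t))) :
    ∃ (ξ : ℂˣ) (f : (yModule p t ξ).carrier →ₗ[GWA (σ p) t] V.carrier),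
      Function.Injective f := by
  obtain ⟨c, v, hc, hv, h⟩ := exists_eigenvector_of_not_isNilpotent h
  rw [act_apply] at h
  let c' : ℂˣ := (Units.mk0 c hc)⁻¹
  have hY : ∀ k : Fin p, GWA.Y (σ p) t • idem (k + 1) • v = c • idem k • v := fun k => by
    rw [Y_smul_idem_smul, h, smul_comm]
  have hne : ∀ k : Fin p, (idem k : ℂ[T;T⁻¹]) • v ≠ 0 := by
    intro k hk
    refine hv ?_
    have : ∀ l : Fin p, (idem l : ℂ[T;T⁻¹]) • v = 0 :=
      fin_cyclic_induction_down k hk fun l hl => by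
        have := hY l
        rw [hl, smul_zero] at this
        exact (smul_eq_zero.mp this.symm).resolve_left hc
    rw [← sum_idem_smul v]
    exact Finset.sum_eq_zero fun l _ => this l
  obtain ⟨w, hwd⟩ : ∃ w : Fin p → V.carrier,
      ∀ k, w k = (c' : ℂ) ^ (k - 1).val • (idem k : ℂ[T;T⁻¹]) • v := ⟨_, fun _ => rfl⟩
  have hw : ∀ k, (idem k : ℂ[T;T⁻¹]) • w k = w k := fun k => by
    rw [hwd, smul_comm, idem_smul_idem_smul_self]
  have hYw : ∀ k, w k = (twistFactor (c' ^ p) k : ℂ) • GWA.Y (σ p) t • w (k + 1) := fun k => by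
    rw [hwd, hwd, carrier_smul_comm, hY, smul_smul, smul_smul, add_sub_cancel_right,
      ← pow_val_sub_one c' k, pow_succ, mul_assoc]
    rw [show (c' : ℂ) * c = 1 from Units.inv_mul (Units.mk0 c hc), mul_one]
  refine ⟨c' ^ p, exists_injective_of_orbitModule V w hw (fun k => ?_) (fun k => ?_) (fun k => ?_)⟩
  · rw [hwd]
    exact smul_ne_zero (pow_ne_zero _ (Units.ne_zero c')) (hne k)
  · conv_lhs => rw [hYw k]
    rw [carrier_smul_comm, X_smul_Y_smul (hw _), smul_smul, mul_comm]
  · conv_rhs => rw [hYw k]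
    rw [smul_smul, Units.inv_mul, one_smul]

theorem exists_homogeneous_of_isNilpotent [Nontrivial V.carrier]
    (hX : IsNilpotent (act V (GWA.X (σ p) t))) :
    ∃ (k : Fin p) (w : V.carrier), w ≠ 0 ∧ (idem k : ℂ[T;T⁻¹]) • w = w ∧
      GWA.X (σ p) t • w = 0 := by
  obtain ⟨v, hv, hv0⟩ : ∃ v : V.carrier, v ≠ 0 ∧ GWA.X (σ p) t • v = 0 := by
    by_contra! hcon
    obtain ⟨v, hv⟩ := exists_ne (0 : V.carrier)
    have h : ∀ n : ℕ, (act V (GWA.X (σ p) t) ^ n) v ≠ 0 := by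
      intro n
      induction n with
      | zero => exact hv
      | succ n ih =>
        intro h
        rw [pow_succ'] at h
        exact hcon _ ih h
    obtain ⟨n, hn⟩ := hX
    exact h n (by rw [hn]; rfl)
  obtain ⟨k, hk⟩ : ∃ k : Fin p, (idem k : ℂ[T;T⁻¹]) • v ≠ 0 := by
    by_contra! hcon
    refine hv ?_
    rw [← sum_idem_smul v]
    exact Finset.sum_eq_zero fun l _ => hcon l
  exact ⟨k, _, hk, idem_smul_idem_smul_self k v, by rw [X_smul_idem_smul, hv0, smul_zero]⟩

theorem exists_injective_segmentModule [Nontrivial V.carrier]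
    (hX : IsNilpotent (act V (GWA.X (σ p) t))) (hY : IsNilpotent (act V (GWA.Y (σ p) t))) :
    ∃ (k : Fin p) (hk : evalOrbit p t k = 0)
      (f : (segmentModule k hk).carrier →ₗ[GWA (σ p) t] V.carrier), Function.Injective f := by
  classical
  have hex : ∃ N : ℕ, ∃ (k : Fin p) (w : V.carrier), w ≠ 0 ∧ (idem k : ℂ[T;T⁻¹]) • w = w ∧
      GWA.X (σ p) t • w = 0 ∧ (GWA.Y (σ p) t) ^ N • w = 0 := by
    obtain ⟨k, w, h1, h2, h3⟩ := exists_homogeneous_of_isNilpotent V hX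
    obtain ⟨N, hN⟩ := hY
    refine ⟨N, k, w, h1, h2, h3, ?_⟩
    rw [← act_apply, map_pow, hN]
    rfl
  obtain ⟨k, w₀, hne, hid, hXw, hYw⟩ := Nat.find_spec hex
  have hmin := fun m => Nat.find_min hex (m := m)
  set N := Nat.find hex
  have hk : evalOrbit p t k = 0 := by
    have h := Y_smul_X_smul hid
    rw [hXw, smul_zero] at h
    exact (smul_eq_zero.mp h.symm).resolve_right hne
  let w : Fin p → V.carrier := fun l => (GWA.Y (σ p) t) ^ (k - l).val • w₀
  have hwk : w k = w₀ := by
    change (GWA.Y (σ p) t) ^ (k - k).val • w₀ = w₀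
    rw [sub_self, Fin.val_zero, pow_zero, one_smul]
  have hstep : ∀ l, l ≠ k → w l = GWA.Y (σ p) t • w (l + 1) := by
    intro l hl
    change (GWA.Y (σ p) t) ^ (k - l).val • w₀ = _ • (GWA.Y (σ p) t) ^ (k - (l + 1)).val • w₀
    rw [← val_sub_add_one hl, pow_succ', mul_smul]
  have hdown : ∀ P : Fin p → Prop, P k → (∀ l, l ≠ k → P (l + 1) → P l) → ∀ l, P l := by
    intro P h0 hs
    refine fin_cyclic_induction_down k h0 fun l hl => ?_
    by_cases h : l = k
    · rwa [h]
    · exact hs l h hl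
  have hw : ∀ l, (idem l : ℂ[T;T⁻¹]) • w l = w l := by
    refine hdown _ (by rw [hwk, hid]) fun l hl ih => ?_
    rw [hstep l hl, ← Y_smul_idem_smul, ih]
  have hXw' : ∀ l, GWA.X (σ p) t • w l = evalOrbit p t l • w (l + 1) := by
    intro l
    by_cases hl : l = k
    · rw [hl, hwk, hXw, hk, zero_smul]
    · rw [hstep l hl, X_smul_Y_smul (hw _)]
  have hzero : ∀ i l, (k - i).val ≤ (k - l).val → w i = 0 → w l = 0 := by
    intro i l hil hi
    obtain ⟨m, hm⟩ := Nat.exists_eq_add_of_le' hil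
    change (GWA.Y (σ p) t) ^ (k - l).val • w₀ = 0
    rw [hm, pow_add, mul_smul]
    exact (congrArg _ hi).trans (smul_zero _)
  have hbreak : ∀ i, i ≠ k → evalOrbit p t i = 0 → w i = 0 := by
    intro i hi hti
    by_contra hwi
    have hpos : 0 < (k - i).val := by
      rw [← val_sub_add_one hi]; omega
    have hN0 : 0 < N := by
      rcases Nat.eq_zero_or_pos N with h | h
      · rw [h, pow_zero, one_smul] at hYw
        exact absurd hYw hne
      · exact h
    refine hmin (N - (k - i).val) (by omega) ⟨i, w i, hwi, hw i, ?_, ?_⟩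
    · rw [hXw', hti, zero_smul]
    · change _ • (GWA.Y (σ p) t) ^ (k - i).val • w₀ = 0
      rw [smul_smul, ← pow_add]
      obtain ⟨m, hm⟩ := Nat.exists_eq_add_of_le'
        (show N ≤ N - (k - i).val + (k - i).val by omega)
      rw [hm, pow_add, mul_smul, hYw, smul_zero]
  have hYw' : ∀ l, GWA.Y (σ p) t • w (l + 1) = (if l = k then (0 : ℂ) else 1) • w l := by
    intro l
    by_cases hl : l = k
    · rw [if_pos hl, zero_smul, hl]
      by_contra hu
      rcases Nat.eq_zero_or_pos N with h | h
      · rw [h, pow_zero, one_smul] at hYw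
        exact hne hYw
      refine hmin (N - 1) (by omega) ⟨k, _, hu, ?_, ?_, ?_⟩
      · rw [← Y_smul_idem_smul, hw]
      · rw [X_smul_Y_smul (hw _), hk, zero_smul]
      · change _ • _ • (GWA.Y (σ p) t) ^ (k - (k + 1)).val • w₀ = 0
        rw [smul_smul, ← pow_succ, smul_smul, ← pow_add, Nat.sub_add_cancel h, add_comm, pow_add,
          mul_smul, hYw, smul_zero]
    · rw [if_neg hl, one_smul, hstep l hl]
  have hseg : ∀ l, w l ≠ 0 ↔ l ∈ segment t k := by
    intro l
    constructor
    · intro hl i hi hil hti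
      exact hl (hzero i l hil (hbreak i hi hti))
    · refine hdown (fun l => l ∈ segment t k → w l ≠ 0) (fun _ => by rwa [hwk]) ?_ l
      intro l hl ih hls h
      obtain ⟨h1, h2⟩ := (mem_segment_iff hl).mp hls
      have h3 := hXw' l
      rw [h, smul_zero] at h3
      exact smul_ne_zero h1 (ih h2) h3.symm
  obtain ⟨f, hf⟩ := exists_hom_of_orbitModule (t := t) (a := evalOrbit p t)
    (b := fun l => if l = k then 0 else 1) (hab := fun l => by
      split_ifs with h
      · rw [h, hk, zero_mul]
      · rw [mul_one]) V w hw hXw' hYw'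
  refine ⟨k, hk, exists_injective_of_quotModule (brokenModule k hk) (segmentKernel k hk) f ?_⟩
  ext v
  rw [LinearMap.mem_ker, hf]
  simp only [hseg]
  rfl

end existence

/-! ### Generators of `𝒜(p)` -/

theorem toAp_cls_xModule (t : M p) (ξ : ℂˣ) :
    toAp p (GrothendieckRing.cls t (xModule p t ξ)) =
      toAp p (GrothendieckRing.cls t (xModule p t 1)) := by
  rw [← GrothendieckRing.cls_eq_of_isIso rfl (twist_xModule_isIso p t ξ), toAp_cls_twist]

theorem toAp_cls_yModule (t : M p) (ξ : ℂˣ) :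
    toAp p (GrothendieckRing.cls t (yModule p t ξ)) =
      toAp p (GrothendieckRing.cls t (yModule p t 1)) := by
  rw [← GrothendieckRing.cls_eq_of_isIso rfl (twist_yModule_isIso p t ξ), toAp_cls_twist]

theorem toAp_cls_mem (t : M p) (S : Submodule ℂ (Ap p))
    (hx : toAp p (GrothendieckRing.cls t (xModule p t 1)) ∈ S)
    (hy : toAp p (GrothendieckRing.cls t (yModule p t 1)) ∈ S)
    (hs : ∀ (k : Fin p) (hk : evalOrbit p t k = 0),
      toAp p (GrothendieckRing.cls t (segmentModule k hk)) ∈ S)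
    (V : WeightModule (σ p) (ω p) (t : ℂ[T;T⁻¹])) : toAp p (GrothendieckRing.cls t V) ∈ S := by
  have key : ∀ (n : ℕ) (V : WeightModule (σ p) (ω p) (t : ℂ[T;T⁻¹])),
      Module.finrank ℂ V.carrier = n → toAp p (GrothendieckRing.cls t V) ∈ S := by
    intro n
    induction n using Nat.strong_induction_on with
    | _ n ih =>
      intro V hV
      rcases subsingleton_or_nontrivial V.carrier with h0 | h0
      · rw [GrothendieckRing.cls, K0.of_eq_zero V h0, TensorProduct.tmul_zero, map_zero, map_zero]
        exact S.zero_mem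
      have step : ∀ (U : WeightModule (σ p) (ω p) (t : ℂ[T;T⁻¹]))
          (f : U.carrier →ₗ[GWA (σ p) (t : ℂ[T;T⁻¹])] V.carrier), Function.Injective f →
          0 < Module.finrank ℂ U.carrier → toAp p (GrothendieckRing.cls t U) ∈ S →
          toAp p (GrothendieckRing.cls t V) ∈ S := by
        intro U f hf hU hUS
        have hE := isExtension_quotModule V f hf
        have h1 := finrank_eq_add_of_isExtension hE
        rw [GrothendieckRing.cls_eq_add t hE, map_add]
        exact S.add_mem hUS (ih _ (by omega) _ rfl)
      by_cases hX : IsNilpotent (act V (GWA.X (σ p) t))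
      · by_cases hY : IsNilpotent (act V (GWA.Y (σ p) t))
        · obtain ⟨k, hk, f, hf⟩ := exists_injective_segmentModule V hX hY
          have := nontrivial_segmentModule k hk
          exact step _ f hf Module.finrank_pos (hs k hk)
        · obtain ⟨ξ, f, hf⟩ := exists_injective_yModule V hY
          refine step _ f hf ?_ (by rw [toAp_cls_yModule]; exact hy)
          rw [finrank_orbitModule]
          exact NeZero.pos p
      · obtain ⟨ξ, f, hf⟩ := exists_injective_xModule V hX
        refine step _ f hf ?_ (by rw [toAp_cls_xModule]; exact hx)
        rw [finrank_orbitModule]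
        exact NeZero.pos p
  exact key _ V rfl

theorem incl_mem (t : M p) (S : Submodule ℂ (Ap p))
    (hS : ∀ V : WeightModule (σ p) (ω p) (t : ℂ[T;T⁻¹]), toAp p (GrothendieckRing.cls t V) ∈ S)
    (x : ℂ ⊗[ℤ] K0 (σ p) (ω p) (t : ℂ[T;T⁻¹])) :
    toAp p (GrothendieckRing.incl (σ p) (ω p) t x) ∈ S := by
  have h : (((S.mkQ.comp (toAp p)).comp
      (GrothendieckRing.incl (σ p) (ω p) t)).toAddMonoidHom.comp
      (TensorProduct.mk ℤ ℂ (K0 (σ p) (ω p) (t : ℂ[T;T⁻¹])) 1).toAddMonoidHom) = 0 :=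
    K0.hom_ext fun V => (Submodule.Quotient.mk_eq_zero S).mpr (hS V)
  induction x using TensorProduct.induction_on with
  | zero => rw [map_zero, map_zero]; exact S.zero_mem
  | tmul c a =>
    have h1 : c ⊗ₜ[ℤ] a = c • ((1 : ℂ) ⊗ₜ[ℤ] a) := by
      rw [TensorProduct.smul_tmul', smul_eq_mul, mul_one]
    rw [h1, map_smul, map_smul]
    exact S.smul_mem _ ((Submodule.Quotient.mk_eq_zero S).mp (DFunLike.congr_fun h a))
  | add a b ha hb => rw [map_add, map_add]; exact S.add_mem ha hb

end RootOfUnityGWA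

namespace RootOfUnityGWA

open LaurentPolynomial

variable {p : ℕ}

/-! ### The monoid `M` -/

theorem toM_apply (d : Fin p →₀ ℕ) :
    (toM p (Multiplicative.ofAdd d) : ℂ[T;T⁻¹]) = ∏ k, lin p k ^ d k := rfl

theorem toM_surjective : Function.Surjective (toM p) := by
  rintro ⟨t, ht⟩
  induction ht using Submonoid.closure_induction with
  | mem t ht =>
    obtain ⟨k, rfl⟩ := ht
    refine ⟨Multiplicative.ofAdd (Finsupp.single k 1), Subtype.ext ?_⟩
    rw [toM_apply, Finset.prod_eq_single k]
    · rw [Finsupp.single_eq_same, pow_one]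
    · intro j _ hj
      rw [Finsupp.single_eq_of_ne hj, pow_zero]
    · exact fun h => absurd (Finset.mem_univ k) h
  | one => exact ⟨1, map_one _⟩
  | mul s t hs ht ihs iht =>
    obtain ⟨d, hd⟩ := ihs
    obtain ⟨e, he⟩ := iht
    exact ⟨d * e, by rw [map_mul, hd, he]; rfl⟩

section
variable [NeZero p]

theorem q_pow_injective : Function.Injective fun k : Fin p => (q p : ℂ) ^ (k : ℕ) :=
  fun a b hab => Fin.ext ((isPrimitiveRoot_q p).pow_inj a.2 b.2 hab)

theorem toM_injective : Function.Injective (toM p) := by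
  classical
  intro d e h
  let P : (Fin p →₀ ℕ) → Polynomial ℂ := fun d =>
    ∏ k : Fin p, (Polynomial.X - Polynomial.C ((q p : ℂ) ^ (k : ℕ))) ^ d k
  have hP : ∀ d : Fin p →₀ ℕ, (Polynomial.toLaurent (P d) : ℂ[T;T⁻¹]) =
      toM p (Multiplicative.ofAdd d) := fun d => by
    rw [toM_apply, map_prod]
    refine Finset.prod_congr rfl fun k _ => ?_
    rw [map_pow, map_sub, Polynomial.toLaurent_X, Polynomial.toLaurent_C]
    rfl
  have hde : P d.toAdd = P e.toAdd := by
    refine Polynomial.toLaurent_injective ?_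
    rw [hP, hP]
    exact congrArg Subtype.val h
  have hcount : ∀ (d : Fin p →₀ ℕ) (k : Fin p),
      (P d).roots.count ((q p : ℂ) ^ (k : ℕ)) = d k := by
    intro d k
    have hne : P d ≠ 0 := Finset.prod_ne_zero_iff.mpr fun l _ =>
      pow_ne_zero _ (Polynomial.X_sub_C_ne_zero _)
    rw [Polynomial.roots_prod _ _ hne, Multiset.count_bind]
    change ∑ l : Fin p, _ = _
    rw [Finset.sum_eq_single k]
    · rw [Polynomial.roots_pow, Polynomial.roots_X_sub_C, Multiset.count_nsmul,
        Multiset.count_singleton_self, mul_one]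
    · intro l _ hl
      rw [Polynomial.roots_pow, Polynomial.roots_X_sub_C, Multiset.count_nsmul,
        Multiset.count_singleton, if_neg fun h => hl (q_pow_injective h).symm, mul_zero]
    · exact fun h => absurd (Finset.mem_univ k) h
  refine Multiplicative.toAdd.injective (Finsupp.ext fun k => ?_)
  rw [← hcount, ← hcount, hde]

theorem evalOrbit_toM_eq_zero_iff (d : Fin p →₀ ℕ) (k : Fin p) :
    evalOrbit p (toM p (Multiplicative.ofAdd d)) k = 0 ↔ d k ≠ 0 := by
  rw [toM_apply, map_prod, Finset.prod_apply, Finset.prod_eq_zero_iff]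
  have h : ∀ l, evalOrbit p (lin p l) k = (q p : ℂ) ^ (k : ℕ) - (q p : ℂ) ^ (l : ℕ) := fun l => by
    rw [lin, map_sub, Pi.sub_apply, evalOrbit_T, evalOrbit_C]
  constructor
  · rintro ⟨l, -, hl⟩
    rw [map_pow, Pi.pow_apply, h] at hl
    have hd : d l ≠ 0 := fun h0 => by
      rw [h0, pow_zero] at hl
      exact one_ne_zero hl
    rw [pow_eq_zero_iff hd, sub_eq_zero] at hl
    rwa [q_pow_injective hl]
  · intro hk
    refine ⟨k, Finset.mem_univ k, ?_⟩
    rw [map_pow, Pi.pow_apply, h, sub_self, zero_pow hk]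

/-! ### The components of `𝒜(p)` -/

theorem toAp_cls_mem_piece {d : Fin p →₀ ℕ} {t : M p} (h : toM p (Multiplicative.ofAdd d) = t)
    (V : WeightModule (σ p) (ω p) (t : ℂ[T;T⁻¹])) :
    toAp p (GrothendieckRing.cls t V) ∈ piece p d := by
  subst h
  exact ⟨_, ⟨_, rfl⟩, rfl⟩

theorem piece_le (d : Fin p →₀ ℕ) (S : Submodule ℂ (Ap p))
    (hS : ∀ V, toAp p (GrothendieckRing.cls (toM p (Multiplicative.ofAdd d)) V) ∈ S) :
    piece p d ≤ S := by
  rintro _ ⟨_, ⟨x, rfl⟩, rfl⟩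
  exact incl_mem _ S hS x

theorem piece_eq_span (d : Fin p →₀ ℕ) : piece p d = Submodule.span ℂ
    (Set.range fun V => toAp p (GrothendieckRing.cls (toM p (Multiplicative.ofAdd d)) V)) := by
  refine le_antisymm (piece_le d _ fun V => Submodule.subset_span ⟨V, rfl⟩) ?_
  rw [Submodule.span_le]
  rintro _ ⟨V, rfl⟩
  exact toAp_cls_mem_piece rfl V

/-- The functional on `𝒜(p)` given by the stable rank of `X`. -/
noncomputable def stableRankX (p : ℕ) [NeZero p] : Ap p →ₗ[ℂ] ℂ :=
  stableRankAp (fun t => GWA.X (σ p) t) fun _ V ξ => stableRank_act_X_twist V ξ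

/-- The functional on `𝒜(p)` given by the stable rank of `Y`. -/
noncomputable def stableRankY (p : ℕ) [NeZero p] : Ap p →ₗ[ℂ] ℂ :=
  stableRankAp (fun t => GWA.Y (σ p) t) fun _ V ξ => stableRank_act_Y_twist V ξ

/-- The functional on `𝒜(p)` given by the dimension of the `k`-th weight space. -/
noncomputable def weightDim (k : Fin p) : Ap p →ₗ[ℂ] ℂ :=
  stableRankAp (fun t => GWA.coeff (σ p) t (idem k)) fun _ V ξ => stableRank_act_coeff_twist V ξ _

theorem stableRankX_toAp_cls (t : M p) (V : WeightModule (σ p) (ω p) (t : ℂ[T;T⁻¹])) :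
    stableRankX p (toAp p (GrothendieckRing.cls t V)) = stableRank (act V (GWA.X (σ p) t)) :=
  stableRankAp_toAp_cls _ _ t V

theorem stableRankY_toAp_cls (t : M p) (V : WeightModule (σ p) (ω p) (t : ℂ[T;T⁻¹])) :
    stableRankY p (toAp p (GrothendieckRing.cls t V)) = stableRank (act V (GWA.Y (σ p) t)) :=
  stableRankAp_toAp_cls _ _ t V

theorem weightDim_toAp_cls (k : Fin p) (t : M p)
    (V : WeightModule (σ p) (ω p) (t : ℂ[T;T⁻¹])) :
    weightDim k (toAp p (GrothendieckRing.cls t V)) =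
      stableRank (act V (GWA.coeff (σ p) t (idem k))) :=
  stableRankAp_toAp_cls _ _ t V

/-- The classes of the simple modules in degree `d ≠ 0`. -/
noncomputable def simpleClass (d : Fin p →₀ ℕ) : Option (Option d.support) → Ap p
  | none => toAp p (GrothendieckRing.cls (toM p (Multiplicative.ofAdd d)) (xModule p _ 1))
  | some none => toAp p (GrothendieckRing.cls (toM p (Multiplicative.ofAdd d)) (yModule p _ 1))
  | some (some k) => toAp p (GrothendieckRing.cls (toM p (Multiplicative.ofAdd d))
      (segmentModule k.1 ((evalOrbit_toM_eq_zero_iff d k.1).mpr (Finsupp.mem_support_iff.mp k.2))))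

theorem span_simpleClass (d : Fin p →₀ ℕ) :
    Submodule.span ℂ (Set.range (simpleClass d)) = piece p d := by
  refine le_antisymm ?_ (piece_le d _ fun V => toAp_cls_mem _ _ ?_ ?_ ?_ V)
  · rw [Submodule.span_le]
    rintro _ ⟨i, rfl⟩
    rcases i with _ | _ | k <;> exact toAp_cls_mem_piece rfl _
  · exact Submodule.subset_span ⟨none, rfl⟩
  · exact Submodule.subset_span ⟨some none, rfl⟩
  · intro k hk
    exact Submodule.subset_span ⟨some (some ⟨k, Finsupp.mem_support_iff.mpr
      ((evalOrbit_toM_eq_zero_iff d k).mp hk)⟩), rfl⟩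

instance finite_piece (d : Fin p →₀ ℕ) : Module.Finite ℂ (piece p d) := by
  rw [← span_simpleClass]
  exact Module.Finite.span_of_finite ℂ (Set.finite_range _)

theorem linearIndependent_simpleClass {d : Fin p →₀ ℕ} (hd : d ≠ 0) :
    LinearIndependent ℂ (simpleClass d) := by
  obtain ⟨k₀, hk₀⟩ := Finsupp.ne_iff.mp hd
  have hk₀ := (evalOrbit_toM_eq_zero_iff d k₀).mpr hk₀
  have hp : (p : ℂ) ≠ 0 := Nat.cast_ne_zero.mpr (NeZero.ne p)
  have hk : ∀ k : d.support, evalOrbit p (toM p (Multiplicative.ofAdd d)) k.1 = 0 := fun k =>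
    (evalOrbit_toM_eq_zero_iff d k.1).mpr (Finsupp.mem_support_iff.mp k.2)
  have hXx : stableRankX p (simpleClass d none) = p := by
    rw [simpleClass, stableRankX_toAp_cls, stableRank_act_X_orbitModule]
    exact fun k => Units.ne_zero _
  have hXy : stableRankX p (simpleClass d (some none)) = 0 := by
    rw [simpleClass, stableRankX_toAp_cls, stableRank_eq_zero_of_isNilpotent, Nat.cast_zero]
    exact isNilpotent_act_X (k := k₀) (by rw [hk₀, zero_mul])
  have hXs : ∀ k, stableRankX p (simpleClass d (some (some k))) = 0 := fun k => by
    rw [simpleClass, stableRankX_toAp_cls, stableRank_act_X_segmentModule, Nat.cast_zero]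
  have hYy : stableRankY p (simpleClass d (some none)) = p := by
    rw [simpleClass, stableRankY_toAp_cls, stableRank_act_Y_orbitModule]
    exact fun k => Units.ne_zero _
  have hYs : ∀ k, stableRankY p (simpleClass d (some (some k))) = 0 := fun k => by
    rw [simpleClass, stableRankY_toAp_cls, stableRank_act_Y_segmentModule, Nat.cast_zero]
  have hss : ∀ k : d.support, weightDim k.1 (simpleClass d (some (some k))) ≠ 0 := fun k => by
    rw [simpleClass, weightDim_toAp_cls, Nat.cast_ne_zero]
    exact stableRank_act_idem_segmentModule_self _ _
  have hst : ∀ k j : d.support, k ≠ j → weightDim j.1 (simpleClass d (some (some k))) = 0 :=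
    fun k j h => by
      rw [simpleClass, weightDim_toAp_cls, stableRank_act_idem_segmentModule _ _
        (fun h' => h (Subtype.ext h'.symm)) (hk j), Nat.cast_zero]
  rw [Fintype.linearIndependent_iff]
  intro g hg
  rw [Fintype.sum_option, Fintype.sum_option] at hg
  have hx : g none = 0 := by
    have h := congrArg (stableRankX p) hg
    simp only [map_add, map_sum, map_smul, hXx, hXy, hXs, mul_zero, Finset.sum_const_zero,
      add_zero, map_zero, smul_eq_mul] at h
    exact (mul_eq_zero.mp h).resolve_right hp
  have hy : g (some none) = 0 := by
    have h := congrArg (stableRankY p) hg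
    simp only [hx, zero_smul, zero_add, map_add, map_sum, map_smul, hYy, hYs, mul_zero,
      Finset.sum_const_zero, add_zero, map_zero, smul_eq_mul] at h
    exact (mul_eq_zero.mp h).resolve_right hp
  rintro (_ | _ | k)
  · exact hx
  · exact hy
  · have h := congrArg (weightDim k.1) hg
    simp only [hx, hy, zero_smul, zero_add, map_sum, map_smul, map_zero] at h
    rw [Finset.sum_eq_single k (fun j _ hj => by rw [hst j k hj, smul_zero])
      (fun h' => absurd (Finset.mem_univ k) h')] at h
    exact (smul_eq_zero.mp h).resolve_right (hss k)

theorem finrank_piece {d : Fin p →₀ ℕ} (hd : d ≠ 0) :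
    Module.finrank ℂ (piece p d) = 2 + d.support.card := by
  rw [← span_simpleClass, finrank_span_eq_card (linearIndependent_simpleClass hd),
    Fintype.card_option, Fintype.card_option, Fintype.card_coe]
  omega

theorem finrank_piece_zero : Module.finrank ℂ (piece p 0) = 1 := by
  have ht : evalOrbit p (toM p (Multiplicative.ofAdd 0)) = 1 := by
    rw [ofAdd_zero, map_one, Submonoid.coe_one, map_one]
  have hxy : xModule p (toM p (Multiplicative.ofAdd 0) : ℂ[T;T⁻¹]) 1 =
      yModule p (toM p (Multiplicative.ofAdd 0) : ℂ[T;T⁻¹]) 1 := by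
    have h : ∀ {t : ℂ[T;T⁻¹]} {a a' b b' : Fin p → ℂ} (hab : ∀ k, a k * b k = evalOrbit p t k)
        (hab' : ∀ k, a' k * b' k = evalOrbit p t k), a = a' → b = b' →
        orbitModule t a b hab = orbitModule t a' b' hab' := by
      rintro t a _ b _ hab hab' rfl rfl
      rfl
    exact h _ _ (by simp) (by simp)
  have hspan : piece p 0 = Submodule.span ℂ {simpleClass 0 none} := by
    refine le_antisymm (piece_le 0 _ fun V => toAp_cls_mem _ _ ?_ ?_ ?_ V) ?_
    · exact Submodule.mem_span_singleton_self _
    · rw [← hxy]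
      exact Submodule.mem_span_singleton_self _
    · intro k hk
      rw [ht] at hk
      exact absurd hk one_ne_zero
    · rw [Submodule.span_singleton_le_iff_mem]
      exact toAp_cls_mem_piece rfl _
  rw [hspan]
  refine finrank_span_singleton fun h => ?_
  have h1 : stableRankX p (simpleClass 0 none) = p :=
    (stableRankX_toAp_cls _ _).trans (congrArg _
      (stableRank_act_X_orbitModule fun k => Units.ne_zero _))
  rw [h, map_zero] at h1
  exact NeZero.ne p (Nat.cast_eq_zero.mp h1.symm)

/-! ### The grading -/

/-- The isomorphism of `ℕ^p` with `M`. -/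
noncomputable def equivM (p : ℕ) [NeZero p] : Multiplicative (Fin p →₀ ℕ) ≃ M p :=
  Equiv.ofBijective (toM p) ⟨toM_injective, toM_surjective⟩

/-- The exponent vector of an element of `M`. -/
noncomputable def expM (t : M p) : Fin p →₀ ℕ := ((equivM p).symm t).toAdd

theorem toM_expM (t : M p) : toM p (Multiplicative.ofAdd (expM t)) = t :=
  (equivM p).apply_symm_apply t

theorem expM_toM (d : Fin p →₀ ℕ) : expM (toM p (Multiplicative.ofAdd d)) = d :=
  congrArg Multiplicative.toAdd ((equivM p).symm_apply_apply (Multiplicative.ofAdd d))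

/-- The decomposition of `𝒜(p)` into its components. -/
noncomputable def decomposeAp (p : ℕ) [NeZero p] :
    Ap p →ₗ[ℂ] DirectSum (Fin p →₀ ℕ) (fun d => piece p d) :=
  liftAp (fun t V => DirectSum.lof ℂ (Fin p →₀ ℕ) (fun d => piece p d) (expM t)
      ⟨toAp p (GrothendieckRing.cls t V), toAp_cls_mem_piece (toM_expM t) V⟩)
    (fun t U V W h => by
      rw [← map_add]
      refine congrArg _ (Subtype.ext ?_)
      change toAp p _ = toAp p _ + toAp p _
      rw [GrothendieckRing.cls_eq_add t h, map_add])
    (fun t V ξ => congrArg _ (Subtype.ext (toAp_cls_twist ξ t V)))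

theorem decomposeAp_toAp_cls {d : Fin p →₀ ℕ} {t : M p} (h : expM t = d)
    (V : WeightModule (σ p) (ω p) (t : ℂ[T;T⁻¹])) (hV : toAp p (GrothendieckRing.cls t V) ∈
      piece p d) :
    decomposeAp p (toAp p (GrothendieckRing.cls t V)) =
      DirectSum.lof ℂ (Fin p →₀ ℕ) (fun d => piece p d) d
        ⟨toAp p (GrothendieckRing.cls t V), hV⟩ := by
  subst h
  exact liftAp_toAp_cls _ _ _ t V

theorem coe_decomposeAp :
    DirectSum.coeLinearMap (piece p) ∘ₗ decomposeAp p = LinearMap.id := by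
  have h : (DirectSum.coeLinearMap (piece p) ∘ₗ decomposeAp p) ∘ₗ toAp p = toAp p := by
    refine GrothendieckRing.hom_ext fun t V => ?_
    rw [LinearMap.comp_apply, LinearMap.comp_apply,
      decomposeAp_toAp_cls rfl V (toAp_cls_mem_piece (toM_expM t) V),
      DirectSum.coeLinearMap_lof]
  refine LinearMap.ext fun x => ?_
  obtain ⟨x, rfl⟩ := toAp_surjective x
  exact DFunLike.congr_fun h x

theorem decomposeAp_of_mem {d : Fin p →₀ ℕ} (x : piece p d) : decomposeAp p x =
    DirectSum.lof ℂ (Fin p →₀ ℕ) (fun d => piece p d) d x := by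
  let S : Submodule ℂ (Ap p) :=
    { carrier := {x | ∃ h : x ∈ piece p d, decomposeAp p x =
        DirectSum.lof ℂ (Fin p →₀ ℕ) (fun d => piece p d) d ⟨x, h⟩}
      zero_mem' := ⟨zero_mem _, (map_zero _).trans (map_zero _).symm⟩
      add_mem' := fun ⟨hx, hx'⟩ ⟨hy, hy'⟩ => ⟨add_mem hx hy, by
        rw [map_add, hx', hy', ← map_add]; rfl⟩
      smul_mem' := fun c x ⟨hx, hx'⟩ => ⟨Submodule.smul_mem _ c hx, by
        rw [map_smul, hx', ← map_smul]; rfl⟩ }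
  have hS : piece p d ≤ S := piece_le d S fun V =>
    ⟨toAp_cls_mem_piece rfl V, decomposeAp_toAp_cls (expM_toM d) V _⟩
  exact (hS x.2).choose_spec

theorem decomposeAp_coe :
    decomposeAp p ∘ₗ DirectSum.coeLinearMap (piece p) = LinearMap.id := by
  refine DirectSum.linearMap_ext ℂ fun d => LinearMap.ext fun x => ?_
  rw [LinearMap.comp_apply, LinearMap.comp_apply, DirectSum.coeLinearMap_lof,
    decomposeAp_of_mem, LinearMap.comp_apply, LinearMap.id_apply]

theorem piece_mul_piece_le (d e : Fin p →₀ ℕ) : piece p d * piece p e ≤ piece p (d + e) := by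
  rw [piece_eq_span d, piece_eq_span e, Submodule.span_mul_span, Submodule.span_le]
  rintro _ ⟨_, ⟨V, rfl⟩, _, ⟨W, rfl⟩, rfl⟩
  change toAp p _ * toAp p _ ∈ _
  rw [← toAp_mul, GrothendieckRing.cls_mul_cls]
  exact toAp_cls_mem_piece (map_mul (toM p) _ _) _

noncomputable instance gradedAlgebraPiece : GradedAlgebra (piece p) where
  one_mem := by
    rw [← toAp_one]
    exact toAp_cls_mem_piece (map_one (toM p)) (uModule p 1)
  mul_mem := fun _ _ _ _ hx hy => piece_mul_piece_le _ _ (Submodule.mul_mem_mul hx hy)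
  toDecomposition := DirectSum.Decomposition.ofLinearMap _ (decomposeAp p) coe_decomposeAp
    decomposeAp_coe

end

end RootOfUnityGWA

namespace RootOfUnityGWA

open LaurentPolynomial

/-! ### Multivariate and total dimension series -/

section series

variable {p : ℕ}

/-- The power series with given coefficients. -/
def ofCoeff (f : (Fin p →₀ ℕ) → ℚ) : MvPowerSeries (Fin p) ℚ := f

theorem coeff_ofCoeff (f : (Fin p →₀ ℕ) → ℚ) (d : Fin p →₀ ℕ) :
    MvPowerSeries.coeff d (ofCoeff f) = f d := rfl

theorem ofCoeff_one_mul_prod_one_sub_X (s : Finset (Fin p)) :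
    ofCoeff (fun _ => 1) * ∏ i ∈ s, (1 - MvPowerSeries.X i) =
      ofCoeff (fun d => if ∀ i ∈ s, d i = 0 then 1 else 0) := by
  classical
  induction s using Finset.induction_on with
  | empty =>
    rw [Finset.prod_empty, mul_one]
    simp
  | insert i s hi ih =>
    rw [Finset.prod_insert hi, mul_left_comm, ih, sub_mul, one_mul]
    ext d
    rw [map_sub, MvPowerSeries.X, MvPowerSeries.coeff_monomial_mul, one_mul, coeff_ofCoeff,
      coeff_ofCoeff, coeff_ofCoeff]
    have h1 : (∀ j ∈ s, (d - Finsupp.single i 1 : Fin p →₀ ℕ) j = 0) ↔ ∀ j ∈ s, d j = 0 := by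
      refine forall₂_congr fun j hj => ?_
      have hij : j ≠ i := fun h => hi (h ▸ hj)
      rw [Finsupp.tsub_apply, Finsupp.single_eq_of_ne hij, tsub_zero]
    simp only [h1, Finsupp.single_le_iff, Nat.one_le_iff_ne_zero, Finset.forall_mem_insert]
    by_cases h2 : d i = 0 <;> by_cases h3 : ∀ j ∈ s, d j = 0 <;> simp [h2, h3]

theorem inv_prod_one_sub_X : (∏ i : Fin p, (1 - MvPowerSeries.X i : MvPowerSeries (Fin p) ℚ))⁻¹ =
    ofCoeff fun _ => 1 := by
  classical
  symm
  rw [MvPowerSeries.eq_inv_iff_mul_eq_one, ofCoeff_one_mul_prod_one_sub_X]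
  · ext d
    rw [MvPowerSeries.coeff_one, coeff_ofCoeff]
    refine if_congr ⟨fun h => Finsupp.ext fun i => h i (Finset.mem_univ i), ?_⟩ rfl rfl
    rintro rfl i _
    rfl
  · simp

theorem coeff_two_add_sum_X_mul (d : Fin p →₀ ℕ) :
    MvPowerSeries.coeff d ((2 + ∑ i, MvPowerSeries.X i : MvPowerSeries (Fin p) ℚ) *
      ofCoeff (fun _ => 1)) = 2 + (d.support.card : ℚ) := by
  classical
  have h2 : (2 : MvPowerSeries (Fin p) ℚ) = 1 + 1 := one_add_one_eq_two.symm
  rw [add_mul, Finset.sum_mul, map_add, map_sum, h2, add_mul, one_mul, map_add]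
  have h : ∀ i, MvPowerSeries.coeff d (MvPowerSeries.X i *
      ofCoeff (fun _ => 1)) = if d i ≠ 0 then 1 else 0 := fun i => by
    rw [MvPowerSeries.X, MvPowerSeries.coeff_monomial_mul, one_mul]
    exact if_congr (by rw [Finsupp.single_le_iff, Nat.one_le_iff_ne_zero]) rfl rfl
  simp only [h]
  rw [Finset.sum_boole]
  have hs : Finset.univ.filter (fun i => d i ≠ 0) = d.support := by
    ext i; simp
  rw [hs]
  change (1 : ℚ) + 1 + _ = _
  norm_num

/-- The number of `d ∈ ℕ^p` with `d_1 + ⋯ + d_p = n`. -/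
def compCount (p n : ℕ) : ℕ := (Finset.finsuppAntidiag (Finset.univ : Finset (Fin p)) n).card

theorem mem_finsuppAntidiag_univ {n : ℕ} {d : Fin p →₀ ℕ} :
    d ∈ Finset.finsuppAntidiag Finset.univ n ↔ ∑ i, d i = n := by
  rw [Finset.mem_finsuppAntidiag]
  exact and_iff_left (Finset.subset_univ _)

theorem card_filter_ne_zero (n : ℕ) (i : Fin p) :
    ((Finset.finsuppAntidiag (Finset.univ : Finset (Fin p)) (n + 1)).filter
      (fun d => d i ≠ 0)).card = compCount p n := by
  classical
  symm
  refine Finset.card_bij (fun d _ => d + Finsupp.single i 1) ?_ ?_ ?_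
  · intro d hd
    rw [Finset.mem_filter, mem_finsuppAntidiag_univ]
    rw [mem_finsuppAntidiag_univ] at hd
    refine ⟨?_, by simp⟩
    simp only [Finsupp.add_apply, Finset.sum_add_distrib, hd]
    simp [Finsupp.single_apply]
  · intro d _ e _ h
    exact add_right_cancel h
  · intro d hd
    rw [Finset.mem_filter, mem_finsuppAntidiag_univ] at hd
    have hle : Finsupp.single i 1 ≤ d := by
      rw [Finsupp.single_le_iff]; omega
    refine ⟨d - Finsupp.single i 1, ?_, tsub_add_cancel_of_le hle⟩
    rw [mem_finsuppAntidiag_univ]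
    have h := hd.1
    rw [← tsub_add_cancel_of_le hle] at h
    simp only [Finsupp.add_apply, Finset.sum_add_distrib] at h
    simp only [Finsupp.single_apply, Finset.sum_ite_eq, Finset.mem_univ, if_true] at h
    omega

theorem sum_card_support (n : ℕ) :
    ∑ d ∈ Finset.finsuppAntidiag (Finset.univ : Finset (Fin p)) (n + 1), d.support.card =
      p * compCount p n := by
  classical
  have h : ∀ d : Fin p →₀ ℕ, d.support.card = ∑ i, if d i ≠ 0 then 1 else 0 := fun d => by
    rw [Finset.sum_boole, Nat.cast_id]
    congr 1
    ext i; simp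
  simp only [h]
  rw [Finset.sum_comm]
  have h2 : ∀ i : Fin p, (∑ d ∈ Finset.finsuppAntidiag (Finset.univ : Finset (Fin p)) (n + 1),
      if d i ≠ 0 then 1 else 0) = compCount p n := fun i => by
    rw [Finset.sum_boole, Nat.cast_id, card_filter_ne_zero]
  rw [Finset.sum_congr rfl fun i _ => h2 i, Finset.sum_const, Finset.card_univ, Fintype.card_fin,
    smul_eq_mul]

theorem inv_one_sub_X_pow (hp : 0 < p) : ((1 - PowerSeries.X : PowerSeries ℚ) ^ p)⁻¹ =
    PowerSeries.mk fun n => (compCount p n : ℚ) := by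
  have h1 : (PowerSeries.mk fun n => (compCount p n : ℚ)) =
      (PowerSeries.invOneSubPow ℚ p).val := by
    rw [PowerSeries.invOneSubPow_val_eq_mk_sub_one_add_choose_of_pos _ _ hp]
    ext n
    rw [PowerSeries.coeff_mk, PowerSeries.coeff_mk, compCount,
      Finset.card_finsuppAntidiag_nat_eq_choose, Finset.card_univ, Fintype.card_fin]
    congr 1
    rw [Nat.sub_add_comm hp, Nat.choose_symm_add]
  symm
  rw [PowerSeries.eq_inv_iff_mul_eq_one, h1, ← PowerSeries.invOneSubPow_inv_eq_one_sub_pow]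
  · exact Units.mul_inv _
  · simp

theorem finrank_iSup_finset {ι E : Type*} [AddCommGroup E] [Module ℂ E] {W : ι → Submodule ℂ E}
    (hW : iSupIndep W) [∀ i, FiniteDimensional ℂ (W i)] (s : Finset ι) :
    FiniteDimensional ℂ (⨆ i ∈ s, W i : Submodule ℂ E) ∧
      Module.finrank ℂ (⨆ i ∈ s, W i : Submodule ℂ E) = ∑ i ∈ s, Module.finrank ℂ (W i) := by
  classical
  induction s using Finset.induction_on with
  | empty =>
    have h : (⨆ i ∈ (∅ : Finset ι), W i) = ⊥ := by simp
    rw [h, finrank_bot, Finset.sum_empty]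
    exact ⟨inferInstance, rfl⟩
  | insert i s hi ih =>
    obtain ⟨h1, h2⟩ := ih
    rw [Finset.iSup_insert, Finset.sum_insert hi, ← h2]
    refine ⟨inferInstance, ?_⟩
    have h3 := Submodule.finrank_sup_add_finrank_inf_eq (W i) (⨆ j ∈ s, W j)
    have h4 : W i ⊓ (⨆ j ∈ s, W j) = ⊥ := by
      refine ((hW i).mono_right ?_).eq_bot
      exact iSup₂_le fun j hj => le_iSup₂_of_le j (fun h => hi (h ▸ hj)) le_rfl
    rw [h4, finrank_bot, add_zero] at h3
    exact h3

variable [NeZero p]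

theorem totalPiece_eq (n : ℕ) : totalPiece p n =
    ⨆ d ∈ Finset.finsuppAntidiag (Finset.univ : Finset (Fin p)) n, piece p d := by
  simp only [totalPiece, mem_finsuppAntidiag_univ]

theorem iSupIndep_piece : iSupIndep (piece p) :=
  (DirectSum.Decomposition.isInternal (piece p)).submodule_iSupIndep

instance finite_totalPiece (n : ℕ) : Module.Finite ℂ (totalPiece p n) := by
  rw [totalPiece_eq]
  exact (finrank_iSup_finset iSupIndep_piece _).1

theorem finrank_totalPiece (n : ℕ) : Module.finrank ℂ (totalPiece p n) =
    ∑ d ∈ Finset.finsuppAntidiag (Finset.univ : Finset (Fin p)) n,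
      Module.finrank ℂ (piece p d) := by
  rw [totalPiece_eq]
  exact (finrank_iSup_finset iSupIndep_piece _).2

theorem dimSeries_eq : dimSeries p =
    -1 + (2 + ∑ i, MvPowerSeries.X i) * (∏ i, (1 - MvPowerSeries.X i))⁻¹ := by
  classical
  rw [inv_prod_one_sub_X]
  ext d
  rw [map_add, map_neg, coeff_two_add_sum_X_mul, MvPowerSeries.coeff_one]
  change (Module.finrank ℂ (piece p d) : ℚ) = _
  by_cases hd : d = 0
  · rw [hd, finrank_piece_zero]
    norm_num
  · rw [if_neg hd, finrank_piece hd, neg_zero, zero_add]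
    push_cast
    rfl

theorem hilbertSeries_eq : hilbertSeries p =
    -1 + (2 + (p : PowerSeries ℚ) * PowerSeries.X) * ((1 - PowerSeries.X) ^ p)⁻¹ := by
  rw [inv_one_sub_X_pow (NeZero.pos p)]
  have h2 : (2 : PowerSeries ℚ) = PowerSeries.C (2 : ℚ) := (map_ofNat _ 2).symm
  have hp : (p : PowerSeries ℚ) = PowerSeries.C (p : ℚ) := (map_natCast _ p).symm
  ext n
  rw [hilbertSeries, PowerSeries.coeff_mk, map_add, map_neg, PowerSeries.coeff_one, add_mul,
    map_add, h2, hp, mul_assoc, PowerSeries.coeff_C_mul, PowerSeries.coeff_C_mul,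
    PowerSeries.coeff_mk, finrank_totalPiece]
  cases n with
  | zero =>
    have h0 : Finset.finsuppAntidiag (Finset.univ : Finset (Fin p)) 0 = {0} :=
      Finset.finsuppAntidiag_zero _
    rw [compCount, h0, Finset.sum_singleton, finrank_piece_zero, PowerSeries.coeff_zero_X_mul]
    norm_num
  | succ n =>
    rw [PowerSeries.coeff_succ_X_mul, PowerSeries.coeff_mk, if_neg (Nat.succ_ne_zero n)]
    have h : ∑ d ∈ Finset.finsuppAntidiag (Finset.univ : Finset (Fin p)) (n + 1),
        Module.finrank ℂ (piece p d) = 2 * compCount p (n + 1) + p * compCount p n := by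
      rw [← sum_card_support, compCount, mul_comm, ← smul_eq_mul, ← Finset.sum_const,
        ← Finset.sum_add_distrib]
      refine Finset.sum_congr rfl fun d hd => finrank_piece ?_
      rintro rfl
      rw [mem_finsuppAntidiag_univ] at hd
      simp at hd
    rw [h]
    push_cast
    ring

end series

end RootOfUnityGWA

theorem proposition4p5 (p : ℕ) [NeZero p] :
    -- `M` is identified with `ℕ^p`, and the components form a grading of `𝒜(p)` by `ℕ^p`
    Function.Bijective (RootOfUnityGWA.toM p) ∧
    Nonempty (GradedAlgebra (RootOfUnityGWA.piece p)) ∧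
    -- the multigraded dimension series
    (∀ d, Module.Finite ℂ (RootOfUnityGWA.piece p d)) ∧
    RootOfUnityGWA.dimSeries p =
      -1 + (2 + ∑ i, MvPowerSeries.X i) * (∏ i, (1 - MvPowerSeries.X i))⁻¹ ∧
    -- the Hilbert series
    (∀ n, Module.Finite ℂ (RootOfUnityGWA.totalPiece p n)) ∧
    RootOfUnityGWA.hilbertSeries p =
      -1 + (2 + (p : PowerSeries ℚ) * PowerSeries.X) * ((1 - PowerSeries.X) ^ p)⁻¹ :=
  ⟨⟨RootOfUnityGWA.toM_injective, RootOfUnityGWA.toM_surjective⟩,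
    ⟨RootOfUnityGWA.gradedAlgebraPiece⟩, RootOfUnityGWA.finite_piece,
    RootOfUnityGWA.dimSeries_eq, RootOfUnityGWA.finite_totalPiece,
    RootOfUnityGWA.hilbertSeries_eq⟩
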